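/- Let $W=C_0([0,1],\mathbb R^d)$ be the classical Wiener space with Wiener measure $\mu$, and let $H=\{h:\ h(t)=\int_0^t\dot h(s)\,ds,\ |h|_H^2=\int_0^1|\dot h(s)|^2ds<\infty\}$ be its Cameron–Martin space. Let $1<p<\infty$. For a separable Hilbert space $\Xi$ and a cylindrical function $F(w)=f(w(t_1),\dots,w(t_n))$ with $f$ a $\Xi$-valued Schwartz function, $\nabla F$ is the $H\otimes\Xi$-valued function determined by $(\nabla F(w),h)_H=\frac{d}{d\lambda}F(w+\lambda h)|_{\lambda=0}$, $h\in H$. A function $F\in L^p(\mu,\Xi)$ belongs to $\mathbb D_{p,1}(\Xi)$, with $\nabla F=G\in L^p(\mu,H\otimes\Xi)$, if there are cylindrical $F_m$ with $F_m\to F$ in $L^p(\mu,\Xi)$ and $\nabla F_m\to G$ in $L^p(\mu,H\otimes\Xi)$. Put $\nabla^0\varphi=\varphi$, $\mathbb D_{p,0}=L^p(\mu)$; for $k\ge 1$, $\varphi\in\mathbb D_{p,k}$ if $\varphi\in\mathbb D_{p,k-1}$ and $\nabla^{k-1}\varphi\in\mathbb D_{p,1}(H^{\otimes(k-1)})$,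 and then $\nabla^k\varphi=\nabla(\nabla^{k-1}\varphi)$. Let $P_t\varphi(x)=\int_W\varphi\big(e^{-t}x+\sqrt{1-e^{-2t}}\,y\big)\,\mu(dy)$ be the Ornstein–Uhlenbeck semigroup and $-\mathcal L$ its generator. For $\alpha>0$ let $$(I+\mathcal L)^{-\alpha}\varphi=\frac1{\Gamma(\alpha)}\int_0^\infty t^{\alpha-1}e^{-t}P_t\varphi\,dt ,\qquad \varphi\in L^p(\mu),$$ let $(I+\mathcal L)^0=I$, and let $(I+\mathcal L)^{\alpha}$, with domain the range of $(I+\mathcal L)^{-\alpha}$ on $L^p(\mu)$, be the inverse of $(I+\mathcal L)^{-\alpha}$. Then: 1. For every $\varphi\in L^p(\mu)$ one has $(I+\mathcal L)^{-1/2}\varphi\in\mathbb D_{p,1}$, and $\nabla(I+\mathcal L)^{-1/2}$ is a bounded linear operator from $L^p(\mu)$ to $L^p(\mu,H)$, with norm at most a constant depending only on $p$. 2. (Meyer inequalities.) For every $k\in\mathbb N$ there are constants $c_{p,k},\tilde c_{p,k}$, depending only on $p$ and $k$, such that a function $\varphi\in L^p(\mu)$ lies in the domain of $(I+\mathcal L)^{k/2}$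 if and only if $\varphi\in\mathbb D_{p,k}$, and in that case $$\sum_{i=0}^k\|\nabla^i\varphi\|_{L^p(\mu,H^{\otimes i})}\le c_{p,k}\,\|(I+\mathcal L)^{k/2}\varphi\|_{L^p(\mu)},\qquad \|(I+\mathcal L)^{k/2}\varphi\|_{L^p(\mu)}\le\tilde c_{p,k}\big(\|\varphi\|_{L^p(\mu)}+\|\nabla^k\varphi\|_{L^p(\mu,H^{\otimes k})}\big).$$ In particular the norms $\|(I+\mathcal L)^{k/2}\varphi\|_p$ and $\sum_{i\le k}\|\nabla^i\varphi\|_p$ are equivalent. -/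

import Mathlib

open MeasureTheory ProbabilityTheory Filter Topology
open scoped ENNReal SchwartzMap unitInterval

noncomputable section

namespace Wiener

/-! ### Classical Wiener space and Wiener measure -/

/-- The paths `w : [0,1] → ℝ^d` that are continuous with `w 0 = 0`. -/
def pathSubmodule (d : ℕ) : Submodule ℝ C(I, EuclideanSpace ℝ (Fin d)) where
  carrier := {w | w 0 = 0}
  add_mem' := by
    intro a b ha hb
    simp only [Set.mem_ofPred_eq] at ha hb
    simp [ha, hb]
  zero_mem' := by simp
  smul_mem' := by
    intro c a ha
    simp only [Set.mem_ofPred_eq] at ha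
    simp [ha]

/-- The classical Wiener space `W = C₀([0,1], ℝ^d)` (sup norm). -/
abbrev WienerSpace (d : ℕ) : Type := ↥(pathSubmodule d)

instance (d : ℕ) : MeasurableSpace (WienerSpace d) := borel _

instance (d : ℕ) : BorelSpace (WienerSpace d) := ⟨rfl⟩

/-- `μ` is the Wiener measure on `C₀([0,1], ℝ^d)`: under `μ` the coordinates `w ↦ w(t)ₐ` form a
centered Gaussian process with covariance `E[w(s)ₐ w(t)_b] = min(s,t) δ_{ab}`, that is, the
coordinate process is a standard `d`-dimensional Brownian motion. This determines `μ`. -/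
structure IsWienerMeasure {d : ℕ} (μ : Measure (WienerSpace d)) : Prop where
  isProbabilityMeasure : IsProbabilityMeasure μ
  isGaussianProcess :
    IsGaussianProcess (fun (i : I × Fin d) (w : WienerSpace d) => w.1 i.1 i.2) μ
  mean_zero : ∀ (t : I) (a : Fin d), ∫ w : WienerSpace d, w.1 t a ∂μ = 0
  covariance : ∀ (s t : I) (a b : Fin d),
    ∫ w : WienerSpace d, w.1 s a * w.1 t b ∂μ = if a = b then min (s : ℝ) (t : ℝ) else 0

/-! ### The Cameron–Martin space and its tensor powers -/

/-- Lebesgue measure on `[0,1]` times counting measure on the `d` coordinates. -/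
def cmMeasure (d : ℕ) : Measure (I × Fin d) := (volume : Measure I).prod Measure.count

instance (d : ℕ) : IsFiniteMeasure (cmMeasure d) := by
  unfold cmMeasure; infer_instance

/-- The Hilbert tensor product `H ⊗ Ξ` of the Cameron–Martin space `H` with a Hilbert space `Ξ`,
realised as `L²([0,1] × {1,…,d}; Ξ)`. A path `h ∈ H`, `h(t)ₐ = ∫₀ᵗ ḣₐ(s) ds`, is represented by
its density `ḣ ∈ L²([0,1]; ℝ^d)`, with `|h|_H = |ḣ|_{L²}`; thus `H` itself is `HTensor d ℝ`. -/
abbrev HTensor (d : ℕ) (Ξ : Type) [NormedAddCommGroup Ξ] : Type := Lp Ξ 2 (cmMeasure d)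

/-- The elementary tensor `h ⊗ ξ`, i.e. the kernel `(s, a) ↦ ḣₐ(s) • ξ`. -/
def elemTensor {d : ℕ} {Ξ : Type} [NormedAddCommGroup Ξ] [NormedSpace ℝ Ξ]
    (h : HTensor d ℝ) (ξ : Ξ) : HTensor d Ξ :=
  (ContinuousLinearMap.toSpanSingleton ℝ ξ).compLp h

/-- The element `U_{t,a}` of `H` with density `1_{[0,t]} eₐ`, so that `(U_{t,a}, h)_H = h(t)ₐ`. -/
def evalVec {d : ℕ} (t : I) (a : Fin d) : HTensor d ℝ :=
  indicatorConstLp 2 (s := Set.Iic t ×ˢ {a})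
    (measurableSet_Iic.prod (measurableSet_singleton a)) (measure_ne_top _ _) (1 : ℝ)

/-- A real inner product space, bundled so that the tensor powers can be defined by recursion. -/
structure InnerBundle : Type 1 where
  carrier : Type
  normed : NormedAddCommGroup carrier
  inner : InnerProductSpace ℝ carrier

/-- `H^{⊗0} = ℝ` and `H^{⊗(k+1)} = H ⊗ H^{⊗k}`. -/
def tensorBundle (d : ℕ) : ℕ → InnerBundle
  | 0 => ⟨ℝ, inferInstance, inferInstance⟩
  | k + 1 =>
    letI := (tensorBundle d k).normed
    letI := (tensorBundle d k).inner
    ⟨HTensor d (tensorBundle d k).carrier, inferInstance, inferInstance⟩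

/-- The Hilbert space `H^{⊗k}`. -/
def HPow (d k : ℕ) : Type := (tensorBundle d k).carrier

instance (d k : ℕ) : NormedAddCommGroup (HPow d k) := (tensorBundle d k).normed

instance (d k : ℕ) : InnerProductSpace ℝ (HPow d k) := (tensorBundle d k).inner

/-! ### The Gross–Sobolev derivative -/

section Gradient

variable {d : ℕ} {Ξ : Type} [NormedAddCommGroup Ξ] [NormedSpace ℝ Ξ]

/-- The cylindrical function `w ↦ f(w(t₁), …, w(tₙ))`, with `f` a `Ξ`-valued Schwartz function. -/
def cyl {n : ℕ} (t : Fin n → I) (f : 𝓢(Fin n → EuclideanSpace ℝ (Fin d), Ξ))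
    (w : WienerSpace d) : Ξ :=
  f fun i => w.1 (t i)

/-- The derivative of a cylindrical function,
`∇F(w) = ∑_{i,a} U_{tᵢ,a} ⊗ ∂_{i,a} f(w(t₁), …, w(tₙ))`, so that
`(∇F(w), h)_H = d/dλ F(w + λ h)` at `λ = 0`. -/
def cylGrad {n : ℕ} (t : Fin n → I) (f : 𝓢(Fin n → EuclideanSpace ℝ (Fin d), Ξ))
    (w : WienerSpace d) : HTensor d Ξ :=
  ∑ i : Fin n, ∑ a : Fin d, elemTensor (evalVec (t i) a)
    (fderiv ℝ f (fun j => w.1 (t j)) (Pi.single i (EuclideanSpace.single a (1 : ℝ))))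

/-- `F ∈ 𝔻_{p,1}(Ξ)` and `∇F = G`: there are cylindrical `F_m` with `F_m → F` in `L^p(μ, Ξ)` and
`∇F_m → G` in `L^p(μ, H ⊗ Ξ)`. -/
def HasGrad {μ : Measure (WienerSpace d)} {p : ℝ≥0∞}
    (F : Lp Ξ p μ) (G : Lp (HTensor d Ξ) p μ) : Prop :=
  ∃ (n : ℕ → ℕ) (t : ∀ m, Fin (n m) → I)
    (f : ∀ m, 𝓢(Fin (n m) → EuclideanSpace ℝ (Fin d), Ξ)),
    Tendsto (fun m => eLpNorm (fun w => cyl (t m) (f m) w - F w) p μ) atTop (𝓝 0) ∧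
    Tendsto (fun m => eLpNorm (fun w => cylGrad (t m) (f m) w - G w) p μ) atTop (𝓝 0)

end Gradient

/-- `φ ∈ 𝔻_{p,k}` and `∇ᵏφ = G`, by iteration: `∇⁰φ = φ`, and `∇ᵏ⁺¹φ = ∇(∇ᵏφ)` where
`∇ᵏφ ∈ 𝔻_{p,1}(H^{⊗k})`. -/
def HasIterGrad {d : ℕ} {μ : Measure (WienerSpace d)} {p : ℝ≥0∞} (φ : Lp ℝ p μ) :
    (k : ℕ) → Lp (HPow d k) p μ → Prop
  | 0, G => G = φ
  | k + 1, G => ∃ G' : Lp (HPow d k) p μ, HasIterGrad φ k G' ∧ HasGrad (Ξ := HPow d k) G' G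

/-- `φ ∈ 𝔻_{p,k}`. -/
def MemSobolev {d : ℕ} {μ : Measure (WienerSpace d)} {p : ℝ≥0∞} (k : ℕ) (φ : Lp ℝ p μ) : Prop :=
  ∃ G : Lp (HPow d k) p μ, HasIterGrad φ k G

/-! ### The Ornstein–Uhlenbeck semigroup and the powers of `I + 𝓛` -/

/-- The Ornstein–Uhlenbeck semigroup `P_t = e^{-t𝓛}`, by Mehler's formula. -/
def ouSemigroup {d : ℕ} (μ : Measure (WienerSpace d)) (t : ℝ) (φ : WienerSpace d → ℝ)
    (x : WienerSpace d) : ℝ :=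
  ∫ y, φ (Real.exp (-t) • x + √(1 - Real.exp (-2 * t)) • y) ∂μ

/-- The negative power `(I + 𝓛)^{-α}`, `α ≥ 0`, where `-𝓛` is the generator of `P_t`:
`(I + 𝓛)^{-α} φ = Γ(α)⁻¹ ∫₀^∞ t^{α-1} e^{-t} P_t φ dt` for `α > 0`, and the identity for `α = 0`. -/
def ouNegPow {d : ℕ} (μ : Measure (WienerSpace d)) (α : ℝ) (φ : WienerSpace d → ℝ)
    (x : WienerSpace d) : ℝ :=
  if α = 0 then φ x
  else (Real.Gamma α)⁻¹ *
    ∫ t in Set.Ioi (0 : ℝ), t ^ (α - 1) * Real.exp (-t) * ouSemigroup μ t φ x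

/-- `φ` lies in the `L^p` domain of `(I + 𝓛)^α` and `(I + 𝓛)^α φ = ψ`, where `(I + 𝓛)^α` is the
inverse of the operator `(I + 𝓛)^{-α}` on `L^p(μ)`. -/
def HasOUPow {d : ℕ} {μ : Measure (WienerSpace d)} {p : ℝ≥0∞} (α : ℝ) (φ ψ : Lp ℝ p μ) : Prop :=
  φ =ᵐ[μ] ouNegPow μ α ψ

end Wiener

end

/-! Pisier's rotation argument reduces the inequalities to M. Riesz's theorem on the conjugate
function. Put `T_θ F(x) = ∫ F(cos θ x + sin θ y) μ(dy)`, which is `P_t` when `cos θ = exp(-t)`.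
Gaussian integration by parts in `y` shows that `sin θ T_θ(∇F)(x)` is the first chaos, in the
variable `y`, of `F(cos θ x + sin θ y)`. After the substitution `s = -log cos θ` in the gamma
integral, `∇((c+1)I + 𝓛)^{-1/2} F(x)` becomes the first chaos of `y ↦ ∫₀^π k(θ) [F(cos θ x + sin θ
y) - F(cos θ x - sin θ y)] dθ`, where `k` differs from a multiple of `cot(θ/2)` by a bounded
function (`exists_gradL_eq`).

Rotations of the pair `(x, y)` preserve `μ × μ`, and along an orbit this integral is a singular
integral on the circle. Its `L^p` bound is therefore transferred from
`exists_lintegral_singularIntegral_le` by `lintegral_rieszDouble_le`. Taking the first chaos costs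
only a Gaussian moment (`enorm_gradL_le`), so no constant sees the dimension or the Hilbert space of
values. The result, `exists_norm_pot_grad_le`, gives the first claim. The parameter `c` is carried
along because `∇P_t = exp(-t) P_t ∇`: each derivative raises `c` by one.

The converse is by duality. In weak form `𝓛 = ∇*∇` (`pairLp_eq_of_mem_gradGraph`), so a half power
of the operator is controlled by the function, its gradient, and the Riesz transform on the
conjugate exponent `q` (`exists_norm_pot_zero_le`). Applying this to difference quotients of the
semigroup and passing to the limit in a closed graph produces `((c+1)I + 𝓛)^{1/2} F` for every `F`
with a gradient (`exists_eq_pot_of_mem_gradGraph`).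

Both directions are iterated one half power at a time. The intermediate derivatives are removed from
the second inequality by interpolation: the gradient splits into `G - T_θ G`, controlled by the next
derivative, and `T_θ G`, controlled by the function through smoothing (`norm_grad_le`). -/

noncomputable section

set_option linter.unusedSectionVars false

/-! ### M. Riesz's theorem on the conjugate function. -/

namespace ConjugateFunction

open Real

/-- For `1 < p ≤ 2` one has `|sin a|^p ≤ A cos^p a - B cos (p a)` on `(-π/2, π/2)`. -/
theorem exists_abs_sin_rpow_le {p : ℝ} (hp1 : 1 < p) (hp2 : p ≤ 2) :
    ∃ A B : ℝ, 0 ≤ A ∧ 0 ≤ B ∧ ∀ a : ℝ, |a| < π / 2 →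
      |sin a| ^ p ≤ A * cos a ^ p - B * cos (a * p) := by
  have hpi := pi_pos
  have hneg : cos (π / 2 * p) < 0 := by
    apply cos_neg_of_pi_div_two_lt_of_lt <;> nlinarith
  -- For `1 < p ≤ 2` the angle `pπ/2` lies in `(π/2, π]`, so `-cos(pa)` stays above `c > 0` near `a
  -- = ±π/2`, and `B = 1/c` makes that term at least `1 ≥ |sin a|^p`. Away from the ends `cos a ≥
  -- sin η`, and `A` is chosen to pay for both `1` and `B cos(pa)`.
  set c : ℝ := -cos (π / 2 * p) / 2 with hc
  have hcpos : 0 < c := by rw [hc]; linarith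
  have hcont : ContinuousAt (fun a : ℝ => cos (a * p)) (π / 2) := by fun_prop
  have hev : ∀ᶠ a in 𝓝 (π / 2), cos (a * p) < -c :=
    hcont.eventually_lt continuousAt_const (by rw [hc]; linarith)
  obtain ⟨δ, hδ, hball⟩ := Metric.eventually_nhds_iff.1 hev
  set η : ℝ := min δ (π / 2) with hη
  have hη0 : 0 < η := lt_min hδ (by linarith)
  have hηpi : η ≤ π / 2 := min_le_right _ _
  have hsin : 0 < sin η := sin_pos_of_pos_of_lt_pi hη0 (by linarith)
  refine ⟨(1 + c⁻¹) / sin η ^ p, c⁻¹, by positivity, by positivity, fun a ha => ?_⟩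
  have hcosa : 0 < cos a := cos_pos_of_mem_Ioo ⟨by linarith [abs_lt.1 ha], by linarith [abs_lt.1 ha]⟩
  have hs1 : |sin a| ^ p ≤ 1 := rpow_le_one (abs_nonneg _) (abs_sin_le_one a) (by linarith)
  have hcabs : cos (a * p) = cos (|a| * p) := by
    rcases abs_choice a with h | h <;> rw [h]
    rw [neg_mul, cos_neg]
  have hA : 0 ≤ (1 + c⁻¹) / sin η ^ p * cos a ^ p := by positivity
  by_cases h : π / 2 - |a| < η
  · have : cos (|a| * p) < -c := by
      apply hball
      rw [dist_eq, abs_sub_comm, abs_of_pos (by linarith)]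
      exact h.trans_le (min_le_left _ _)
    rw [hcabs]
    have h2 : c⁻¹ * cos (|a| * p) ≤ c⁻¹ * (-c) := by gcongr
    rw [mul_neg, inv_mul_cancel₀ hcpos.ne'] at h2
    linarith
  · push Not at h
    have h1 : sin η ≤ cos a := by
      rw [← cos_abs a, ← sin_pi_div_two_sub]
      exact sin_le_sin_of_le_of_le_pi_div_two (by linarith) (by linarith [abs_nonneg a]) h
    have h2 : (1 + c⁻¹) ≤ (1 + c⁻¹) / sin η ^ p * cos a ^ p := by
      rw [div_mul_eq_mul_div, le_div_iff₀ (by positivity)]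
      gcongr
    have h3 : c⁻¹ * cos (a * p) ≤ c⁻¹ * 1 := by gcongr; exact cos_le_one _
    linarith

/-- `|Im z|^p ≤ A (Re z)^p - B Re (z^p)` on the right half plane, for `1 < p ≤ 2`. -/
theorem exists_abs_im_rpow_le {p : ℝ} (hp1 : 1 < p) (hp2 : p ≤ 2) :
    ∃ A B : ℝ, 0 ≤ A ∧ 0 ≤ B ∧ ∀ z : ℂ, 0 < z.re →
      |z.im| ^ p ≤ A * z.re ^ p - B * (z ^ (p : ℂ)).re := by
  obtain ⟨A, B, hA, hB, h⟩ := exists_abs_sin_rpow_le hp1 hp2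
  refine ⟨A, B, hA, hB, fun z hz => ?_⟩
  have harg : |z.arg| < π / 2 := Complex.abs_arg_lt_pi_div_two_iff.2 (Or.inl hz)
  have hz0 : z ≠ 0 := fun h0 => by simp [h0] at hz
  have hn : 0 < ‖z‖ := norm_pos_iff.2 hz0
  have hcos : 0 ≤ cos z.arg :=
    (cos_pos_of_mem_Ioo ⟨by linarith [abs_lt.1 harg], by linarith [abs_lt.1 harg]⟩).le
  have hre : z.re = ‖z‖ * cos z.arg := by rw [Complex.norm_mul_cos_arg]
  have him : z.im = ‖z‖ * sin z.arg := by rw [Complex.norm_mul_sin_arg]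
  rw [Complex.cpow_ofReal_re, him, abs_mul, abs_of_pos hn, mul_rpow hn.le (abs_nonneg _)]
  rw [hre, mul_rpow hn.le hcos]
  calc ‖z‖ ^ p * |sin z.arg| ^ p
      ≤ ‖z‖ ^ p * (A * cos z.arg ^ p - B * cos (z.arg * p)) := by gcongr; exact h _ harg
    _ = _ := by ring

/-- Young's inequality for averages of the translates of a periodic function. -/
theorem lintegral_rpow_lintegral_translate_le {p T : ℝ} (hp : 1 ≤ p) (hT : 0 < T) {g : ℝ → ℝ≥0∞}
    (hg : Measurable g) (hper : Function.Periodic g T) (ν : Measure ℝ) [SFinite ν] :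
    ∫⁻ s in Set.Ioc 0 T, (∫⁻ θ, g (s - θ) ∂ν) ^ p ≤
      ν Set.univ ^ p * ∫⁻ s in Set.Ioc 0 T, g s ^ p := by
  have hp0 : 0 < p := by linarith
  have hgm : Measurable fun z : ℝ × ℝ => g (z.1 - z.2) ^ p := by fun_prop
  -- Hölder against the constant `1`; after integrating in `s`, periodicity makes every translate
  -- contribute the same amount.
  have key : ∀ s, (∫⁻ θ, g (s - θ) ∂ν) ^ p ≤ ν Set.univ ^ (p - 1) * ∫⁻ θ, g (s - θ) ^ p ∂ν := by
    intro s
    rcases eq_or_lt_of_le hp with h1 | h1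
    · simp [← h1]
    have hpq : p.HolderConjugate (p.conjExponent) := Real.HolderConjugate.conjExponent h1
    have hm : Measurable fun θ => g (s - θ) := by fun_prop
    have := ENNReal.lintegral_mul_le_Lp_mul_Lq ν hpq hm.aemeasurable
      (aemeasurable_const (b := (1 : ℝ≥0∞)))
    simp only [Pi.mul_apply, mul_one, ENNReal.one_rpow, lintegral_const, one_mul] at this
    calc (∫⁻ θ, g (s - θ) ∂ν) ^ p
        ≤ ((∫⁻ θ, g (s - θ) ^ p ∂ν) ^ (1 / p) * ν Set.univ ^ (1 / p.conjExponent)) ^ p := by gcongr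
      _ = _ := by
        rw [ENNReal.mul_rpow_of_nonneg _ _ hp0.le, ← ENNReal.rpow_mul, ← ENNReal.rpow_mul,
          one_div_mul_cancel hp0.ne', ENNReal.rpow_one, mul_comm]
        congr 2
        rw [Real.conjExponent]
        field_simp
  calc ∫⁻ s in Set.Ioc 0 T, (∫⁻ θ, g (s - θ) ∂ν) ^ p
      ≤ ∫⁻ s in Set.Ioc 0 T, ν Set.univ ^ (p - 1) * ∫⁻ θ, g (s - θ) ^ p ∂ν := by
        gcongr with s; exact key s
    _ = ν Set.univ ^ (p - 1) * ∫⁻ θ, (∫⁻ s in Set.Ioc 0 T, g (s - θ) ^ p) ∂ν := by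
        rw [lintegral_const_mul _ (by exact Measurable.lintegral_prod_right' hgm),
          lintegral_lintegral_swap hgm.aemeasurable]
    _ = ν Set.univ ^ (p - 1) * ∫⁻ θ, (∫⁻ s in Set.Ioc 0 T, g s ^ p) ∂ν := by
        congr 2 with θ
        have h1 : ∫⁻ s in Set.Ioc 0 T, g (s - θ) ^ p = ∫⁻ s in Set.Ioc (0 - θ) (T - θ), g s ^ p := by
          have := (measurePreserving_sub_right volume θ).setLIntegral_comp_preimage_emb
            (MeasurableEquiv.subRight θ).measurableEmbedding (fun s => g s ^ p)
            (Set.Ioc (0 - θ) (T - θ))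
          rw [← this]
          congr 2
          ext x; simp
        rw [h1]
        have hper' : Function.Periodic (fun s => g s ^ p) T := fun s => by simp [hper s]
        have h2 : T - θ = (0 - θ) + T := by ring
        have h3 : Set.Ioc 0 T = Set.Ioc 0 (0 + T) := by simp
        rw [h2, h3]
        exact (isAddFundamentalDomain_Ioc hT _).setLIntegral_eq (isAddFundamentalDomain_Ioc hT _)
          (fun s => g s ^ p) hper'.map_vadd_zmultiples
    _ = _ := by
        rw [lintegral_const, mul_comm (lintegral _ _), ← mul_assoc]
        congr 1
        by_cases h0 : ν Set.univ = 0
        · rw [h0, mul_zero, ENNReal.zero_rpow_of_pos hp0]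
        · by_cases ht : ν Set.univ = ⊤
          · rw [ht, ENNReal.top_rpow_of_pos hp0, ENNReal.mul_top]
            rcases eq_or_lt_of_le hp with h1 | h1
            · simp [← h1]
            · rw [ENNReal.top_rpow_of_pos (by linarith)]; simp
          · nth_rw 2 [← ENNReal.rpow_one (ν Set.univ)]
            rw [← ENNReal.rpow_add _ _ h0 ht]; congr 1; ring

/-- The conjugate Poisson kernel. -/
def conjKernel (r θ : ℝ) : ℝ := 2 * r * sin θ / (1 - 2 * r * cos θ + r ^ 2)

/-- The Poisson kernel of the unit disk. -/
def poisKernel (r θ : ℝ) : ℝ := (1 - r ^ 2) / (1 - 2 * r * cos θ + r ^ 2)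

theorem denom_pos {r : ℝ} (hr0 : 0 ≤ r) (hr1 : r < 1) (θ : ℝ) :
    0 < 1 - 2 * r * cos θ + r ^ 2 := by
  nlinarith [cos_le_one θ, mul_nonneg hr0 (sub_nonneg.2 (cos_le_one θ)), sq_pos_of_pos (sub_pos.2 hr1)]

@[fun_prop]
theorem continuous_conjKernel {r : ℝ} (hr0 : 0 ≤ r) (hr1 : r < 1) : Continuous (conjKernel r) := by
  unfold conjKernel
  exact Continuous.div (by fun_prop) (by fun_prop) fun θ => (denom_pos hr0 hr1 θ).ne'

@[fun_prop]
theorem continuous_poisKernel {r : ℝ} (hr0 : 0 ≤ r) (hr1 : r < 1) : Continuous (poisKernel r) := by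
  unfold poisKernel
  exact Continuous.div (by fun_prop) (by fun_prop) fun θ => (denom_pos hr0 hr1 θ).ne'

theorem conjKernel_neg (r θ : ℝ) : conjKernel r (-θ) = -conjKernel r θ := by
  simp [conjKernel, neg_div]

theorem conjKernel_periodic (r : ℝ) : Function.Periodic (conjKernel r) (2 * π) := fun θ => by
  simp [conjKernel]

theorem poisKernel_periodic (r : ℝ) : Function.Periodic (poisKernel r) (2 * π) := fun θ => by
  simp [poisKernel]

theorem poisKernel_pos {r : ℝ} (hr0 : 0 ≤ r) (hr1 : r < 1) (θ : ℝ) : 0 < poisKernel r θ :=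
  div_pos (by nlinarith) (denom_pos hr0 hr1 θ)

/-- The point of the Herglotz kernel is holomorphy: averaging a real function against it gives a
holomorphic function on the disk, whose real and imaginary parts are the Poisson and conjugate
Poisson integrals. -/
theorem herglotz_circleMap {r : ℝ} (hr0 : 0 ≤ r) (hr1 : r < 1) (s η : ℝ) :
    herglotzRieszKernel 0 (circleMap 0 r s) (circleMap 0 1 η) =
      ⟨poisKernel r (s - η), conjKernel r (s - η)⟩ := by
  have hden : (circleMap 0 1 η - circleMap 0 r s) ≠ 0 := by
    intro h
    have h2 : ‖circleMap 0 1 η‖ = ‖circleMap 0 r s‖ := by rw [sub_eq_zero.1 h]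
    simp [abs_of_nonneg hr0] at h2
    linarith
  have hp := (denom_pos hr0 hr1 (s - η)).ne'
  rw [herglotzRieszKernel_def, sub_zero, sub_zero, div_eq_iff hden]
  have h1 : circleMap 0 1 η = ⟨cos η, sin η⟩ := by
    apply Complex.ext <;> simp [circleMap, Complex.exp_re, Complex.exp_im]
  have h2 : circleMap 0 r s = ⟨r * cos s, r * sin s⟩ := by
    apply Complex.ext <;> simp [circleMap, Complex.exp_re, Complex.exp_im]
  rw [h1, h2]
  have e1 := cos_sub s η
  have e2 := sin_sub s η
  have e3 := sin_sq_add_cos_sq s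
  have e4 := sin_sq_add_cos_sq η
  unfold poisKernel conjKernel
  apply Complex.ext
  · simp only [Complex.add_re, Complex.mul_re, Complex.sub_re, Complex.sub_im]
    rw [div_mul_eq_mul_div, div_mul_eq_mul_div, ← sub_div, eq_div_iff hp, e1, e2]
    clear hp hden h1 h2 e1 e2
    generalize cos s = x at *
    generalize sin s = y at *
    generalize cos η = z at *
    generalize sin η = w at *
    have hx : x ^ 2 = 1 - y ^ 2 := by linarith
    have hz : z ^ 2 = 1 - w ^ 2 := by linarith
    ring_nf
    grind
  · simp only [Complex.add_im, Complex.mul_im, Complex.sub_re, Complex.sub_im]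
    rw [div_mul_eq_mul_div, div_mul_eq_mul_div, ← add_div, eq_div_iff hp, e1, e2]
    clear hp hden h1 h2 e1 e2
    generalize cos s = x at *
    generalize sin s = y at *
    generalize cos η = z at *
    generalize sin η = w at *
    have hx : x ^ 2 = 1 - y ^ 2 := by linarith
    have hz : z ^ 2 = 1 - w ^ 2 := by linarith
    ring_nf
    grind

/-- Allows a periodic function of the angle to be read as a function on the unit circle, in spite of
the jump of `Complex.arg`. -/
theorem periodic_arg_circleMap {g : ℝ → ℝ} (hper : Function.Periodic g (2 * π)) (η : ℝ) :
    g (circleMap 0 1 η).arg = g η := by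
  have : circleMap 0 1 η = Complex.exp (η * Complex.I) := by simp [circleMap]
  rw [this, Complex.arg_exp_mul_I]
  rw [toIocMod]
  exact hper.sub_zsmul_eq _


/-- The Herglotz integral `F` of a positive `g` has positive real part, so `F^p` is holomorphic. By
the mean value property the average of `Re F^p` on the circle of radius `r` is `Re F(0)^p`, which is
nonnegative because `F(0)` is a nonnegative real. Hence the term `-B Re F^p` can be dropped when the
pointwise inequality is integrated. -/
theorem exists_integral_conj_rpow_le {p : ℝ} (hp1 : 1 < p) (hp2 : p ≤ 2) :
    ∃ A : ℝ, 0 ≤ A ∧ ∀ (r : ℝ), 0 ≤ r → r < 1 → ∀ g : ℝ → ℝ, Continuous g →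
      Function.Periodic g (2 * π) → (∀ s, 0 < g s) →
      ∫ s in 0..2 * π, |(2 * π)⁻¹ * ∫ η in 0..2 * π, conjKernel r (s - η) * g η| ^ p ≤
        A * ∫ s in 0..2 * π, ((2 * π)⁻¹ * ∫ η in 0..2 * π, poisKernel r (s - η) * g η) ^ p := by
  obtain ⟨A, B, hA, hB, hAB⟩ := exists_abs_im_rpow_le hp1 hp2
  refine ⟨A, hA, fun r hr0 hr1 g hg hper hpos => ?_⟩
  have hpi := pi_pos
  set u : ℝ → ℝ := fun s => (2 * π)⁻¹ * ∫ η in 0..2 * π, poisKernel r (s - η) * g η with hu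
  set v : ℝ → ℝ := fun s => (2 * π)⁻¹ * ∫ η in 0..2 * π, conjKernel r (s - η) * g η with hv
  set f : ℂ → ℂ := fun ζ => (g ζ.arg : ℂ) with hf
  have hfc : ∀ η, f (circleMap 0 1 η) = g η := fun η => by
    rw [hf]; simp only; rw [periodic_arg_circleMap hper]
  have hint : CircleIntegrable f 0 1 := by
    rw [CircleIntegrable]
    simp_rw [hfc]
    exact (Complex.continuous_ofReal.comp hg).intervalIntegrable _ _
  set F : ℂ → ℂ := fun w => circleAverage (fun ζ ↦ herglotzRieszKernel 0 w ζ • f ζ) 0 1 with hF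
  have hdiff : DifferentiableOn ℂ F (Metric.ball 0 1) :=
    differentiableOn_circleAverage_herglotzRieszKernel_smul hint
  have hu_cont : Continuous u := by
    refine continuous_const.mul ?_
    refine intervalIntegral.continuous_parametric_intervalIntegral_of_continuous' ?_ _ _
    have := continuous_poisKernel hr0 hr1
    fun_prop
  have hv_cont : Continuous v := by
    refine continuous_const.mul ?_
    refine intervalIntegral.continuous_parametric_intervalIntegral_of_continuous' ?_ _ _
    have := continuous_conjKernel hr0 hr1
    fun_prop
  have hFval : ∀ r', 0 ≤ r' → r' < 1 → ∀ s, F (circleMap 0 r' s) =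
      ⟨(2 * π)⁻¹ * ∫ η in 0..2 * π, poisKernel r' (s - η) * g η,
        (2 * π)⁻¹ * ∫ η in 0..2 * π, conjKernel r' (s - η) * g η⟩ := by
    intro r' h0 h1 s
    have hc1 : Continuous fun η => poisKernel r' (s - η) * g η := by
      have := continuous_poisKernel h0 h1
      fun_prop
    have hc2 : Continuous fun η => conjKernel r' (s - η) * g η := by
      have := continuous_conjKernel h0 h1
      fun_prop
    have e1 : F (circleMap 0 r' s) = (2 * π)⁻¹ • ∫ η in 0..2 * π,
        ((poisKernel r' (s - η) * g η : ℝ) + (conjKernel r' (s - η) * g η : ℝ) * Complex.I : ℂ) := by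
      simp only [hF, circleAverage_def]
      congr 1
      refine intervalIntegral.integral_congr fun η _ => ?_
      simp only [hfc, herglotz_circleMap h0 h1, smul_eq_mul]
      apply Complex.ext <;> simp
    rw [e1, intervalIntegral.integral_add, intervalIntegral.integral_mul_const,
      intervalIntegral.integral_ofReal, intervalIntegral.integral_ofReal]
    · apply Complex.ext <;> simp
    · exact (Complex.continuous_ofReal.comp hc1).intervalIntegrable _ _
    · exact ((Complex.continuous_ofReal.comp hc2).mul continuous_const).intervalIntegrable _ _
  have hre : ∀ w ∈ Metric.ball (0 : ℂ) 1, 0 < (F w).re := by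
    intro w hw
    have hw' : ‖w‖ < 1 := by simpa using hw
    have : w = circleMap 0 ‖w‖ w.arg := by simp [circleMap]
    rw [this, hFval _ (norm_nonneg _) hw']
    refine mul_pos (by positivity) ?_
    have := continuous_poisKernel (norm_nonneg w) hw'
    refine intervalIntegral.intervalIntegral_pos_of_pos ?_ (fun η => ?_) (by positivity)
    · exact Continuous.intervalIntegrable (by fun_prop) _ _
    · exact mul_pos (poisKernel_pos (norm_nonneg _) hw' _) (hpos _)
  have hFs : ∀ s, F (circleMap 0 r s) = ⟨u s, v s⟩ := hFval r hr0 hr1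
  have hmem : ∀ s, circleMap 0 r s ∈ Metric.ball (0 : ℂ) 1 := fun s => by
    simp [abs_of_nonneg hr0, hr1]
  have hupos : ∀ s, 0 < u s := fun s => by
    have := hre _ (hmem s); rw [hFs] at this; exact this
  have hpow : DifferentiableOn ℂ (fun w => F w ^ (p : ℂ)) (Metric.ball 0 1) := by
    refine hdiff.cpow_const fun w hw => Or.inl (hre w hw)
  have hmv : circleAverage (fun w => F w ^ (p : ℂ)) 0 r = F 0 ^ (p : ℂ) := by
    apply DiffContOnCl.circleAverage
    apply DifferentiableOn.diffContOnCl
    apply hpow.mono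
    rw [abs_of_nonneg hr0]
    exact Metric.closure_ball_subset_closedBall.trans (Metric.closedBall_subset_ball hr1)
  -- The conjugate kernel vanishes at radius zero, so `F(0)` is real.
  have hF0 : ∃ a : ℝ, 0 ≤ a ∧ F 0 = a := by
    refine ⟨(F 0).re, (hre 0 (by simp)).le, ?_⟩
    have := hFval 0 le_rfl one_pos 0
    rw [circleMap_zero_radius] at this
    simp only [Function.const_apply] at this
    apply Complex.ext
    · simp
    · rw [this]; simp [conjKernel]
  have hF0p : 0 ≤ (F 0 ^ (p : ℂ)).re := by
    obtain ⟨a, ha, hFa⟩ := hF0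
    rw [hFa, ← Complex.ofReal_cpow ha, Complex.ofReal_re]
    positivity
  have hcont_pow : Continuous fun s => F (circleMap 0 r s) ^ (p : ℂ) := by
    simp_rw [hFs]
    have hc : Continuous fun s => (⟨u s, v s⟩ : ℂ) := by
      have : (fun s => (⟨u s, v s⟩ : ℂ)) = fun s => (u s : ℂ) + v s * Complex.I := by
        ext s; apply Complex.ext <;> simp
      rw [this]; fun_prop
    exact hc.cpow continuous_const fun s => Or.inl (hupos s)
  have hint_re : 0 ≤ ∫ s in 0..2 * π, (F (circleMap 0 r s) ^ (p : ℂ)).re := by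
    have h1 : (circleAverage (fun w => F w ^ (p : ℂ)) 0 r).re =
        (2 * π)⁻¹ * ∫ s in 0..2 * π, (F (circleMap 0 r s) ^ (p : ℂ)).re := by
      rw [circleAverage_def, Complex.smul_re, smul_eq_mul]
      congr 1
      exact (Complex.reCLM.intervalIntegral_comp_comm (hcont_pow.intervalIntegrable _ _)).symm
    rw [hmv] at h1
    rw [h1] at hF0p
    exact (mul_nonneg_iff_of_pos_left (by positivity)).1 hF0p
  have hle : ∫ s in 0..2 * π, |v s| ^ p ≤
      ∫ s in 0..2 * π, (A * u s ^ p - B * (F (circleMap 0 r s) ^ (p : ℂ)).re) := by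
    apply intervalIntegral.integral_mono_on (by positivity)
    · exact (Continuous.rpow_const hv_cont.abs fun _ => Or.inr (by linarith)).intervalIntegrable _ _
    · refine Continuous.intervalIntegrable ?_ _ _
      refine Continuous.sub (continuous_const.mul
        (hu_cont.rpow_const fun _ => Or.inr (by linarith))) ?_
      exact continuous_const.mul (Complex.continuous_re.comp hcont_pow)
    · intro s _
      have := hAB (F (circleMap 0 r s)) (hre _ (hmem s))
      rw [hFs] at this ⊢
      exact this
  rw [intervalIntegral.integral_sub, intervalIntegral.integral_const_mul,
    intervalIntegral.integral_const_mul] at hle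
  · have := mul_nonneg hB hint_re
    linarith
  · exact (continuous_const.mul
        (hu_cont.rpow_const fun _ => Or.inr (by linarith))).intervalIntegrable _ _
  · exact (continuous_const.mul (Complex.continuous_re.comp hcont_pow)).intervalIntegrable _ _

/-! ### The conjugate Poisson integral. -/

section Basic

variable {E : Type*} [NormedAddCommGroup E] [NormedSpace ℝ E]

/-- The conjugate Poisson integral of a periodic function. -/
def conjInt (r : ℝ) (g : ℝ → E) (s : ℝ) : E :=
  ∫ θ in Set.Ioc (-π) π, conjKernel r θ • g (s - θ)

theorem conjInt_eq_intervalIntegral (r : ℝ) {g : ℝ → E} (hper : Function.Periodic g (2 * π)) (s : ℝ) :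
    conjInt r g s = ∫ η in 0..2 * π, conjKernel r (s - η) • g η := by
  have hper' : Function.Periodic (fun θ => conjKernel r θ • g (s - θ)) (2 * π) := fun θ => by
    have : g (s - (θ + 2 * π)) = g (s - θ) := by
      rw [← hper (s - (θ + 2 * π))]; congr 1; ring
    simp only [conjKernel_periodic r θ, this]
  have h1 := intervalIntegral.integral_comp_sub_left (a := 0) (b := 2 * π)
    (fun θ => conjKernel r θ • g (s - θ)) s
  simp only [sub_sub_cancel, sub_zero] at h1
  rw [h1, conjInt, ← intervalIntegral.integral_of_le (by linarith [pi_pos])]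
  have h2 := hper'.intervalIntegral_add_eq (-π) (s - 2 * π)
  rw [show -π + 2 * π = π by ring, show s - 2 * π + 2 * π = s by ring] at h2
  exact h2

theorem integrableOn_conjInt {r : ℝ} (hr0 : 0 ≤ r) (hr1 : r < 1) {g : ℝ → E} (hg : Continuous g)
    (s : ℝ) : IntegrableOn (fun θ => conjKernel r θ • g (s - θ)) (Set.Ioc (-π) π) := by
  have := continuous_conjKernel hr0 hr1
  have hc : Continuous fun θ => conjKernel r θ • g (s - θ) := by fun_prop
  exact (hc.integrableOn_Icc).mono_set Set.Ioc_subset_Icc_self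

theorem conjInt_sub {r : ℝ} (hr0 : 0 ≤ r) (hr1 : r < 1) {g h : ℝ → E} (hg : Continuous g)
    (hh : Continuous h) (s : ℝ) :
    conjInt r (fun x => g x - h x) s = conjInt r g s - conjInt r h s := by
  simp only [conjInt, smul_sub]
  exact integral_sub (integrableOn_conjInt hr0 hr1 hg s) (integrableOn_conjInt hr0 hr1 hh s)

theorem conjInt_add {r : ℝ} (hr0 : 0 ≤ r) (hr1 : r < 1) {g h : ℝ → E} (hg : Continuous g)
    (hh : Continuous h) (s : ℝ) :
    conjInt r (fun x => g x + h x) s = conjInt r g s + conjInt r h s := by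
  simp only [conjInt, smul_add]
  exact integral_add (integrableOn_conjInt hr0 hr1 hg s) (integrableOn_conjInt hr0 hr1 hh s)

theorem continuous_conjInt {r : ℝ} (hr0 : 0 ≤ r) (hr1 : r < 1) {g : ℝ → E} (hg : Continuous g) :
    Continuous (conjInt r g) := by
  have := continuous_conjKernel hr0 hr1
  have : conjInt r g = fun s => ∫ θ in (-π)..π, conjKernel r θ • g (s - θ) := by
    ext s
    rw [conjInt, intervalIntegral.integral_of_le (by linarith [pi_pos])]
  rw [this]
  exact intervalIntegral.continuous_parametric_intervalIntegral_of_continuous' (by fun_prop) _ _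

theorem periodic_conjInt (r : ℝ) {g : ℝ → E} (hper : Function.Periodic g (2 * π)) :
    Function.Periodic (conjInt r g) (2 * π) := fun s => by
  simp only [conjInt]
  congr 1 with θ
  rw [show s + 2 * π - θ = (s - θ) + 2 * π by ring, hper]

theorem conjInt_clm {F : Type*} [NormedAddCommGroup F] [NormedSpace ℝ F] [CompleteSpace E]
    [CompleteSpace F] {r : ℝ} (hr0 : 0 ≤ r)
    (hr1 : r < 1) {g : ℝ → E} (hg : Continuous g) (L : E →L[ℝ] F) (s : ℝ) :
    L (conjInt r g s) = conjInt r (fun x => L (g x)) s := by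
  rw [conjInt, ← L.integral_comp_comm (integrableOn_conjInt hr0 hr1 hg s)]
  simp [conjInt]

end Basic

/-- The Poisson integral reproduces the holomorphic function `1`. -/
theorem integral_poisKernel {r : ℝ} (hr0 : 0 ≤ r) (hr1 : r < 1) :
    ∫ θ in Set.Ioc (-π) π, poisKernel r θ = 2 * π := by
  have h := DiffContOnCl.circleAverage_re_herglotzRieszKernel_smul 
    (E := ℂ) (f := fun _ : ℂ => (1 : ℂ)) (c := 0) (R := 1) (w := circleMap 0 r 0)
    diffContOnCl_const (by simp [abs_of_nonneg hr0, hr1])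
  rw [circleAverage_def] at h
  simp only [Pi.smul_apply', Function.comp_apply, herglotz_circleMap hr0 hr1, Complex.real_smul,
    mul_one, zero_sub, intervalIntegral.integral_ofReal] at h
  have h' : (2 * π)⁻¹ * ∫ x in 0..2 * π, poisKernel r (-x) = 1 := by exact_mod_cast h
  have h2 : ∫ x in 0..2 * π, poisKernel r (-x) = ∫ θ in Set.Ioc (-π) π, poisKernel r θ := by
    have e : ∀ x, poisKernel r (-x) = poisKernel r x := fun x => by simp [poisKernel]
    simp_rw [e]
    rw [← intervalIntegral.integral_of_le (by linarith [pi_pos])]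
    have h2 := (poisKernel_periodic r).intervalIntegral_add_eq (-π) 0
    rw [show -π + 2 * π = π by ring, zero_add] at h2
    exact h2.symm
  rw [h2] at h'
  field_simp at h'
  linarith

theorem ofReal_intervalIntegral_abs_rpow {p : ℝ} (hp : 0 ≤ p) {g : ℝ → ℝ} (hg : Continuous g) :
    ENNReal.ofReal (∫ s in 0..2 * π, |g s| ^ p) = ∫⁻ s in Set.Ioc 0 (2 * π), ‖g s‖ₑ ^ p := by
  rw [intervalIntegral.integral_of_le (by positivity), ofReal_integral_eq_lintegral_ofReal]
  · refine lintegral_congr fun s => ?_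
    rw [← ENNReal.ofReal_rpow_of_nonneg (abs_nonneg _) hp, ← Real.norm_eq_abs, ofReal_norm]
  · have : Continuous fun s => |g s| ^ p := hg.abs.rpow_const fun _ => Or.inr hp
    exact this.integrableOn_Icc.mono_set Set.Ioc_subset_Icc_self
  · exact Eventually.of_forall fun s => by positivity

/-- The bound by the Poisson integral is already known; that integral is an average of translates
against a probability measure, so Young's inequality replaces it by `g`. The factor `(2π)^p` appears
because `conjInt` carries no `1/(2π)`. -/
theorem exists_lintegral_conjInt_pos_le {p : ℝ} (hp1 : 1 < p) (hp2 : p ≤ 2) :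
    ∃ C : NNReal, ∀ (r : ℝ), 0 ≤ r → r < 1 → ∀ g : ℝ → ℝ, Continuous g →
      Function.Periodic g (2 * π) → (∀ s, 0 < g s) →
      ∫⁻ s in Set.Ioc 0 (2 * π), ‖conjInt r g s‖ₑ ^ p ≤
        C * ∫⁻ s in Set.Ioc 0 (2 * π), ‖g s‖ₑ ^ p := by
  obtain ⟨A, hA, h⟩ := exists_integral_conj_rpow_le hp1 hp2
  have hpi := pi_pos
  have hp0 : 0 ≤ p := by linarith
  refine ⟨((2 * π) ^ p * A).toNNReal, fun r hr0 hr1 g hg hper hpos => ?_⟩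
  have h1 := h r hr0 hr1 g hg hper hpos
  have hck := continuous_poisKernel hr0 hr1
  have e1 : ∀ s, (∫ η in 0..2 * π, conjKernel r (s - η) * g η) = conjInt r g s := fun s => by
    rw [conjInt_eq_intervalIntegral r hper]; rfl
  set u : ℝ → ℝ := fun s => (2 * π)⁻¹ * ∫ η in 0..2 * π, poisKernel r (s - η) * g η with hu
  have hu_cont : Continuous u := by
    refine continuous_const.mul ?_
    exact intervalIntegral.continuous_parametric_intervalIntegral_of_continuous' (by fun_prop) _ _
  have hupos : ∀ s, 0 ≤ u s := fun s => by
    refine mul_nonneg (by positivity) (intervalIntegral.integral_nonneg (by positivity) ?_)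
    exact fun η _ => mul_nonneg (poisKernel_pos hr0 hr1 _).le (hpos η).le
  have hus : ∀ s, u s = (2 * π)⁻¹ * ∫ θ in Set.Ioc (-π) π, poisKernel r θ * g (s - θ) := by
    intro s
    have hper' : Function.Periodic (fun θ => poisKernel r θ * g (s - θ)) (2 * π) := fun θ => by
      have : g (s - (θ + 2 * π)) = g (s - θ) := by
        rw [← hper (s - (θ + 2 * π))]; congr 1; ring
      simp only [poisKernel_periodic r θ, this]
    have h1 := intervalIntegral.integral_comp_sub_left (a := 0) (b := 2 * π)
      (fun θ => poisKernel r θ * g (s - θ)) s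
    simp only [sub_sub_cancel, sub_zero] at h1
    rw [hu]; simp only
    rw [h1, ← intervalIntegral.integral_of_le (by linarith [pi_pos])]
    have h2 := hper'.intervalIntegral_add_eq (-π) (s - 2 * π)
    rw [show -π + 2 * π = π by ring, show s - 2 * π + 2 * π = s by ring] at h2
    rw [h2]
  set ν : Measure ℝ := (volume.restrict (Set.Ioc (-π) π)).withDensity
    (fun θ => ENNReal.ofReal ((2 * π)⁻¹ * poisKernel r θ)) with hν
  have hkm : Measurable fun θ => ENNReal.ofReal ((2 * π)⁻¹ * poisKernel r θ) := by fun_prop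
  have hν1 : ν Set.univ = 1 := by
    rw [hν, withDensity_apply _ MeasurableSet.univ, Measure.restrict_univ,
      ← ofReal_integral_eq_lintegral_ofReal, integral_const_mul, integral_poisKernel hr0 hr1]
    · rw [inv_mul_cancel₀ (by positivity), ENNReal.ofReal_one]
    · have : Continuous fun θ => (2 * π)⁻¹ * poisKernel r θ := by fun_prop
      exact this.integrableOn_Icc.mono_set Set.Ioc_subset_Icc_self
    · exact Eventually.of_forall fun θ => mul_nonneg (by positivity) (poisKernel_pos hr0 hr1 _).le
  have hule : ∀ s, ‖u s‖ₑ = ∫⁻ θ, ‖g (s - θ)‖ₑ ∂ν := by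
    intro s
    rw [hν, lintegral_withDensity_eq_lintegral_mul _ hkm (by have := hg.measurable; fun_prop), hus,
      ← integral_const_mul, Real.enorm_of_nonneg, ofReal_integral_eq_lintegral_ofReal]
    · refine lintegral_congr fun θ => ?_
      rw [Pi.mul_apply, Real.enorm_of_nonneg (hpos _).le, ← ENNReal.ofReal_mul, mul_assoc]
      exact mul_nonneg (by positivity) (poisKernel_pos hr0 hr1 _).le
    · have : Continuous fun θ => (2 * π)⁻¹ * (poisKernel r θ * g (s - θ)) := by fun_prop
      exact this.integrableOn_Icc.mono_set Set.Ioc_subset_Icc_self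
    · exact Eventually.of_forall fun θ => mul_nonneg (by positivity)
        (mul_nonneg (poisKernel_pos hr0 hr1 _).le (hpos _).le)
    · exact integral_nonneg fun θ => mul_nonneg (by positivity)
        (mul_nonneg (poisKernel_pos hr0 hr1 _).le (hpos _).le)
  have hyoung : ∫⁻ s in Set.Ioc 0 (2 * π), ‖u s‖ₑ ^ p ≤ ∫⁻ s in Set.Ioc 0 (2 * π), ‖g s‖ₑ ^ p := by
    have := lintegral_rpow_lintegral_translate_le hp1.le (by positivity : (0 : ℝ) < 2 * π)
      (g := fun s => ‖g s‖ₑ) (by fun_prop) (fun s => by simp [hper s]) ν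
    rw [hν1, ENNReal.one_rpow, one_mul] at this
    simp_rw [hule]
    exact this
  have hvc := continuous_conjInt hr0 hr1 hg
  have h2 : ∫ s in 0..2 * π, |conjInt r g s| ^ p ≤ (2 * π) ^ p * A * ∫ s in 0..2 * π, |u s| ^ p := by
    have e2 : ∫ s in 0..2 * π, |conjInt r g s| ^ p =
        (2 * π) ^ p * ∫ s in 0..2 * π, |(2 * π)⁻¹ * conjInt r g s| ^ p := by
      rw [← intervalIntegral.integral_const_mul]
      congr 1 with s
      rw [abs_mul, mul_rpow (abs_nonneg _) (abs_nonneg _), ← mul_assoc,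
        abs_of_pos (by positivity : (0 : ℝ) < (2 * π)⁻¹), ← mul_rpow (by positivity) (by positivity),
        mul_inv_cancel₀ (by positivity), one_rpow, one_mul]
    rw [e2, mul_assoc]
    gcongr
    simp_rw [e1] at h1
    refine h1.trans_eq ?_
    congr 2 with s
    rw [abs_of_nonneg (hupos s)]
  rw [← ofReal_intervalIntegral_abs_rpow hp0 hvc]
  refine (ENNReal.ofReal_le_ofReal h2).trans ?_
  rw [ENNReal.ofReal_mul (by positivity), ofReal_intervalIntegral_abs_rpow hp0 hu_cont]
  rw [ENNReal.ofReal]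
  gcongr

theorem lintegral_circle_add_rpow_le {p : ℝ} (hp : 1 ≤ p) {f g : ℝ → ℝ≥0∞} (hf : Measurable f) :
    ∫⁻ s in Set.Ioc 0 (2 * π), (f s + g s) ^ p ≤
      2 ^ (p - 1) * ((∫⁻ s in Set.Ioc 0 (2 * π), f s ^ p) + ∫⁻ s in Set.Ioc 0 (2 * π), g s ^ p) := by
  rw [← lintegral_add_left (by fun_prop), ← lintegral_const_mul' _ _ (by
    exact ENNReal.rpow_ne_top_of_nonneg (by linarith) (by simp))]
  gcongr with s
  exact ENNReal.rpow_add_le_mul_rpow_add_rpow _ _ hp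

/-- The kernel is odd. This makes the addition of a constant, used to reach strict positivity,
invisible to the operator. -/
theorem conjInt_const (r : ℝ) (c : ℝ) (s : ℝ) : conjInt r (fun _ => c) s = 0 := by
  rw [conjInt, ← intervalIntegral.integral_of_le (by linarith [pi_pos])]
  have h := intervalIntegral.integral_comp_neg (a := -π) (b := π) (fun θ => conjKernel r θ • c)
  simp only [conjKernel_neg, neg_smul, intervalIntegral.integral_neg, neg_neg] at h
  linarith

/-- Positive and negative parts are treated separately. Each is shifted by `ε > 0`, which leaves its
conjugate integral unchanged, and then `ε → 0`. -/
theorem exists_lintegral_conjInt_le_of_le_two {p : ℝ} (hp1 : 1 < p) (hp2 : p ≤ 2) :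
    ∃ C : NNReal, ∀ (r : ℝ), 0 ≤ r → r < 1 → ∀ g : ℝ → ℝ, Continuous g →
      Function.Periodic g (2 * π) →
      ∫⁻ s in Set.Ioc 0 (2 * π), ‖conjInt r g s‖ₑ ^ p ≤
        C * ∫⁻ s in Set.Ioc 0 (2 * π), ‖g s‖ₑ ^ p := by
  obtain ⟨C, hC⟩ := exists_lintegral_conjInt_pos_le hp1 hp2
  have hp0 : 0 < p := by linarith
  set D : NNReal := 2 ^ (p - 1) with hD
  have hD' : (2 : ℝ≥0∞) ^ (p - 1) = D := by
    rw [hD, ENNReal.coe_rpow_of_nonneg _ (by linarith)]; rfl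
  refine ⟨D * (2 * C * D), fun r hr0 hr1 g hg hper => ?_⟩
  set L := ∫⁻ s in Set.Ioc 0 (2 * π), ‖g s‖ₑ ^ p with hL
  have key : ∀ ε : ℝ, 0 < ε → ∫⁻ s in Set.Ioc 0 (2 * π), ‖conjInt r g s‖ₑ ^ p ≤
      D * (2 * C * D) * (L + ENNReal.ofReal ε ^ p * ENNReal.ofReal (2 * π)) := by
    intro ε hε
    have hc1 : Continuous fun s => max (g s) 0 := hg.max continuous_const
    have hc2 : Continuous fun s => max (-g s) 0 := hg.neg.max continuous_const
    have hbound : ∀ h : ℝ → ℝ, Continuous h → Function.Periodic h (2 * π) → (∀ s, 0 ≤ h s) →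
        (∀ s, h s ≤ |g s|) → ∫⁻ s in Set.Ioc 0 (2 * π), ‖conjInt r h s‖ₑ ^ p ≤
          C * (D * (L + ENNReal.ofReal ε ^ p * ENNReal.ofReal (2 * π))) := by
      intro h hh hhper h0 hle
      have e : ∀ s, conjInt r h s = conjInt r (fun s => h s + ε) s := fun s => by
        rw [conjInt_add hr0 hr1 hh continuous_const, conjInt_const, add_zero]
      simp_rw [e]
      refine (hC r hr0 hr1 _ (by fun_prop) (fun s => by simp [hhper s])
        (fun s => by linarith [h0 s])).trans ?_
      gcongr
      calc ∫⁻ s in Set.Ioc 0 (2 * π), ‖h s + ε‖ₑ ^ p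
          ≤ ∫⁻ s in Set.Ioc 0 (2 * π), (‖g s‖ₑ + ENNReal.ofReal ε) ^ p := by
            gcongr with s
            rw [Real.enorm_of_nonneg (by linarith [h0 s]), ENNReal.ofReal_add (h0 s) hε.le,
              ← ofReal_norm, Real.norm_eq_abs]
            gcongr
            exact hle s
        _ ≤ 2 ^ (p - 1) * (L + ∫⁻ s in Set.Ioc 0 (2 * π), ENNReal.ofReal ε ^ p) :=
            lintegral_circle_add_rpow_le hp1.le (by fun_prop)
        _ = _ := by
            rw [hD', lintegral_const, Measure.restrict_apply MeasurableSet.univ]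
            simp
    have hdec : ∀ s, conjInt r g s =
        conjInt r (fun s => max (g s) 0) s - conjInt r (fun s => max (-g s) 0) s := fun s => by
      rw [← conjInt_sub hr0 hr1 hc1 hc2]
      congr 1 with x
      rcases le_total 0 (g x) with h | h
      · rw [max_eq_left h, max_eq_right (by linarith)]; ring
      · rw [max_eq_right h, max_eq_left (by linarith)]; ring
    have b1 := hbound _ hc1 (fun s => by simp [hper s]) (fun s => le_max_right _ _)
      (fun s => max_le (le_abs_self _) (abs_nonneg _))
    have b2 := hbound _ hc2 (fun s => by simp [hper s]) (fun s => le_max_right _ _)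
      (fun s => max_le (neg_le_abs _) (abs_nonneg _))
    calc ∫⁻ s in Set.Ioc 0 (2 * π), ‖conjInt r g s‖ₑ ^ p
        ≤ ∫⁻ s in Set.Ioc 0 (2 * π), (‖conjInt r (fun s => max (g s) 0) s‖ₑ +
            ‖conjInt r (fun s => max (-g s) 0) s‖ₑ) ^ p := by
          gcongr with s
          rw [hdec s]
          exact enorm_sub_le
      _ ≤ 2 ^ (p - 1) * (C * (D * (L + ENNReal.ofReal ε ^ p * ENNReal.ofReal (2 * π))) +
            C * (D * (L + ENNReal.ofReal ε ^ p * ENNReal.ofReal (2 * π)))) := by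
          have := continuous_conjInt hr0 hr1 hc1
          refine (lintegral_circle_add_rpow_le hp1.le (by fun_prop)).trans ?_
          gcongr
      _ = _ := by rw [hD']; ring
  have hlim : Tendsto (fun ε : ℝ => (D * (2 * C * D) : ℝ≥0∞) *
      (L + ENNReal.ofReal ε ^ p * ENNReal.ofReal (2 * π))) (𝓝[>] 0)
      (𝓝 (D * (2 * C * D) * (L + ENNReal.ofReal 0 ^ p * ENNReal.ofReal (2 * π)))) := by
    refine ENNReal.Tendsto.const_mul ?_ (Or.inr (by finiteness))
    refine Tendsto.const_add _ (ENNReal.Tendsto.mul_const ?_ (Or.inr (by finiteness)))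
    refine ((ENNReal.continuous_rpow_const.tendsto _).comp ?_)
    exact (ENNReal.continuous_ofReal.tendsto 0).mono_left nhdsWithin_le_nhds
  rw [ENNReal.ofReal_zero, ENNReal.zero_rpow_of_pos hp0, zero_mul, add_zero] at hlim
  push_cast
  refine ge_of_tendsto hlim ?_
  filter_upwards [self_mem_nhdsWithin] with ε hε using key ε hε

/-- Oddness of the kernel makes the operator skew-adjoint, which is what transfers exponents below
`2` to exponents above `2`. -/
theorem integral_conjInt_mul {r : ℝ} (hr0 : 0 ≤ r) (hr1 : r < 1) {g h : ℝ → ℝ} (hg : Continuous g)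
    (hh : Continuous h) (hgp : Function.Periodic g (2 * π)) (hhp : Function.Periodic h (2 * π)) :
    ∫ s in Set.Ioc 0 (2 * π), conjInt r g s * h s =
      -∫ s in Set.Ioc 0 (2 * π), g s * conjInt r h s := by
  have hk := continuous_conjKernel hr0 hr1
  simp_rw [conjInt_eq_intervalIntegral r hgp, conjInt_eq_intervalIntegral r hhp,
    intervalIntegral.integral_of_le (by positivity : (0 : ℝ) ≤ 2 * π), smul_eq_mul]
  simp_rw [← integral_mul_const, ← integral_const_mul]
  rw [integral_integral_swap, ← integral_neg]
  · congr 1 with s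
    rw [← integral_neg]
    congr 1 with η
    rw [show s - η = -(η - s) by ring, conjKernel_neg]
    ring
  · have hc : Continuous (Function.uncurry fun s η => conjKernel r (s - η) * g η * h s) := by
      unfold Function.uncurry; fun_prop
    rw [Measure.prod_restrict]
    refine (hc.continuousOn.integrableOn_compact (isCompact_Icc.prod isCompact_Icc) :
      IntegrableOn _ (Set.Icc 0 (2 * π) ×ˢ Set.Icc 0 (2 * π)) _).mono_set ?_
    exact Set.prod_mono Set.Ioc_subset_Icc_self Set.Ioc_subset_Icc_self

/-- For `p > 2` the conjugate integral `v` is tested against its dual function `h = |v|^{p-2} v`,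
for which `‖h‖_q^q = ‖v‖_p^p`. Skew-adjointness moves the operator onto `h`, where the conjugate
exponent `q ≤ 2` is already available. -/
theorem exists_lintegral_conjInt_le {p : ℝ} (hp1 : 1 < p) :
    ∃ C : NNReal, ∀ (r : ℝ), 0 ≤ r → r < 1 → ∀ g : ℝ → ℝ, Continuous g →
      Function.Periodic g (2 * π) →
      ∫⁻ s in Set.Ioc 0 (2 * π), ‖conjInt r g s‖ₑ ^ p ≤
        C * ∫⁻ s in Set.Ioc 0 (2 * π), ‖g s‖ₑ ^ p := by
  rcases le_total p 2 with hp2 | hp2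
  · exact exists_lintegral_conjInt_le_of_le_two hp1 hp2
  set q := p.conjExponent with hq
  have hpq : p.HolderConjugate q := Real.HolderConjugate.conjExponent hp1
  have hp0 : 0 < p := by linarith
  have hq1 : 1 < q := hpq.symm.lt
  have hq0 : 0 < q := by linarith
  have hqp : (p - 1) * q = p := hpq.sub_one_mul_conj
  have hq2 : q ≤ 2 := by nlinarith
  obtain ⟨C, hC⟩ := exists_lintegral_conjInt_le_of_le_two hq1 hq2
  refine ⟨C ^ (p / q), fun r hr0 hr1 g hg hper => ?_⟩
  set v := conjInt r g with hv
  have hvc : Continuous v := continuous_conjInt hr0 hr1 hg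
  have hvp : Function.Periodic v (2 * π) := periodic_conjInt r hper
  set h : ℝ → ℝ := fun s => |v s| ^ (p - 2) * v s with hh
  have hhc : Continuous h := (hvc.abs.rpow_const fun _ => Or.inr (by linarith)).mul hvc
  have hhp : Function.Periodic h (2 * π) := fun s => by simp [hh, hvp s]
  have hvh : ∀ s, v s * h s = |v s| ^ p := fun s => by
    simp only [hh]
    rcases eq_or_ne (v s) 0 with h0 | h0
    · simp [h0, hp0.ne']
    · have : 0 < |v s| := abs_pos.2 h0
      rw [mul_left_comm, ← sq, ← sq_abs, ← rpow_natCast, ← rpow_add this]; norm_num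
  have hhabs : ∀ s, ‖h s‖ₑ ^ q = ‖v s‖ₑ ^ p := fun s => by
    have : ‖h s‖ₑ = ‖v s‖ₑ ^ (p - 1) := by
      rw [← ofReal_norm, ← ofReal_norm, ENNReal.ofReal_rpow_of_nonneg (norm_nonneg _) (by linarith)]
      congr 1
      simp only [hh, norm_mul, Real.norm_eq_abs]
      rcases eq_or_ne (v s) 0 with h0 | h0
      · rw [h0]; simp; rw [zero_rpow]; linarith
      · have h1 : 0 < |v s| := abs_pos.2 h0
        rw [abs_of_nonneg (by positivity), ← rpow_add_one h1.ne']; congr 1; ring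
    rw [this, ← ENNReal.rpow_mul, hqp]
  set X := ∫⁻ s in Set.Ioc 0 (2 * π), ‖v s‖ₑ ^ p with hX
  set L := ∫⁻ s in Set.Ioc 0 (2 * π), ‖g s‖ₑ ^ p with hL
  -- Finiteness is needed in order to cancel `X^{1/q}` from both sides below.
  have hXtop : X ≠ ⊤ := by
    rw [hX, ← ofReal_intervalIntegral_abs_rpow hp0.le hvc]; exact ENNReal.ofReal_ne_top
  have hwc := continuous_conjInt hr0 hr1 hhc
  have h1 : X ≤ L ^ (1 / p) * (C * X) ^ (1 / q) := by
    have e1 : X = ENNReal.ofReal (∫ s in Set.Ioc 0 (2 * π), v s * h s) := by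
      rw [hX, ← ofReal_intervalIntegral_abs_rpow hp0.le hvc,
        intervalIntegral.integral_of_le (by positivity)]
      simp_rw [hvh]
    rw [integral_conjInt_mul hr0 hr1 hg hhc hper hhp] at e1
    calc X = ENNReal.ofReal (-∫ s in Set.Ioc 0 (2 * π), g s * conjInt r h s) := e1
      _ ≤ ‖∫ s in Set.Ioc 0 (2 * π), g s * conjInt r h s‖ₑ := by
        rw [← ofReal_norm]
        exact ENNReal.ofReal_le_ofReal (neg_le_abs _)
      _ ≤ ∫⁻ s in Set.Ioc 0 (2 * π), ‖g s * conjInt r h s‖ₑ := enorm_integral_le_lintegral_enorm _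
      _ = ∫⁻ s in Set.Ioc 0 (2 * π), ((fun s => ‖g s‖ₑ) * fun s => ‖conjInt r h s‖ₑ) s := by
          simp [enorm_mul]
      _ ≤ L ^ (1 / p) * (∫⁻ s in Set.Ioc 0 (2 * π), ‖conjInt r h s‖ₑ ^ q) ^ (1 / q) :=
          ENNReal.lintegral_mul_le_Lp_mul_Lq _ hpq (by fun_prop) (by fun_prop)
      _ ≤ L ^ (1 / p) * (C * X) ^ (1 / q) := by
          gcongr
          refine (hC r hr0 hr1 h hhc hhp).trans_eq ?_
          simp_rw [hhabs]
          rfl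
  rcases eq_or_ne X 0 with hX0 | hX0
  · rw [hX0]; exact zero_le
  have h2 : X ^ (1 / p) ≤ L ^ (1 / p) * (C : ℝ≥0∞) ^ (1 / q) := by
    rw [ENNReal.mul_rpow_of_nonneg _ _ (by positivity), ← mul_assoc] at h1
    have e : X = X ^ (1 / p) * X ^ (1 / q) := by
      rw [← ENNReal.rpow_add _ _ hX0 hXtop, hpq.one_div_add_one_div, div_one, ENNReal.rpow_one]
    nth_rw 1 [e] at h1
    have hx0 : X ^ (1 / q) ≠ 0 := by simp [hX0, hXtop]
    have hxt : X ^ (1 / q) ≠ ⊤ := ENNReal.rpow_ne_top_of_nonneg (by positivity) hXtop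
    exact (ENNReal.mul_le_mul_iff_left hx0 hxt).1 h1
  calc X = (X ^ (1 / p)) ^ p := by rw [← ENNReal.rpow_mul, one_div_mul_cancel hp0.ne', ENNReal.rpow_one]
    _ ≤ (L ^ (1 / p) * (C : ℝ≥0∞) ^ (1 / q)) ^ p := by gcongr
    _ = _ := by
      rw [ENNReal.mul_rpow_of_nonneg _ _ hp0.le, ← ENNReal.rpow_mul, ← ENNReal.rpow_mul,
        one_div_mul_cancel hp0.ne', ENNReal.rpow_one, ENNReal.coe_rpow_of_nonneg _ (by positivity),
        mul_comm]
      congr 2; field_simp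

/-! ### Gaussian averaging and Hilbert-valued functions. -/

/-- The absolute moment of order `p` of a standard Gaussian variable. -/
def gaussMoment (p : ℝ) : ℝ≥0∞ := ∫⁻ x : ℝ, ‖x‖ₑ ^ p ∂(gaussianReal 0 1)

theorem gaussMoment_ne_top {p : ℝ} (hp : 0 < p) : gaussMoment p ≠ ⊤ := by
  have h := (memLp_id_gaussianReal (μ := 0) (v := 1) p.toNNReal).eLpNorm_lt_top
  have hp0 : (p.toNNReal : ℝ≥0∞) ≠ 0 := by simpa using hp
  rw [eLpNorm_lt_top_iff_lintegral_rpow_enorm_lt_top hp0 (by simp)] at h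
  simp only [id, ENNReal.coe_toReal, Real.coe_toNNReal _ hp.le] at h
  exact h.ne

theorem gaussMoment_ne_zero {p : ℝ} (hp : 0 < p) : gaussMoment p ≠ 0 := by
  intro h
  rw [gaussMoment, lintegral_eq_zero_iff (by fun_prop)] at h
  have h2 : ∀ᵐ x : ℝ ∂(gaussianReal 0 1), x = 0 := by
    filter_upwards [h] with x hx
    simpa [hp.le, hp, not_lt.2 hp.le] using hx
  have h3 : gaussianReal 0 1 {x : ℝ | ¬ x = 0} = 0 := h2
  have h4 := (gaussianReal_absolutelyContinuous' 0 (one_ne_zero)) h3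
  have h5 : (volume {x : ℝ | ¬ x = 0}) = ⊤ := by
    have : {x : ℝ | ¬ x = 0} = {0}ᶜ := rfl
    rw [this, measure_compl (measurableSet_singleton _) (by simp)]
    simp
  rw [h5] at h4
  exact ENNReal.top_ne_zero h4

theorem lintegral_gaussianReal_rpow {p : ℝ} (hp : 0 ≤ p) (v : NNReal) :
    ∫⁻ x : ℝ, ‖x‖ₑ ^ p ∂(gaussianReal 0 v) = ‖√(v : ℝ)‖ₑ ^ p * gaussMoment p := by
  have h := gaussianReal_map_const_mul (μ := 0) (v := 1) (√(v : ℝ))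
  have h2 : gaussianReal 0 v = (gaussianReal 0 1).map (√(v : ℝ) * ·) := by
    rw [h]; congr 1
    · simp
    · ext; simp
  rw [h2, lintegral_map (by fun_prop) (by fun_prop), gaussMoment, ← lintegral_const_mul _ (by fun_prop)]
  congr 1 with x
  rw [enorm_mul, ENNReal.mul_rpow_of_nonneg _ _ hp]

/-- The scalar product with a standard Gaussian vector is `N(0, |v|²)`, so averaging recovers
`|v|^p` up to a factor that depends on neither `v` nor the dimension. -/
theorem lintegral_inner_stdGaussian {E : Type*} [NormedAddCommGroup E] [InnerProductSpace ℝ E]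
    [FiniteDimensional ℝ E] [MeasurableSpace E] [BorelSpace E] {p : ℝ} (hp : 0 ≤ p) (v : E) :
    ∫⁻ z, ‖inner ℝ v z‖ₑ ^ p ∂(stdGaussian E) = ‖v‖ₑ ^ p * gaussMoment p := by
  have h := IsGaussian.map_eq_gaussianReal (μ := stdGaussian E) (innerSL ℝ v)
  rw [integral_strongDual_stdGaussian, variance_dual_stdGaussian, innerSL_apply_norm] at h
  have h2 : ∫⁻ z, ‖inner ℝ v z‖ₑ ^ p ∂(stdGaussian E) =
      ∫⁻ x : ℝ, ‖x‖ₑ ^ p ∂((stdGaussian E).map (innerSL ℝ v)) := by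
    rw [lintegral_map (by fun_prop) (by fun_prop)]; rfl
  rw [h2, h, lintegral_gaussianReal_rpow hp]
  congr 2
  rw [Real.coe_toNNReal _ (sq_nonneg _), Real.sqrt_sq (norm_nonneg _), enorm_norm]

/-- The scalar inequality is applied to `⟨g, z⟩` and averaged over a Gaussian `z`. The moment factor
is the same on both sides and cancels, so the scalar constant survives in every dimension. -/
theorem exists_lintegral_conjInt_le_finiteDimensional {p : ℝ} (hp1 : 1 < p) :
    ∃ C : NNReal, ∀ (E : Type) [NormedAddCommGroup E] [InnerProductSpace ℝ E]
      [FiniteDimensional ℝ E] (r : ℝ), 0 ≤ r → r < 1 → ∀ g : ℝ → E, Continuous g →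
      Function.Periodic g (2 * π) →
      ∫⁻ s in Set.Ioc 0 (2 * π), ‖conjInt r g s‖ₑ ^ p ≤
        C * ∫⁻ s in Set.Ioc 0 (2 * π), ‖g s‖ₑ ^ p := by
  obtain ⟨C, hC⟩ := exists_lintegral_conjInt_le hp1
  have hp0 : 0 < p := by linarith
  refine ⟨C, fun E _ _ _ r hr0 hr1 g hg hper => ?_⟩
  borelize E
  have main : ∀ f : ℝ → E, Continuous f →
      (∫⁻ s in Set.Ioc 0 (2 * π), ‖f s‖ₑ ^ p) * gaussMoment p =
      ∫⁻ z, (∫⁻ s in Set.Ioc 0 (2 * π), ‖inner ℝ (f s) z‖ₑ ^ p) ∂(stdGaussian E) := by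
    intro f hf
    rw [← lintegral_mul_const' _ _ (gaussMoment_ne_top hp0)]
    simp_rw [← lintegral_inner_stdGaussian hp0.le]
    refine lintegral_lintegral_swap ?_
    have : Continuous (fun z : ℝ × E => inner ℝ (f z.1) z.2) := by fun_prop
    exact (this.measurable.enorm.pow_const p).aemeasurable
  rw [← ENNReal.mul_le_mul_iff_left (gaussMoment_ne_zero hp0) (gaussMoment_ne_top hp0), mul_assoc,
    main _ (continuous_conjInt hr0 hr1 hg), main _ hg, ← lintegral_const_mul' _ _ (by simp)]
  gcongr with z
  have e : ∀ s, inner ℝ (conjInt r g s) z = conjInt r (fun x => inner ℝ (g x) z) s := fun s => by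
    simp_rw [real_inner_comm z]
    exact conjInt_clm hr0 hr1 hg (innerSL ℝ z) s
  simp_rw [e]
  exact hC r hr0 hr1 _ (by fun_prop) (fun s => by simp [hper s])

/-- A continuous periodic function has compact range, hence lies within `ε` of the span `V` of a
finite net. The projection onto `V` is handled by the finite-dimensional case, and the remainder has
conjugate integral at most `ε` times the `L¹` norm of the kernel, for fixed `r`. -/
theorem exists_lintegral_conjInt_le_hilbert {p : ℝ} (hp1 : 1 < p) :
    ∃ C : NNReal, ∀ (E : Type) [NormedAddCommGroup E] [InnerProductSpace ℝ E]
      [CompleteSpace E] (r : ℝ), 0 ≤ r → r < 1 → ∀ g : ℝ → E, Continuous g →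
      Function.Periodic g (2 * π) →
      ∫⁻ s in Set.Ioc 0 (2 * π), ‖conjInt r g s‖ₑ ^ p ≤
        C * ∫⁻ s in Set.Ioc 0 (2 * π), ‖g s‖ₑ ^ p := by
  obtain ⟨C, hC⟩ := exists_lintegral_conjInt_le_finiteDimensional hp1
  have hp0 : 0 < p := by linarith
  set D : NNReal := 2 ^ (p - 1) with hD
  have hD' : (2 : ℝ≥0∞) ^ (p - 1) = D := by
    rw [hD, ENNReal.coe_rpow_of_nonneg _ (by linarith)]; rfl
  refine ⟨D * C, fun E _ _ _ r hr0 hr1 g hg hper => ?_⟩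
  set L := ∫⁻ s in Set.Ioc 0 (2 * π), ‖g s‖ₑ ^ p with hL
  have hk := continuous_conjKernel hr0 hr1
  set M : ℝ := ∫ θ in Set.Ioc (-π) π, ‖conjKernel r θ‖ with hM
  have hM0 : 0 ≤ M := integral_nonneg fun _ => norm_nonneg _
  have key : ∀ ε : ℝ, 0 < ε → ∫⁻ s in Set.Ioc 0 (2 * π), ‖conjInt r g s‖ₑ ^ p ≤
      D * (C * L + ENNReal.ofReal (ε * M) ^ p * ENNReal.ofReal (2 * π)) := by
    intro ε hε
    have hcomp : IsCompact (g '' Set.Icc 0 (2 * π)) := isCompact_Icc.image hg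
    obtain ⟨t, ht, hfin, hcov⟩ := hcomp.totallyBounded.exists_subset (Metric.dist_mem_uniformity hε)
    set V : Submodule ℝ E := Submodule.span ℝ t with hV
    have : FiniteDimensional ℝ V := FiniteDimensional.span_of_finite ℝ hfin
    set P : E →L[ℝ] V := V.orthogonalProjectionOnto with hP
    have hclose : ∀ s, ‖g s - P (g s)‖ ≤ ε := by
      intro s
      obtain ⟨s', hs', hss⟩ := hper.exists_mem_Ico₀ (by positivity) s
      rw [hss]
      have := hcov (Set.mem_image_of_mem g (Set.Ico_subset_Icc_self hs'))
      simp only [Set.mem_iUnion, Set.mem_ofPred_eq] at this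
      obtain ⟨y, hy, hd⟩ := this
      have hyV : y ∈ V := Submodule.subset_span hy
      have h1 : ‖g s' - P (g s')‖ ≤ ‖g s' - y‖ := by
        have h2 := V.starProjection_minimal (g s')
        rw [Submodule.starProjection_apply] at h2
        rw [hP, h2]
        exact ciInf_le ⟨0, by rintro _ ⟨x, rfl⟩; exact norm_nonneg _⟩ (⟨y, hyV⟩ : V)
      rw [dist_eq_norm] at hd
      exact h1.trans hd.le
    have hPg : Continuous fun s => P (g s) := P.continuous.comp hg
    have hPg' : Continuous fun s => (P (g s) : E) := continuous_subtype_val.comp hPg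
    have hsplit : ∀ s, ‖conjInt r g s‖ₑ ≤
        ‖conjInt r (fun s => P (g s)) s‖ₑ + ENNReal.ofReal (ε * M) := by
      intro s
      have e1 : conjInt r g s = ((conjInt r (fun s => P (g s)) s : V) : E) +
          conjInt r (fun s => g s - P (g s)) s := by
        rw [conjInt_sub hr0 hr1 hg hPg']
        have := conjInt_clm hr0 hr1 hPg V.subtypeL s
        simp only [Submodule.subtypeL_apply] at this
        rw [this]
        abel
      have e2 : ‖conjInt r (fun s => g s - P (g s)) s‖ ≤ ε * M := by
        rw [conjInt, hM, ← integral_const_mul]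
        refine norm_integral_le_of_norm_le ?_ (Eventually.of_forall fun θ => ?_)
        · exact (continuous_const.mul hk.norm).integrableOn_Icc.mono_set Set.Ioc_subset_Icc_self
        · rw [norm_smul, mul_comm]
          gcongr
          exact hclose _
      rw [e1]
      refine (enorm_add_le _ _).trans ?_
      gcongr
      · exact le_of_eq rfl
      · rw [← ofReal_norm]; exact ENNReal.ofReal_le_ofReal e2
    calc ∫⁻ s in Set.Ioc 0 (2 * π), ‖conjInt r g s‖ₑ ^ p
        ≤ ∫⁻ s in Set.Ioc 0 (2 * π), (‖conjInt r (fun s => P (g s)) s‖ₑ +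
            ENNReal.ofReal (ε * M)) ^ p := by gcongr with s; exact hsplit s
      _ ≤ 2 ^ (p - 1) * ((∫⁻ s in Set.Ioc 0 (2 * π), ‖conjInt r (fun s => P (g s)) s‖ₑ ^ p) +
            ∫⁻ s in Set.Ioc 0 (2 * π), ENNReal.ofReal (ε * M) ^ p) :=
          lintegral_circle_add_rpow_le hp1.le (continuous_conjInt hr0 hr1 hPg).enorm.measurable
      _ ≤ D * (C * L + ENNReal.ofReal (ε * M) ^ p * ENNReal.ofReal (2 * π)) := by
          rw [hD', lintegral_const, Measure.restrict_apply MeasurableSet.univ, Set.univ_inter,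
            Real.volume_Ioc, sub_zero]
          gcongr
          refine (hC V r hr0 hr1 _ hPg fun s => by simp [hper s]).trans ?_
          refine mul_le_mul_right (lintegral_mono fun s => ?_) _
          refine ENNReal.rpow_le_rpow ?_ hp0.le
          rw [← ofReal_norm, ← ofReal_norm]
          exact ENNReal.ofReal_le_ofReal (V.norm_orthogonalProjectionOnto_apply_le _)
  have hlim : Tendsto (fun ε : ℝ => (D : ℝ≥0∞) *
      (C * L + ENNReal.ofReal (ε * M) ^ p * ENNReal.ofReal (2 * π))) (𝓝[>] 0)
      (𝓝 (D * (C * L + ENNReal.ofReal (0 * M) ^ p * ENNReal.ofReal (2 * π)))) := by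
    refine ENNReal.Tendsto.const_mul ?_ (Or.inr (by finiteness))
    refine Tendsto.const_add _ (ENNReal.Tendsto.mul_const ?_ (Or.inr (by finiteness)))
    refine ((ENNReal.continuous_rpow_const.tendsto _).comp ?_)
    have : Continuous fun ε : ℝ => ENNReal.ofReal (ε * M) :=
      ENNReal.continuous_ofReal.comp (by fun_prop)
    exact (this.tendsto 0).mono_left nhdsWithin_le_nhds
  rw [zero_mul, ENNReal.ofReal_zero, ENNReal.zero_rpow_of_pos hp0, zero_mul, add_zero] at hlim
  push_cast
  rw [mul_assoc]
  refine ge_of_tendsto hlim ?_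
  filter_upwards [self_mem_nhdsWithin] with ε hε using key ε hε

/-! ### Singular integrals with a cotangent singularity. -/

theorem abs_conjKernel_le {r θ : ℝ} (hr0 : 0 < r) (h0 : 0 < θ) (hπ : θ < π) :
    |conjKernel r θ| ≤ cot (θ / 2) := by
  have hs : 0 < sin (θ / 2) := sin_pos_of_pos_of_lt_pi (by linarith) (by linarith)
  have hc : 0 < cos (θ / 2) := cos_pos_of_mem_Ioo ⟨by linarith, by linarith⟩
  have e1 : sin θ = 2 * sin (θ / 2) * cos (θ / 2) := by rw [← sin_two_mul]; congr 1; ring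
  have e2 : cos θ = 1 - 2 * sin (θ / 2) ^ 2 := by
    rw [show θ = 2 * (θ / 2) by ring, cos_two_mul, cos_sq']; ring_nf
  have hden : 0 < 4 * r * sin (θ / 2) ^ 2 := by positivity
  -- The denominator equals `(1-r)² + 4r sin²(θ/2)`; dropping the square gives a majorant
  -- independent of `r`.
  have hle : 4 * r * sin (θ / 2) ^ 2 ≤ 1 - 2 * r * cos θ + r ^ 2 := by
    rw [e2]; nlinarith [sq_nonneg (1 - r)]
  rw [conjKernel, abs_of_nonneg (by rw [e1]; exact div_nonneg (by positivity) (hden.le.trans hle)),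
    cot_eq_cos_div_sin, div_le_div_iff₀ (hden.trans_le hle) hs, e1]
  nlinarith [mul_le_mul_of_nonneg_left hle hc.le]

theorem tendsto_conjKernel {θ : ℝ} (h0 : 0 < θ) (hπ : θ < π) :
    Tendsto (fun r => conjKernel r θ) (𝓝 1) (𝓝 (cot (θ / 2))) := by
  have hs : 0 < sin (θ / 2) := sin_pos_of_pos_of_lt_pi (by linarith) (by linarith)
  have e1 : sin θ = 2 * sin (θ / 2) * cos (θ / 2) := by rw [← sin_two_mul]; congr 1; ring
  have e2 : cos θ = 1 - 2 * sin (θ / 2) ^ 2 := by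
    rw [show θ = 2 * (θ / 2) by ring, cos_two_mul, cos_sq']; ring_nf
  have e3 : cot (θ / 2) = conjKernel 1 θ := by
    rw [conjKernel, e1, e2, cot_eq_cos_div_sin, div_eq_div_iff hs.ne' (by have := pow_pos hs 2; intro h; nlinarith)]
    ring
  rw [e3]
  have : ContinuousAt (fun r => conjKernel r θ) 1 := by
    unfold conjKernel
    refine ContinuousAt.div (by fun_prop) (by fun_prop) ?_
    rw [e2]; have := pow_pos hs 2; intro h; nlinarith
  exact this

/-- From `tan x > x`. A Lipschitz difference `g(s+θ) - g(s-θ)` therefore compensates the singularity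
of the cotangent. -/
theorem mul_cot_le {θ : ℝ} (h0 : 0 < θ) (hπ : θ < π) : θ * cot (θ / 2) ≤ 2 := by
  have hs : 0 < sin (θ / 2) := sin_pos_of_pos_of_lt_pi (by linarith) (by linarith)
  have hc : 0 < cos (θ / 2) := cos_pos_of_mem_Ioo ⟨by linarith, by linarith⟩
  have h := lt_tan (x := θ / 2) (by linarith) (by linarith)
  rw [tan_eq_sin_div_cos, lt_div_iff₀ hc] at h
  rw [cot_eq_cos_div_sin, mul_div_assoc', div_le_iff₀ hs]
  linarith

theorem conjInt_eq_integral_Ioo {E : Type*} [NormedAddCommGroup E] [NormedSpace ℝ E]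
    {r : ℝ} (hr0 : 0 ≤ r) (hr1 : r < 1) {g : ℝ → E} (hg : Continuous g) (s : ℝ) :
    conjInt r g s = -∫ θ in Set.Ioo 0 π, conjKernel r θ • (g (s + θ) - g (s - θ)) := by
  have hk := continuous_conjKernel hr0 hr1
  have hc : Continuous fun θ => conjKernel r θ • g (s - θ) := by fun_prop
  have hc' : Continuous fun θ => conjKernel r θ • g (s + θ) := by fun_prop
  rw [conjInt, ← intervalIntegral.integral_of_le (by linarith [pi_pos]),
    ← intervalIntegral.integral_add_adjacent_intervals (b := 0) (hc.intervalIntegrable _ _)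
      (hc.intervalIntegrable _ _)]
  have h := intervalIntegral.integral_comp_neg (a := 0) (b := π) (fun θ => conjKernel r θ • g (s - θ))
  simp only [conjKernel_neg, neg_smul, intervalIntegral.integral_neg, neg_zero, sub_neg_eq_add] at h
  rw [← h, ← integral_Ioc_eq_integral_Ioo, ← intervalIntegral.integral_of_le pi_pos.le]
  simp_rw [smul_sub]
  rw [intervalIntegral.integral_sub (hc'.intervalIntegrable _ _) (hc.intervalIntegrable _ _)]
  abel

/-- `L^p`-boundedness of singular integrals on the circle whose kernel differs from a multiple of
`cot (θ / 2)` by a bounded function. -/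
theorem exists_lintegral_singularIntegral_le {p : ℝ} (hp1 : 1 < p) (κ M : ℝ) :
    ∃ C : NNReal, ∀ (E : Type) [NormedAddCommGroup E] [InnerProductSpace ℝ E] [CompleteSpace E]
      (k : ℝ → ℝ), Measurable k → (∀ θ ∈ Set.Ioo 0 π, |k θ - κ * cot (θ / 2)| ≤ M) →
      ∀ (g : ℝ → E) (K : NNReal), LipschitzWith K g → Function.Periodic g (2 * π) →
      ∫⁻ s in Set.Ioc 0 (2 * π), ‖∫ θ in Set.Ioo 0 π, k θ • (g (s + θ) - g (s - θ))‖ₑ ^ p ≤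
        C * ∫⁻ s in Set.Ioc 0 (2 * π), ‖g s‖ₑ ^ p := by
  obtain ⟨C, hC⟩ := exists_lintegral_conjInt_le_hilbert hp1
  have hp0 : 0 < p := by linarith
  set D : NNReal := 2 ^ (p - 1) with hD
  have hD' : (2 : ℝ≥0∞) ^ (p - 1) = D := by
    rw [hD, ENNReal.coe_rpow_of_nonneg _ (by linarith)]; rfl
  set N : NNReal := M.toNNReal * (2 * π).toNNReal with hN
  refine ⟨D * (‖κ‖₊ ^ p * C + N ^ p), fun E _ _ _ k hk hkb g K hgL hper => ?_⟩
  have hg : Continuous g := hgL.continuous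
  set L := ∫⁻ s in Set.Ioc 0 (2 * π), ‖g s‖ₑ ^ p with hL
  set b : ℝ → ℝ := fun θ => k θ - κ * cot (θ / 2) with hb
  have hbm : Measurable b := by
    simp only [hb, cot_eq_cos_div_sin]; fun_prop
  have hlip : ∀ s θ, 0 < θ → ‖g (s + θ) - g (s - θ)‖ ≤ K * (2 * θ) := fun s θ hθ => by
    have := hgL.dist_le_mul (s + θ) (s - θ)
    rw [dist_eq_norm, dist_eq_norm, show s + θ - (s - θ) = 2 * θ by ring,
      Real.norm_of_nonneg (by linarith)] at this
    exact this
  have hdiff : ∀ s, Continuous fun θ => g (s + θ) - g (s - θ) := fun s => by fun_prop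
  set B : ℝ → E := fun s => ∫ θ in Set.Ioo 0 π, b θ • (g (s + θ) - g (s - θ)) with hB
  have hbint : ∀ s, IntegrableOn (fun θ => b θ • (g (s + θ) - g (s - θ))) (Set.Ioo 0 π) := by
    intro s
    refine Integrable.bdd_smul ?_ M hbm.aestronglyMeasurable ?_
    · exact (hdiff s).integrableOn_Icc.mono_set Set.Ioo_subset_Icc_self
    · exact (ae_restrict_iff' measurableSet_Ioo).2 (Eventually.of_forall hkb)
  -- The bounded remainder of the kernel acts as an average over translates of total mass `2πM`.
  have hBle : ∫⁻ s in Set.Ioc 0 (2 * π), ‖B s‖ₑ ^ p ≤ (N : ℝ≥0∞) ^ p * L := by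
    set ν : Measure ℝ := ENNReal.ofReal M • volume.restrict (Set.Ioo (-π) π) with hν
    have hν1 : ν Set.univ = N := by
      rw [hν, Measure.smul_apply, Measure.restrict_apply MeasurableSet.univ, Set.univ_inter,
        Real.volume_Ioo, hN, ENNReal.coe_mul, sub_neg_eq_add, ← two_mul]
      rfl
    have hpt : ∀ s, ‖B s‖ₑ ≤ ∫⁻ θ, ‖g (s - θ)‖ₑ ∂ν := by
      intro s
      have hmp : ∫⁻ θ in Set.Ioo 0 π, ‖g (s + θ)‖ₑ = ∫⁻ θ in Set.Ioo (-π) 0, ‖g (s - θ)‖ₑ := by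
        have := (Measure.measurePreserving_neg (volume : Measure ℝ)).setLIntegral_comp_preimage_emb
          (MeasurableEquiv.neg ℝ).measurableEmbedding (fun θ => ‖g (s - θ)‖ₑ) (Set.Ioo (-π) 0)
        rw [← this]
        simp
      calc ‖B s‖ₑ ≤ ∫⁻ θ in Set.Ioo 0 π, ‖b θ • (g (s + θ) - g (s - θ))‖ₑ :=
            enorm_integral_le_lintegral_enorm _
        _ ≤ ∫⁻ θ in Set.Ioo 0 π, ENNReal.ofReal M * (‖g (s + θ)‖ₑ + ‖g (s - θ)‖ₑ) := by
            refine setLIntegral_mono' measurableSet_Ioo fun θ hθ => ?_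
            rw [enorm_smul]
            gcongr
            · rw [← ofReal_norm]; exact ENNReal.ofReal_le_ofReal (hkb θ hθ)
            · exact enorm_sub_le
        _ = ENNReal.ofReal M * ((∫⁻ θ in Set.Ioo (-π) 0, ‖g (s - θ)‖ₑ) +
              ∫⁻ θ in Set.Ioo 0 π, ‖g (s - θ)‖ₑ) := by
            rw [lintegral_const_mul' _ _ ENNReal.ofReal_ne_top, lintegral_add_left
              (Continuous.measurable (by fun_prop)), hmp]
        _ = ENNReal.ofReal M * ∫⁻ θ in Set.Ioo (-π) 0 ∪ Set.Ioo 0 π, ‖g (s - θ)‖ₑ := by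
            rw [lintegral_union measurableSet_Ioo]
            exact Set.disjoint_left.2 fun x h1 h2 => by linarith [h1.2, h2.1]
        _ ≤ ENNReal.ofReal M * ∫⁻ θ in Set.Ioo (-π) π, ‖g (s - θ)‖ₑ := by
            gcongr
            · exact Set.union_subset (Set.Ioo_subset_Ioo_right pi_pos.le)
                (Set.Ioo_subset_Ioo_left (by linarith [pi_pos]))
        _ = _ := by rw [hν, lintegral_smul_measure, smul_eq_mul]
    rw [← hν1]
    refine le_trans ?_ (lintegral_rpow_lintegral_translate_le hp1.le
      (by positivity : (0 : ℝ) < 2 * π) (g := fun s => ‖g s‖ₑ) hg.enorm.measurable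
      (fun s => by simp [hper s]) ν)
    gcongr with s
    exact hpt s
  have hreg : ∀ r, 0 ≤ r → r < 1 →
      ∫⁻ s in Set.Ioc 0 (2 * π), ‖-(κ • conjInt r g s) + B s‖ₑ ^ p ≤
        D * (‖κ‖ₑ ^ p * (C * L) + (N : ℝ≥0∞) ^ p * L) := by
    intro r hr0 hr1
    have hcc := continuous_conjInt hr0 hr1 hg
    calc ∫⁻ s in Set.Ioc 0 (2 * π), ‖-(κ • conjInt r g s) + B s‖ₑ ^ p
        ≤ ∫⁻ s in Set.Ioc 0 (2 * π), (‖κ • conjInt r g s‖ₑ + ‖B s‖ₑ) ^ p := by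
          gcongr with s
          refine (enorm_add_le _ _).trans ?_
          rw [enorm_neg]
      _ ≤ 2 ^ (p - 1) * ((∫⁻ s in Set.Ioc 0 (2 * π), ‖κ • conjInt r g s‖ₑ ^ p) +
            ∫⁻ s in Set.Ioc 0 (2 * π), ‖B s‖ₑ ^ p) :=
          lintegral_circle_add_rpow_le hp1.le (Continuous.measurable (by fun_prop))
      _ ≤ _ := by
          rw [hD']
          gcongr
          simp_rw [enorm_smul, ENNReal.mul_rpow_of_nonneg _ _ hp0.le]
          rw [lintegral_const_mul' _ _ (ENNReal.rpow_ne_top_of_nonneg hp0.le (by simp))]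
          gcongr
          exact hC E r hr0 hr1 g hg hper
  set rn : ℕ → ℝ := fun n => 1 - 1 / (n + 2) with hrn
  have hrn0 : ∀ n, 0 < rn n := fun n => by
    simp only [hrn]; rw [sub_pos, div_lt_one (by positivity)]; linarith [(Nat.cast_nonneg n : (0:ℝ) ≤ n)]
  have hrn1 : ∀ n, rn n < 1 := fun n => by simp only [hrn, sub_lt_self_iff]; positivity
  have hrnlim : Tendsto rn atTop (𝓝 1) := by
    have h1 : Tendsto (fun n : ℕ => 1 / ((n : ℝ) + 2)) atTop (𝓝 0) :=
      tendsto_const_nhds.div_atTop (tendsto_atTop_add_const_right _ _ tendsto_natCast_atTop_atTop)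
    simpa [hrn] using h1.const_sub 1
  -- As the radius tends to `1`, the conjugate kernel tends to `cot(θ/2)`. The minus sign comes from
  -- folding `conjInt` onto `(0, π)`. Domination uses the majorant `cot(θ/2)`, the Lipschitz bound
  -- `2Kθ` and `θ cot(θ/2) ≤ 2`.
  have hlim : ∀ s, Tendsto (fun n => -(κ • conjInt (rn n) g s) + B s) atTop
      (𝓝 (∫ θ in Set.Ioo 0 π, k θ • (g (s + θ) - g (s - θ)))) := by
    intro s
    have e : ∀ n, -(κ • conjInt (rn n) g s) + B s =
        ∫ θ in Set.Ioo 0 π, (κ * conjKernel (rn n) θ + b θ) • (g (s + θ) - g (s - θ)) := by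
      intro n
      rw [conjInt_eq_integral_Ioo (hrn0 n).le (hrn1 n) hg, smul_neg, neg_neg, ← integral_smul, hB]
      simp only
      have hkc := continuous_conjKernel (hrn0 n).le (hrn1 n)
      rw [← integral_add ?_ (hbint s)]
      · congr 1 with θ; rw [add_smul, mul_smul]
      · have : Continuous fun θ => κ • conjKernel (rn n) θ • (g (s + θ) - g (s - θ)) := by fun_prop
        exact this.integrableOn_Icc.mono_set Set.Ioo_subset_Icc_self
    simp_rw [e]
    refine tendsto_integral_of_dominated_convergence
      (fun _ => |κ| * (K * 4) + M * (K * (2 * π))) (fun n => ?_) ?_ (fun n => ?_) ?_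
    · have hkc := continuous_conjKernel (hrn0 n).le (hrn1 n)
      exact ((hkc.measurable.const_mul κ).add hbm).aestronglyMeasurable.smul
        (hdiff s).aestronglyMeasurable
    · exact integrable_const _
    · refine (ae_restrict_iff' measurableSet_Ioo).2 (Eventually.of_forall fun θ hθ => ?_)
      rw [add_smul]
      have hK := hlip s θ hθ.1
      have hcot := mul_cot_le hθ.1 hθ.2
      have hck := abs_conjKernel_le (hrn0 n) hθ.1 hθ.2
      have hM0 : 0 ≤ M := (abs_nonneg _).trans (hkb θ hθ)
      refine (norm_add_le _ _).trans (add_le_add ?_ ?_)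
      · rw [norm_smul, norm_mul, Real.norm_eq_abs, Real.norm_eq_abs, mul_assoc]
        refine mul_le_mul_of_nonneg_left ?_ (abs_nonneg _)
        calc |conjKernel (rn n) θ| * ‖g (s + θ) - g (s - θ)‖ ≤ cot (θ / 2) * (K * (2 * θ)) := by
              gcongr
              exact (abs_nonneg _).trans hck
          _ = K * 2 * (θ * cot (θ / 2)) := by ring
          _ ≤ K * 2 * 2 := by gcongr
          _ = K * 4 := by ring
      · rw [norm_smul]
        gcongr
        · exact hkb θ hθ
        · exact hK.trans (by gcongr; exact hθ.2.le)
    · refine (ae_restrict_iff' measurableSet_Ioo).2 (Eventually.of_forall fun θ hθ => ?_)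
      have h1 : Tendsto (fun n => κ * conjKernel (rn n) θ + b θ) atTop (𝓝 (k θ)) := by
        have := (((tendsto_conjKernel hθ.1 hθ.2).comp hrnlim).const_mul κ).add_const (b θ)
        simpa [hb] using this
      exact h1.smul_const _
  -- Fatou's lemma carries the bound, uniform in the radius, to the limit.
  calc ∫⁻ s in Set.Ioc 0 (2 * π), ‖∫ θ in Set.Ioo 0 π, k θ • (g (s + θ) - g (s - θ))‖ₑ ^ p
      = ∫⁻ s in Set.Ioc 0 (2 * π),
          liminf (fun n => ‖-(κ • conjInt (rn n) g s) + B s‖ₑ ^ p) atTop := by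
        congr 1 with s
        have := ((ENNReal.continuous_rpow_const (y := p)).tendsto _).comp (hlim s).enorm
        exact this.liminf_eq.symm
    _ ≤ liminf (fun n => ∫⁻ s in Set.Ioc 0 (2 * π), ‖-(κ • conjInt (rn n) g s) + B s‖ₑ ^ p) atTop := by
        refine lintegral_liminf_le' fun n => ?_
        have hcc := continuous_conjInt (hrn0 n).le (hrn1 n) hg
        have hBm : AEStronglyMeasurable B (volume.restrict (Set.Ioc 0 (2 * π))) := by
          refine AEStronglyMeasurable.integral_prod_right' (f := fun z : ℝ × ℝ =>
            b z.2 • (g (z.1 + z.2) - g (z.1 - z.2))) ?_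
          refine AEStronglyMeasurable.smul ?_ ?_
          · exact (hbm.comp measurable_snd).aestronglyMeasurable
          · exact Continuous.aestronglyMeasurable (by fun_prop)
        have h2 : AEStronglyMeasurable (fun s => -(κ • conjInt (rn n) g s) + B s)
            (volume.restrict (Set.Ioc 0 (2 * π))) :=
          AEStronglyMeasurable.add (Continuous.aestronglyMeasurable (by fun_prop)) hBm
        exact h2.enorm.pow_const p
    _ ≤ D * (‖κ‖ₑ ^ p * (C * L) + (N : ℝ≥0∞) ^ p * L) := by
        refine (liminf_le_liminf (Eventually.of_forall fun n =>
          hreg (rn n) (hrn0 n).le (hrn1 n))).trans ?_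
        simp
    _ = _ := by
        push_cast
        rw [ENNReal.coe_rpow_of_nonneg _ hp0.le, ENNReal.coe_rpow_of_nonneg _ hp0.le]
        rw [show (‖κ‖₊ : ℝ≥0∞) = ‖κ‖ₑ from rfl]
        ring

end ConjugateFunction

/-! ### Rotation invariance from finite dimensional approximations -/

section ApproxBanach

variable {E : Type*} [NormedAddCommGroup E] [NormedSpace ℝ E] [MeasurableSpace E] [BorelSpace E]
  [SecondCountableTopology E] {μ : Measure E} [IsProbabilityMeasure μ]
  {V : ℕ → Type*} [∀ n, NormedAddCommGroup (V n)] [∀ n, NormedSpace ℝ (V n)]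
  [∀ n, MeasurableSpace (V n)] [∀ n, BorelSpace (V n)] [∀ n, SecondCountableTopology (V n)]
  {π : ∀ n, E →L[ℝ] V n} {S : ∀ n, V n →L[ℝ] E}

/-- Characteristic functionals determine the law. Those of the two measures are limits, by dominated
convergence, of the functionals of `(Sₙ πₙ x, Sₙ πₙ y)`, and these depend only on the image
measures, where invariance is assumed. -/
theorem map_rotation_eq_self_of_tendsto [CompleteSpace E]
    (hS : ∀ x, Tendsto (fun n => S n (π n x)) atTop (𝓝 x))
    {θ : ℝ} (h : ∀ n, ((μ.map (π n)).prod (μ.map (π n))).map (ContinuousLinearMap.rotation θ) =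
      (μ.map (π n)).prod (μ.map (π n))) :
    (μ.prod μ).map (ContinuousLinearMap.rotation θ) = μ.prod μ := by
  refine Measure.ext_of_charFunDual ?_
  ext L
  rw [charFunDual_map]
  simp only [charFunDual_apply]
  have hlim : ∀ L : StrongDual ℝ (E × E),
      Tendsto (fun n => ∫ z, Complex.exp (L (S n (π n z.1), S n (π n z.2)) * Complex.I)
        ∂(μ.prod μ)) atTop (𝓝 (∫ z, Complex.exp (L z * Complex.I) ∂(μ.prod μ))) := by
    intro L
    refine tendsto_integral_of_dominated_convergence (fun _ => 1) (fun n => ?_)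
      (integrable_const _) (fun n => Eventually.of_forall fun z => ?_)
      (Eventually.of_forall fun z => ?_)
    · exact Continuous.aestronglyMeasurable (by fun_prop)
    · rw [Complex.norm_exp_ofReal_mul_I]
    · have h1 : Tendsto (fun n => (S n (π n z.1), S n (π n z.2))) atTop (𝓝 (z.1, z.2)) :=
        (hS z.1).prodMk_nhds (hS z.2)
      have h2 : Continuous fun w : E × E => Complex.exp (L w * Complex.I) := by
        fun_prop
      exact (h2.tendsto _).comp h1
  refine tendsto_nhds_unique (hlim _) ?_
  convert hlim L using 2 with n
  have key : ∀ f : V n × V n → ℂ, Continuous f →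
      ∫ z, f (π n z.1, π n z.2) ∂(μ.prod μ) =
        ∫ z, f z ∂((μ.map (π n)).prod (μ.map (π n))) := by
    intro f hf
    rw [Measure.map_prod_map _ _ (by fun_prop) (by fun_prop), integral_map (by fun_prop)
      hf.aestronglyMeasurable]
    rfl
  set f : V n × V n → ℂ := fun z => Complex.exp (L (S n z.1, S n z.2) * Complex.I) with hf
  have hfc : Continuous f := by fun_prop
  have e1 := key f hfc
  have e2 := key (fun z => f (ContinuousLinearMap.rotation θ z)) (by fun_prop)
  rw [← integral_map (φ := ContinuousLinearMap.rotation θ) (f := f) (by fun_prop)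
    (by fun_prop), h, ← e1] at e2
  refine Eq.trans ?_ e2
  congr 1 with z
  simp [hf, ContinuousLinearMap.rotation_apply]

/-- Functions that factor through finitely many coordinates and are smooth with compact support are
dense in `L^p`. -/
theorem MeasureTheory.MemLp.exists_contDiff_comp_eLpNorm_sub_le [∀ n, FiniteDimensional ℝ (V n)]
    (hS : ∀ x, Tendsto (fun n => S n (π n x)) atTop (𝓝 x))
    {Ξ : Type*} [NormedAddCommGroup Ξ] [NormedSpace ℝ Ξ] {p : ℝ≥0∞} (hp1 : 1 ≤ p) (hp : p ≠ ⊤)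
    {F : E → Ξ} (hF : MemLp F p μ) {ε : ℝ≥0∞} (hε : ε ≠ 0) :
    ∃ (n : ℕ) (f : V n → Ξ), HasCompactSupport f ∧ ContDiff ℝ (⊤ : ℕ∞) f ∧
      eLpNorm (fun x => F x - f (π n x)) p μ ≤ ε := by
  have hε3 : ε / 3 ≠ 0 := by simp [hε]
  -- Three errors of `ε/3`: from `F` to a bounded continuous `g`, from `g` to `g ∘ Sₙ ∘ πₙ`, and
  -- from `g ∘ Sₙ` to a smooth compactly supported function on `V n`.
  obtain ⟨g, hg1, hg2⟩ := hF.exists_boundedContinuous_eLpNorm_sub_le hp hε3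
  have hlim : Tendsto (fun n => eLpNorm (fun x => g (S n (π n x)) - g x) p μ) atTop (𝓝 0) := by
    have h2 : Tendsto (fun n => ∫⁻ x, ‖g (S n (π n x)) - g x‖ₑ ^ p.toReal ∂μ) atTop (𝓝 0) := by
      have h3 := tendsto_lintegral_of_dominated_convergence' (μ := μ)
        (F := fun n x => ‖g (S n (π n x)) - g x‖ₑ ^ p.toReal) (f := fun _ => 0)
        (fun _ => ENNReal.ofReal (2 * ‖g‖) ^ p.toReal) (fun n => ?_)
        (fun n => Eventually.of_forall fun x => ?_) ?_ (Eventually.of_forall fun x => ?_)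
      · simpa using h3
      · exact (Continuous.measurable (by fun_prop)).aemeasurable.pow_const _
      · refine ENNReal.rpow_le_rpow ?_ ENNReal.toReal_nonneg
        rw [← ofReal_norm]
        refine ENNReal.ofReal_le_ofReal ((norm_sub_le _ _).trans ?_)
        linarith [g.norm_coe_le_norm (S n (π n x)), g.norm_coe_le_norm x]
      · rw [lintegral_const, measure_univ, mul_one]
        exact (ENNReal.rpow_lt_top_of_nonneg ENNReal.toReal_nonneg ENNReal.ofReal_ne_top).ne
      · have h4 : Tendsto (fun n => ‖g (S n (π n x)) - g x‖ₑ ^ p.toReal) atTop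
            (𝓝 (‖g x - g x‖ₑ ^ p.toReal)) := by
          refine ((ENNReal.continuous_rpow_const.comp continuous_enorm).tendsto _).comp ?_
          exact (((g.continuous.tendsto x).comp (hS x)).sub_const _)
        simpa [ENNReal.zero_rpow_of_pos (ENNReal.toReal_pos (by positivity) hp)] using h4
    have hp0 : p ≠ 0 := by positivity
    simp_rw [eLpNorm_eq_lintegral_rpow_enorm_toReal hp0 hp]
    have h5 := (ENNReal.continuous_rpow_const (y := 1 / p.toReal)).tendsto 0 |>.comp h2
    rw [ENNReal.zero_rpow_of_pos (by have := ENNReal.toReal_pos hp0 hp; positivity)] at h5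
    exact h5
  obtain ⟨n, hn⟩ := ((ENNReal.tendsto_nhds_zero.1 hlim) _ (pos_iff_ne_zero.2 hε3)).exists
  have hm : MemLp (fun v => g (S n v)) p (μ.map (π n)) := by
    have : IsProbabilityMeasure (μ.map (π n)) :=
      Measure.isProbabilityMeasure_map (by fun_prop)
    refine MemLp.of_bound (Continuous.aestronglyMeasurable (by fun_prop)) ‖g‖ ?_
    exact Eventually.of_forall fun v => g.norm_coe_le_norm _
  have : IsProbabilityMeasure (μ.map (π n)) :=
      Measure.isProbabilityMeasure_map (by fun_prop)
  obtain ⟨ε', hε'0, hε'⟩ : ∃ ε' : ℝ, 0 < ε' ∧ ENNReal.ofReal ε' ≤ ε / 3 := by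
    rcases eq_or_ne (ε / 3) ⊤ with h | h
    · exact ⟨1, one_pos, by simp [h]⟩
    · exact ⟨(ε / 3).toReal, ENNReal.toReal_pos hε3 h, by rw [ENNReal.ofReal_toReal h]⟩
  obtain ⟨f, hf1, hf2, hf3⟩ := hm.exist_eLpNorm_sub_le hp hp1 hε'0
  refine ⟨n, f, hf1, hf2, ?_⟩
  have hf3' : eLpNorm (fun x => g (S n (π n x)) - f (π n x)) p μ ≤ ε / 3 := by
    refine le_trans (le_of_eq ?_) (hf3.trans hε')
    rw [eLpNorm_map_measure ((by fun_prop : Continuous fun v => g (S n v)).aestronglyMeasurable.sub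
      hf2.continuous.aestronglyMeasurable) (by fun_prop)]
    rfl
  have hfm : AEStronglyMeasurable (fun x => f (π n x)) μ :=
    (hf2.continuous.comp (π n).continuous).aestronglyMeasurable
  have hgm : AEStronglyMeasurable (fun x => g (S n (π n x))) μ :=
    Continuous.aestronglyMeasurable (by fun_prop)
  have hgm' : AEStronglyMeasurable (fun x => g x) μ :=
    Continuous.aestronglyMeasurable (by fun_prop)
  have h1 : AEStronglyMeasurable (fun x => F x - g x) μ := hF.1.sub hgm'
  have h2 : AEStronglyMeasurable (fun x => g x - g (S n (π n x))) μ := hgm'.sub hgm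
  have h3 : AEStronglyMeasurable (fun x => g (S n (π n x)) - f (π n x)) μ := hgm.sub hfm
  calc eLpNorm (fun x => F x - f (π n x)) p μ
      = eLpNorm ((fun x => F x - g x) + ((fun x => g x - g (S n (π n x))) +
          (fun x => g (S n (π n x)) - f (π n x)))) p μ := by
        congr 1; ext x; simp
    _ ≤ eLpNorm (fun x => F x - g x) p μ + (eLpNorm (fun x => g x - g (S n (π n x))) p μ +
          eLpNorm (fun x => g (S n (π n x)) - f (π n x)) p μ) :=
        (eLpNorm_add_le h1 (h2.add h3) hp1).trans
          (add_le_add le_rfl (eLpNorm_add_le h2 h3 hp1))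
    _ ≤ ε / 3 + (ε / 3 + ε / 3) := by
        refine add_le_add hg1 (add_le_add (le_trans (le_of_eq ?_) hn) hf3')
        exact eLpNorm_sub_comm _ _ p μ
    _ = ε := by rw [← add_assoc, ENNReal.add_thirds]

end ApproxBanach

namespace Wiener

/-! ### Finite dimensional approximation of Wiener space -/

section Approximation

variable {d : ℕ}

instance instNormedAddCommGroupWienerSpace (d : ℕ) : NormedAddCommGroup (WienerSpace d) :=
  inferInstance

instance instNormedSpaceWienerSpace (d : ℕ) : NormedSpace ℝ (WienerSpace d) := inferInstance

instance instSecondCountableWienerSpace (d : ℕ) : SecondCountableTopology (WienerSpace d) :=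
  inferInstance

theorem isClosed_pathSubmodule (d : ℕ) :
    IsClosed (pathSubmodule d : Set C(I, EuclideanSpace ℝ (Fin d))) :=
  isClosed_eq (continuous_eval_const (0 : I)) continuous_const

instance instCompleteSpaceWienerSpace (d : ℕ) : CompleteSpace (WienerSpace d) :=
  (isClosed_pathSubmodule d).completeSpace_coe

/-- Evaluation of paths at finitely many times. -/
def evalPts {n : ℕ} (t : Fin n → I) :
    WienerSpace d →L[ℝ] (Fin n → EuclideanSpace ℝ (Fin d)) :=
  ContinuousLinearMap.pi fun i =>
    (ContinuousMap.evalCLM ℝ (t i)).comp (pathSubmodule d).subtypeL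

@[simp]
theorem evalPts_apply {n : ℕ} (t : Fin n → I) (w : WienerSpace d) (i : Fin n) :
    evalPts t w i = w.1 (t i) := rfl

/-- The Bernstein polynomial with given coefficients, normalised to vanish at `0`. -/
def bernsteinPathₗ (n : ℕ) :
    (Fin (n + 1) → EuclideanSpace ℝ (Fin d)) →ₗ[ℝ] WienerSpace d where
  toFun v := ⟨(∑ k : Fin (n + 1), bernstein n k • ContinuousMap.const I (v k)) -
    ContinuousMap.const I ((∑ k : Fin (n + 1), bernstein n k • ContinuousMap.const I (v k)) 0), by
      rw [pathSubmodule, Submodule.mem_mk]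
      exact sub_self _⟩
  map_add' v w := by
    ext x
    simp [Finset.sum_add_distrib]
    ring
  map_smul' c v := by
    ext x
    simp [Finset.mul_sum, mul_sub, mul_left_comm]

/-- `bernsteinPathₗ` as a continuous linear map. -/
def bernsteinPath (n : ℕ) :
    (Fin (n + 1) → EuclideanSpace ℝ (Fin d)) →L[ℝ] WienerSpace d :=
  LinearMap.toContinuousLinearMap (bernsteinPathₗ n)

/-- The normalisation at `0` changes nothing here, since Bernstein polynomials interpolate at `0`
and paths vanish there. -/
theorem bernsteinPath_evalPts (n : ℕ) (w : WienerSpace d) :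
    (bernsteinPath n (evalPts (fun k : Fin (n + 1) => bernstein.z k) w)).1 =
      bernsteinApproximation n w.1 := by
  have h0 : bernsteinApproximation n w.1 0 = 0 := by
    rw [bernsteinApproximation.apply_zero]; exact w.2
  have h1 : (bernsteinPath n (evalPts (fun k : Fin (n + 1) => bernstein.z k) w)).1 =
    bernsteinApproximation n w.1 -
      ContinuousMap.const I (bernsteinApproximation n w.1 0) := rfl
  rw [h1, h0]
  ext; simp

theorem tendsto_bernsteinPath (w : WienerSpace d) :
    Tendsto (fun n => bernsteinPath n (evalPts (fun k : Fin (n + 1) => bernstein.z k) w))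
      atTop (𝓝 w) := by
  rw [tendsto_subtype_rng]
  simp_rw [bernsteinPath_evalPts]
  exact bernsteinApproximation_uniform w.1

end Approximation

/-! ### Rotation invariance of the Wiener measure -/

section Rotation

variable {d : ℕ} {μ : Measure (WienerSpace d)}

theorem IsWienerMeasure.hasGaussianLaw_evalPts (hμ : IsWienerMeasure μ) {n : ℕ} (t : Fin n → I) :
    HasGaussianLaw (fun w : WienerSpace d => evalPts t w) μ := by
  classical
  -- The times `t i` may coincide, so the joint law is taken over the finite set of distinct indices
  -- and pulled back linearly.
  set S : Finset (I × Fin d) := Finset.univ.image fun i : Fin n × Fin d => (t i.1, i.2) with hS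
  have hmem : ∀ i a, (t i, a) ∈ S := fun i a => Finset.mem_image.2 ⟨(i, a), by simp, rfl⟩
  let L : (S → ℝ) →ₗ[ℝ] (Fin n → EuclideanSpace ℝ (Fin d)) :=
    { toFun := fun v i => WithLp.toLp 2 fun a => v ⟨(t i, a), hmem i a⟩
      map_add' := fun v w => by ext; simp
      map_smul' := fun c v => by ext; simp }
  have h := (hμ.isGaussianProcess.hasGaussianLaw S).map_fun (LinearMap.toContinuousLinearMap L)
  exact h

theorem IsWienerMeasure.memLp_coord (hμ : IsWienerMeasure μ) (t : I) (a : Fin d) {p : ℝ≥0∞}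
    (hp : p ≠ ⊤) : MemLp (fun w : WienerSpace d => w.1 t a) p μ :=
  (hμ.isGaussianProcess.hasGaussianLaw_eval (t, a)).memLp hp

theorem map_pi_eq_sum {n : ℕ} {Ξ : Type*} [NormedAddCommGroup Ξ] [NormedSpace ℝ Ξ]
    (L : (Fin n → EuclideanSpace ℝ (Fin d)) →L[ℝ] Ξ)
    (v : Fin n → EuclideanSpace ℝ (Fin d)) :
    L v = ∑ i, ∑ a, v i a • L (Pi.single i (EuclideanSpace.single a 1)) := by
  have hv : v = ∑ i, ∑ a, v i a • Pi.single i (EuclideanSpace.single a (1 : ℝ)) := by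
    ext j b
    simp [Pi.single_apply, Finset.sum_apply, WithLp.ofLp_sum, apply_ite]
  conv_lhs => rw [hv]
  simp [map_sum]

theorem IsWienerMeasure.integral_dual_evalPts (hμ : IsWienerMeasure μ) {n : ℕ} (t : Fin n → I)
    (L : (Fin n → EuclideanSpace ℝ (Fin d)) →L[ℝ] ℝ) : ∫ w, L (evalPts t w) ∂μ = 0 := by
  have := hμ.isProbabilityMeasure
  have hL : ∀ w, L (evalPts t w) =
    ∑ i, ∑ a, w.1 (t i) a • L (Pi.single i (EuclideanSpace.single a 1)) := fun w =>
      map_pi_eq_sum L _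
  simp only [hL]
  have hi : ∀ i a, Integrable (fun w : WienerSpace d =>
      w.1 (t i) a • L (Pi.single i (EuclideanSpace.single a 1))) μ := fun i a =>
    ((hμ.memLp_coord (t i) a ENNReal.one_ne_top).integrable le_rfl).smul_const _
  rw [integral_finsetSum _ fun i _ => integrable_finsetSum _ fun a _ => hi i a]
  refine Finset.sum_eq_zero fun i _ => ?_
  rw [integral_finsetSum _ fun a _ => hi i a]
  refine Finset.sum_eq_zero fun a _ => ?_
  rw [integral_smul_const]
  simp only [hμ.mean_zero, zero_smul]

theorem IsWienerMeasure.map_rotation_evalPts (hμ : IsWienerMeasure μ) {n : ℕ} (t : Fin n → I)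
    (θ : ℝ) :
    ((μ.map (evalPts t)).prod (μ.map (evalPts t))).map (ContinuousLinearMap.rotation θ) =
      (μ.map (evalPts t)).prod (μ.map (evalPts t)) := by
  have : IsGaussian (μ.map (evalPts t)) := (hμ.hasGaussianLaw_evalPts t).isGaussian_map
  refine IsGaussian.map_rotation_eq_self_of_forall_strongDual_eq_zero (fun L => ?_) θ
  rw [integral_map (by fun_prop) (by fun_prop)]
  exact hμ.integral_dual_evalPts t L

/-- Finite-dimensional marginals are centred Gaussian, hence rotation invariant; Bernstein
interpolation of paths carries this to the whole space. -/
theorem IsWienerMeasure.map_rotation (hμ : IsWienerMeasure μ) (θ : ℝ) :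
    (μ.prod μ).map (ContinuousLinearMap.rotation θ) = μ.prod μ := by
  have := hμ.isProbabilityMeasure
  exact map_rotation_eq_self_of_tendsto tendsto_bernsteinPath
    fun n => hμ.map_rotation_evalPts _ θ

/-- Cylindrical functions are dense in `L^p`. -/
theorem IsWienerMeasure.exists_cyl_eLpNorm_sub_le (hμ : IsWienerMeasure μ)
    {Ξ : Type} [NormedAddCommGroup Ξ] [NormedSpace ℝ Ξ] {p : ℝ≥0∞} (hp1 : 1 ≤ p) (hp : p ≠ ⊤)
    {F : WienerSpace d → Ξ} (hF : MemLp F p μ) {ε : ℝ≥0∞} (hε : ε ≠ 0) :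
    ∃ (n : ℕ) (t : Fin n → I) (f : 𝓢(Fin n → EuclideanSpace ℝ (Fin d), Ξ)),
      eLpNorm (fun w => F w - cyl t f w) p μ ≤ ε := by
  have := hμ.isProbabilityMeasure
  obtain ⟨n, f, hf1, hf2, hf3⟩ :=
    hF.exists_contDiff_comp_eLpNorm_sub_le tendsto_bernsteinPath hp1 hp hε
  exact ⟨n + 1, _, hf1.toSchwartzMap hf2, hf3⟩

end Rotation

end Wiener

/-! ### Averaging over the second factor of a product space -/

section IntegralSnd

variable {X Y : Type*} [MeasurableSpace X] [MeasurableSpace Y] {μ : Measure X} {ν : Measure Y}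
  [IsProbabilityMeasure ν] {Ξ : Type*} [NormedAddCommGroup Ξ] [NormedSpace ℝ Ξ] {p : ℝ≥0∞}

/-- On a probability space the `L¹` norm is at most the `L^p` norm; this is applied in `y` for each
`x`. -/
theorem eLpNorm_integral_snd_le [SFinite μ] (hp1 : 1 ≤ p) (hp : p ≠ ⊤) {G : X × Y → Ξ}
    (hG : AEStronglyMeasurable G (μ.prod ν)) :
    eLpNorm (fun x => ∫ y, G (x, y) ∂ν) p μ ≤ eLpNorm G p (μ.prod ν) := by
  have hp0 : p ≠ 0 := by positivity
  rw [eLpNorm_eq_lintegral_rpow_enorm_toReal hp0 hp, eLpNorm_eq_lintegral_rpow_enorm_toReal hp0 hp,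
    lintegral_prod _ (hG.enorm.pow_const _)]
  refine ENNReal.rpow_le_rpow (lintegral_mono_ae ?_) (by positivity)
  filter_upwards [hG.prodMk_left] with x hx
  have h1 : ‖∫ y, G (x, y) ∂ν‖ₑ ≤ eLpNorm (fun y => G (x, y)) p ν :=
    calc ‖∫ y, G (x, y) ∂ν‖ₑ ≤ ∫⁻ y, ‖G (x, y)‖ₑ ∂ν := enorm_integral_le_lintegral_enorm _
      _ = eLpNorm (fun y => G (x, y)) 1 ν := eLpNorm_one_eq_lintegral_enorm.symm
      _ ≤ _ := eLpNorm_le_eLpNorm_of_exponent_le hp1 hx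
  rw [eLpNorm_eq_lintegral_rpow_enorm_toReal hp0 hp] at h1
  calc ‖∫ y, G (x, y) ∂ν‖ₑ ^ p.toReal
      ≤ ((∫⁻ y, ‖G (x, y)‖ₑ ^ p.toReal ∂ν) ^ (1 / p.toReal)) ^ p.toReal := by gcongr
    _ = _ := by
      rw [← ENNReal.rpow_mul, one_div_mul_cancel (ENNReal.toReal_pos hp0 hp).ne', ENNReal.rpow_one]


theorem MeasureTheory.MemLp.integral_snd [SFinite μ] (hp1 : 1 ≤ p) (hp : p ≠ ⊤) {G : X × Y → Ξ}
    (hG : MemLp G p (μ.prod ν)) : MemLp (fun x => ∫ y, G (x, y) ∂ν) p μ :=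
  ⟨hG.1.integral_prod_right', (eLpNorm_integral_snd_le hp1 hp hG.1).trans_lt hG.2⟩

variable [IsProbabilityMeasure μ]

variable (μ ν) in
/-- Integration over the second variable, as a contraction of `L^p` spaces. -/
def integralSndLp [Fact (1 ≤ p)] (hp : p ≠ ⊤) : Lp Ξ p (μ.prod ν) →L[ℝ] Lp Ξ p μ :=
  LinearMap.mkContinuous
    { toFun := fun G => ((Lp.memLp G).integral_snd Fact.out hp).toLp _
      map_add' := fun F G => by
        rw [← MemLp.toLp_add]
        refine MemLp.toLp_congr _ _ ?_
        have hF := ((Lp.memLp F).integrable Fact.out).prod_right_ae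
        have hG := ((Lp.memLp G).integrable Fact.out).prod_right_ae
        filter_upwards [hF, hG, Measure.ae_ae_of_ae_prod (Lp.coeFn_add F G)] with x h1 h2 h3
        simp only [Pi.add_apply]
        rw [integral_congr_ae h3, ← integral_add h1 h2]
        rfl
      map_smul' := fun c G => by
        rw [RingHom.id_apply, ← MemLp.toLp_const_smul]
        refine MemLp.toLp_congr _ _ ?_
        filter_upwards [Measure.ae_ae_of_ae_prod (Lp.coeFn_smul c G)] with x h3
        simp only [Pi.smul_apply]
        rw [integral_congr_ae h3, ← integral_smul]
        rfl }
    1 fun G => by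
      simp only [LinearMap.coe_mk, AddHom.coe_mk, one_mul]
      rw [Lp.norm_toLp, Lp.norm_def]
      exact ENNReal.toReal_mono (Lp.memLp G).2.ne
        (eLpNorm_integral_snd_le Fact.out hp (Lp.memLp G).1)

theorem coeFn_integralSndLp [Fact (1 ≤ p)] (hp : p ≠ ⊤) (G : Lp Ξ p (μ.prod ν)) :
    integralSndLp μ ν hp G =ᵐ[μ] fun x => ∫ y, G (x, y) ∂ν :=
  MemLp.coeFn_toLp ((Lp.memLp G).integral_snd Fact.out hp)

theorem norm_integralSndLp_apply_le [Fact (1 ≤ p)] (hp : p ≠ ⊤) (G : Lp Ξ p (μ.prod ν)) :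
    ‖integralSndLp μ ν hp G‖ ≤ ‖G‖ := by
  rw [Lp.norm_def, Lp.norm_def, eLpNorm_congr_ae (coeFn_integralSndLp hp G)]
  exact ENNReal.toReal_mono (Lp.memLp G).2.ne
    (eLpNorm_integral_snd_le Fact.out hp (Lp.memLp G).1)

theorem integralSndLp_congr [Fact (1 ≤ p)] (hp : p ≠ ⊤) (G : Lp Ξ p (μ.prod ν)) {g : X × Y → Ξ}
    (h : G =ᵐ[μ.prod ν] g) : integralSndLp μ ν hp G =ᵐ[μ] fun x => ∫ y, g (x, y) ∂ν := by
  filter_upwards [coeFn_integralSndLp hp G, Measure.ae_ae_of_ae_prod h] with x h1 h2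
  rw [h1]
  exact integral_congr_ae h2

end IntegralSnd

/-! ### Bochner integrals in `L^p` -/

section LpIntegral

variable {T X : Type*} [MeasurableSpace T] [MeasurableSpace X] {ν : Measure T} {μ : Measure X}
  [IsFiniteMeasure ν] [IsFiniteMeasure μ] {Ξ : Type*} [NormedAddCommGroup Ξ]
  [NormedSpace ℝ Ξ] [CompleteSpace Ξ] {p : ℝ≥0∞} [Fact (1 ≤ p)]

/-- A Bochner integral of `L^p`-valued functions is computed pointwise. -/
theorem coeFn_integral_Lp {G : T → Lp Ξ p μ} (hG : Integrable G ν) {g : T × X → Ξ}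
    (hg : Integrable g (ν.prod μ)) (h : ∀ᵐ t ∂ν, G t =ᵐ[μ] fun x => g (t, x)) :
    (∫ t, G t ∂ν : Lp Ξ p μ) =ᵐ[μ] fun x => ∫ t, g (t, x) ∂ν := by
  have hg' : Integrable (fun z : X × T => g z.swap) (μ.prod ν) := hg.swap
  refine Integrable.ae_eq_of_forall_setIntegral_eq _ _ ((Lp.memLp _).integrable Fact.out)
    hg'.integral_prod_left fun s hs _ => ?_
  -- Integration over a set is a bounded functional on `L^p` of a finite measure, so it commutes
  -- with the Bochner integral; Fubini then identifies the integrals over every set.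
  let Λ₁ : Lp Ξ p μ →ₗ[ℝ] Ξ :=
    { toFun := fun F => ∫ x in s, F x ∂μ
      map_add' := fun F G => by
        rw [← integral_add (((Lp.memLp F).integrable Fact.out).integrableOn)
          (((Lp.memLp G).integrable Fact.out).integrableOn)]
        exact integral_congr_ae (ae_restrict_of_ae (Lp.coeFn_add F G))
      map_smul' := fun c F => by
        rw [RingHom.id_apply, ← integral_smul]
        exact integral_congr_ae (ae_restrict_of_ae (Lp.coeFn_smul c F)) }
  obtain ⟨C, hC⟩ : ∃ C : ℝ, ∀ F : Lp Ξ p μ, ‖Λ₁ F‖ ≤ C * ‖F‖ := by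
    refine ⟨(μ Set.univ ^ (1 / (1 : ℝ≥0∞).toReal - 1 / p.toReal)).toReal, fun F => ?_⟩
    have h1 : ‖Λ₁ F‖ₑ ≤ eLpNorm F p μ * μ Set.univ ^ (1 / (1 : ℝ≥0∞).toReal - 1 / p.toReal) :=
      calc ‖Λ₁ F‖ₑ ≤ ∫⁻ x in s, ‖F x‖ₑ ∂μ := enorm_integral_le_lintegral_enorm _
        _ ≤ ∫⁻ x, ‖F x‖ₑ ∂μ := setLIntegral_le_lintegral _ _
        _ = eLpNorm F 1 μ := eLpNorm_one_eq_lintegral_enorm.symm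
        _ ≤ _ := eLpNorm_le_eLpNorm_mul_rpow_measure_univ Fact.out (Lp.aestronglyMeasurable F)
    have hexp : 0 ≤ 1 / (1 : ℝ≥0∞).toReal - 1 / p.toReal := by
      have h1p : 1 ≤ p := Fact.out
      rcases eq_or_ne p ⊤ with rfl | hp
      · simp
      · have := ENNReal.toReal_mono hp h1p
        simp only [ENNReal.toReal_one] at this ⊢
        rw [sub_nonneg]
        exact one_div_le_one_div_of_le one_pos this
    have h2 := ENNReal.toReal_mono (ENNReal.mul_ne_top (Lp.memLp F).2.ne
      (ENNReal.rpow_ne_top_of_nonneg hexp (measure_ne_top μ _))) h1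
    rw [ENNReal.toReal_mul, toReal_enorm, ← Lp.norm_def, mul_comm] at h2
    exact h2
  let Λ : Lp Ξ p μ →L[ℝ] Ξ := Λ₁.mkContinuous C hC
  have e1 : ∫ x in s, (∫ t, G t ∂ν : Lp Ξ p μ) x ∂μ = Λ (∫ t, G t ∂ν) := rfl
  have hgs : Integrable (Function.uncurry fun (x : X) (t : T) => g (t, x))
      ((μ.restrict s).prod ν) := by
    refine hg'.mono_measure ?_
    exact Measure.prod_mono Measure.restrict_le_self le_rfl
  rw [e1, ← Λ.integral_comp_comm hG, integral_integral_swap hgs]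
  refine integral_congr_ae ?_
  filter_upwards [h] with t ht
  exact integral_congr_ae (ae_restrict_of_ae ht)

end LpIntegral

/-! ### Convolution of gamma distributions -/

section Gamma

theorem measurable_gammaPDF (a r : ℝ) : Measurable (gammaPDF a r) :=
  (measurable_gammaPDFReal a r).ennreal_ofReal

theorem integral_gammaMeasure {Ξ : Type*} [NormedAddCommGroup Ξ] [NormedSpace ℝ Ξ] {a : ℝ}
    (ha : 0 < a) (f : ℝ → Ξ) :
    ∫ t, f t ∂gammaMeasure a 1 =
      ∫ t in Set.Ioi (0 : ℝ), ((Real.Gamma a)⁻¹ * (t ^ (a - 1) * Real.exp (-t))) • f t := by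
  rw [gammaMeasure, integral_withDensity_eq_integral_toReal_smul (measurable_gammaPDF a 1)
    (Eventually.of_forall fun _ => ENNReal.ofReal_lt_top), ← integral_Ici_eq_integral_Ioi,
    ← integral_indicator measurableSet_Ici]
  congr 1 with t
  rw [gammaPDF, ENNReal.toReal_ofReal (gammaPDFReal_nonneg ha one_pos t), gammaPDFReal]
  by_cases ht : 0 ≤ t
  · rw [Set.indicator_of_mem (Set.mem_Ici.2 ht), if_pos ht]
    congr 1
    simp [mul_assoc]
  · rw [Set.indicator_of_notMem (by simpa using ht), if_neg ht, zero_smul]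

theorem ae_gammaMeasure_pos {a : ℝ} : ∀ᵐ t ∂gammaMeasure a 1, 0 < t := by
  have h1 : ∀ᵐ t ∂gammaMeasure a 1, t ≠ 0 :=
    (withDensity_absolutelyContinuous _ _).ae_le (Measure.ae_ne volume 0)
  have h2 : ∀ᵐ t ∂gammaMeasure a 1, 0 ≤ t := by
    rw [gammaMeasure, ae_withDensity_iff (measurable_gammaPDF a 1)]
    refine Eventually.of_forall fun t ht => ?_
    by_contra hneg
    exact ht (gammaPDF_of_neg (not_le.1 hneg))
  filter_upwards [h1, h2] with t h3 h4 using lt_of_le_of_ne h4 h3.symm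

theorem mgf_gammaMeasure {a : ℝ} (ha : 0 < a) {t : ℝ} (ht : t < 1) :
    mgf id (gammaMeasure a 1) t = (1 / (1 - t)) ^ a := by
  have hG := (Real.Gamma_pos_of_pos ha).ne'
  rw [mgf, integral_gammaMeasure ha, eq_comm, ← mul_div_cancel_right₀ ((1 / (1 - t)) ^ a) hG,
    ← Real.integral_rpow_mul_exp_neg_mul_Ioi ha (sub_pos.2 ht), div_eq_inv_mul,
    ← integral_const_mul]
  refine setIntegral_congr_fun measurableSet_Ioi fun x _ => ?_
  simp only [smul_eq_mul, id]
  rw [mul_assoc, mul_assoc, ← Real.exp_add]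
  ring_nf

/-- The moment generating function is explicit for real arguments below `1`. Both sides are analytic
on the half plane `Re z < 1` and agree along a real sequence tending to `0`, hence agree on the
imaginary axis. -/
theorem charFun_gammaMeasure {a : ℝ} (ha : 0 < a) (ξ : ℝ) :
    charFun (gammaMeasure a 1) ξ = (1 - ξ * Complex.I) ^ (-a : ℂ) := by
  have := isProbabilityMeasure_gammaMeasure ha one_pos
  have hsub : Set.Iio 1 ⊆ interior (integrableExpSet id (gammaMeasure a 1)) := by
    refine interior_maximal (fun t (ht : t < 1) => ?_) isOpen_Iio
    rw [integrableExpSet, Set.mem_ofPred_eq, ← mgf_pos_iff, mgf_gammaMeasure ha ht]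
    have : 0 < 1 - t := sub_pos.2 ht
    positivity
  have hpre : IsPreconnected {z : ℂ | z.re < 1} := (convex_halfSpace_re_lt 1).isPreconnected
  have h1 : AnalyticOnNhd ℂ (complexMGF id (gammaMeasure a 1)) {z : ℂ | z.re < 1} :=
    analyticOnNhd_complexMGF.mono fun z hz => hsub hz
  have h2 : AnalyticOnNhd ℂ (fun z : ℂ => (1 - z) ^ (-a : ℂ)) {z : ℂ | z.re < 1} := by
    intro z hz
    refine AnalyticAt.cpow (by fun_prop) (by fun_prop) (Or.inl ?_)
    simpa using hz
  have h3 : ∃ᶠ z in 𝓝[≠] (0 : ℂ), complexMGF id (gammaMeasure a 1) z = (1 - z) ^ (-a : ℂ) := by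
    have hseq : Tendsto (fun n : ℕ => (((-1 / ((n : ℝ) + 1) : ℝ)) : ℂ)) atTop (𝓝[≠] 0) := by
      rw [tendsto_nhdsWithin_iff]
      refine ⟨?_, Eventually.of_forall fun n => ?_⟩
      · have h := (tendsto_one_div_add_atTop_nhds_zero_nat (𝕜 := ℝ)).neg
        have h' := (Complex.continuous_ofReal.tendsto _).comp h
        simpa [neg_div, Function.comp_def] using h'
      · have : (n : ℝ) + 1 ≠ 0 := by positivity
        simp only [Set.mem_compl_iff, Set.mem_singleton_iff, Complex.ofReal_eq_zero]
        exact div_ne_zero (by norm_num) this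
    refine hseq.frequently (Eventually.of_forall fun n => ?_).frequently
    have hn : -1 / ((n : ℝ) + 1) < 1 := by
      have : 0 < (n : ℝ) + 1 := by positivity
      rw [div_lt_one this]; linarith
    have hn' : 0 ≤ 1 - -1 / ((n : ℝ) + 1) := by linarith
    rw [complexMGF_ofReal, mgf_gammaMeasure ha hn, one_div, Real.inv_rpow hn', ← Real.rpow_neg hn',
      Complex.ofReal_cpow hn']
    push_cast
    rfl
  have h4 := h1.eqOn_of_preconnected_of_frequently_eq h2 hpre (z₀ := 0) (by simp) h3
  have h5 := h4 (x := ξ * Complex.I) (by simp)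
  rw [charFun_apply_real]
  simp only [complexMGF, id] at h5
  rw [← h5]
  congr 1 with x
  ring_nf

/-- The characteristic functions are powers of the same nonzero base, so the shape parameters add.
This is the source of the composition law of Bessel potentials. -/
theorem gammaMeasure_conv {a b : ℝ} (ha : 0 < a) (hb : 0 < b) :
    (gammaMeasure a 1).conv (gammaMeasure b 1) = gammaMeasure (a + b) 1 := by
  have := isProbabilityMeasure_gammaMeasure ha one_pos
  have := isProbabilityMeasure_gammaMeasure hb one_pos
  have := isProbabilityMeasure_gammaMeasure (add_pos ha hb) one_pos
  refine Measure.ext_of_charFun ?_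
  ext ξ
  rw [charFun_conv, charFun_gammaMeasure ha, charFun_gammaMeasure hb,
    charFun_gammaMeasure (add_pos ha hb)]
  push_cast
  rw [neg_add, Complex.cpow_add]
  intro h
  simpa using congrArg Complex.re h

end Gamma

/-! ### The Ornstein–Uhlenbeck semigroup of a rotation invariant measure -/

namespace OrnsteinUhlenbeck

/-- A probability measure `μ` such that `μ × μ` is invariant under rotations. -/
class IsRotationInvariant {E : Type*} [NormedAddCommGroup E] [NormedSpace ℝ E]
    [MeasurableSpace E] (μ : Measure E) : Prop extends IsProbabilityMeasure μ where
  map_rotation : ∀ θ : ℝ, (μ.prod μ).map (ContinuousLinearMap.rotation θ) = μ.prod μ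

/-! ### Rotations of a pair of independent copies. -/

section Mix

variable {E : Type*} [NormedAddCommGroup E] [NormedSpace ℝ E]

/-- The first component `(x, y) ↦ cos θ x + sin θ y` of the rotation by `θ`. -/
def mix (θ : ℝ) : C(E × E, E) :=
  ⟨fun z => Real.cos θ • z.1 + Real.sin θ • z.2, by fun_prop⟩

theorem mix_apply (θ : ℝ) (z : E × E) : mix θ z = Real.cos θ • z.1 + Real.sin θ • z.2 := rfl

theorem continuous_mix : Continuous fun θ : ℝ => (mix θ : C(E × E, E)) :=
  ContinuousMap.continuous_of_continuous_uncurry _ (by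
    simp only [Function.uncurry_def, mix_apply]; fun_prop)

variable [MeasurableSpace E] [BorelSpace E] [SecondCountableTopology E]
  {μ : Measure E} [IsRotationInvariant μ]

theorem measurePreserving_rotation (θ : ℝ) :
    MeasurePreserving (ContinuousLinearMap.rotation θ) (μ.prod μ) (μ.prod μ) :=
  ⟨by fun_prop, IsRotationInvariant.map_rotation θ⟩

theorem measurePreserving_mix (θ : ℝ) : MeasurePreserving (mix θ) (μ.prod μ) μ :=
  measurePreserving_fst.comp (measurePreserving_rotation θ)

theorem measurePreserving_neg : MeasurePreserving (fun x : E => -x) μ μ := by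
  refine ⟨by fun_prop, ?_⟩
  have h := (measurePreserving_mix (μ := μ) Real.pi).map_eq
  have h2 : ⇑(mix (E := E) Real.pi) = (fun x : E => -x) ∘ Prod.fst := by
    ext z; simp [mix_apply]
  rw [h2, ← Measure.map_map (by fun_prop) (by fun_prop), measurePreserving_fst.map_eq] at h
  exact h

/-- Two independent copies combined with weights on a circle of radius `r` have the law of `r` times
one copy; this is the form of invariance behind the semigroup law. -/
theorem map_lincomb (r β : ℝ) :
    (μ.prod μ).map (fun z => (r * Real.cos β) • z.1 + (r * Real.sin β) • z.2) =
      μ.map (fun x => r • x) := by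
  conv_rhs => rw [← (measurePreserving_mix (μ := μ) β).map_eq]
  rw [Measure.map_map (by fun_prop) (by fun_prop)]
  congr 1
  ext z
  simp [mix_apply, mul_smul]

end Mix

/-! ### Mehler's formula on `L^p`, in the angular variable. -/

section Mehler

variable {E : Type*} [NormedAddCommGroup E] [NormedSpace ℝ E] [MeasurableSpace E]
  {Ξ : Type*} [NormedAddCommGroup Ξ] [NormedSpace ℝ Ξ]

/-- Mehler's formula. -/
def mehler (μ : Measure E) (θ : ℝ) (F : E → Ξ) (x : E) : Ξ := ∫ y, F (mix θ (x, y)) ∂μ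

variable [BorelSpace E] [SecondCountableTopology E] {μ : Measure E} [IsRotationInvariant μ]
  {p : ℝ≥0∞} [Fact (1 ≤ p)]

variable (μ) in
/-- Composition with `mix θ`. -/
def mixLp (θ : ℝ) : Lp Ξ p μ →L[ℝ] Lp Ξ p (μ.prod μ) :=
  (Lp.compMeasurePreservingₗᵢ ℝ (mix θ) (measurePreserving_mix θ)).toContinuousLinearMap

theorem norm_mixLp (θ : ℝ) (F : Lp Ξ p μ) : ‖mixLp μ θ F‖ = ‖F‖ :=
  (Lp.compMeasurePreservingₗᵢ ℝ (mix θ) (measurePreserving_mix θ)).norm_map F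

theorem coeFn_mixLp (θ : ℝ) (F : Lp Ξ p μ) :
    mixLp μ θ F =ᵐ[μ.prod μ] fun z => F (mix θ z) :=
  Lp.coeFn_compMeasurePreserving F (measurePreserving_mix θ)

theorem coeFn_mixLp_of_ae (θ : ℝ) {F : Lp Ξ p μ} {f : E → Ξ} (h : F =ᵐ[μ] f) :
    mixLp μ θ F =ᵐ[μ.prod μ] fun z => f (mix θ z) :=
  (coeFn_mixLp θ F).trans ((measurePreserving_mix θ).quasiMeasurePreserving.ae_eq_comp h)

variable [hp : Fact (p ≠ ⊤)]

theorem continuous_mixLp [CompleteSpace E] (F : Lp Ξ p μ) : Continuous fun θ => mixLp μ θ F :=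
  Continuous.compMeasurePreservingLp continuous_const continuous_mix
    (fun θ => measurePreserving_mix θ) hp.out

variable (μ) in
/-- Mehler's formula as a contraction of `L^p`. -/
def mehlerLp (θ : ℝ) : Lp Ξ p μ →L[ℝ] Lp Ξ p μ :=
  (integralSndLp μ μ hp.out).comp (mixLp μ θ)

theorem norm_mehlerLp_apply_le (θ : ℝ) (F : Lp Ξ p μ) : ‖mehlerLp μ θ F‖ ≤ ‖F‖ :=
  (norm_integralSndLp_apply_le hp.out _).trans (norm_mixLp θ F).le

theorem coeFn_mehlerLp (θ : ℝ) {F : Lp Ξ p μ} {f : E → Ξ} (h : F =ᵐ[μ] f) :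
    mehlerLp μ θ F =ᵐ[μ] mehler μ θ f :=
  integralSndLp_congr hp.out _ (coeFn_mixLp_of_ae θ h)

theorem continuous_mehlerLp [CompleteSpace E] (F : Lp Ξ p μ) :
    Continuous fun θ => mehlerLp μ θ F :=
  (integralSndLp μ μ hp.out).continuous.comp (continuous_mixLp F)

theorem mehlerLp_of_cos_eq_one [CompleteSpace Ξ] {θ : ℝ} (h : Real.cos θ = 1) (F : Lp Ξ p μ) :
    mehlerLp μ θ F = F := by
  have hs : Real.sin θ = 0 := by
    have := Real.sin_sq_add_cos_sq θ
    rw [h] at this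
    nlinarith [sq_nonneg (Real.sin θ)]
  refine Lp.ext ((coeFn_mehlerLp θ (ae_eq_refl F)).trans (Eventually.of_forall fun x => ?_))
  simp [mehler, mix_apply, h, hs]

/-- The composition evaluates `F` at `cos θ cos θ' x + (cos θ' sin θ y + sin θ' z)`. The bracket has
the law of `sin θ'' w`, because `cos² θ' sin² θ + sin² θ' = sin² θ''`. -/
theorem mehlerLp_mehlerLp {θ θ' θ'' : ℝ} (h : Real.cos θ'' = Real.cos θ * Real.cos θ')
    (hs : 0 ≤ Real.sin θ'') (F : Lp Ξ p μ) :
    mehlerLp μ θ (mehlerLp μ θ' F) = mehlerLp μ θ'' F := by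
  obtain ⟨β, h1, h2⟩ : ∃ β, Real.cos θ' * Real.sin θ = Real.sin θ'' * Real.cos β ∧
      Real.sin θ' = Real.sin θ'' * Real.sin β := by
    -- The weights of `y` and `z` are the real and imaginary parts of a number of modulus `sin θ''`;
    -- `β` is its argument.
    set z : ℂ := ⟨Real.cos θ' * Real.sin θ, Real.sin θ'⟩ with hz
    have hn : ‖z‖ = Real.sin θ'' := by
      rw [← abs_of_nonneg hs, ← abs_norm, ← sq_eq_sq_iff_abs_eq_abs, ← Complex.normSq_eq_norm_sq,
        Complex.normSq_apply]
      have e1 := Real.sin_sq_add_cos_sq θ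
      have e2 := Real.sin_sq_add_cos_sq θ'
      have e3 := Real.sin_sq_add_cos_sq θ''
      rw [h] at e3
      simp only [hz]
      linear_combination -e3 + e2 + Real.cos θ' ^ 2 * e1
    refine ⟨z.arg, ?_, ?_⟩
    · rw [← hn, Complex.norm_mul_cos_arg]
    · rw [← hn, Complex.norm_mul_sin_arg]
  have hF : StronglyMeasurable F := Lp.stronglyMeasurable F
  have hint : ∀ᵐ x ∂μ, Integrable (fun w => F (mix θ'' (x, w))) μ := by
    have := (((Lp.memLp F).comp_measurePreserving
      (measurePreserving_mix (μ := μ) θ'')).integrable Fact.out).prod_right_ae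
    exact this
  refine Lp.ext ?_
  filter_upwards [coeFn_mehlerLp θ (coeFn_mehlerLp θ' (ae_eq_refl F)),
    coeFn_mehlerLp θ'' (ae_eq_refl F), hint] with x hx1 hx2 hx3
  rw [hx1, hx2]
  set g : E → Ξ := fun v => F (Real.cos θ'' • x + v) with hg
  have hgm : StronglyMeasurable g := hF.comp_measurable (by fun_prop)
  have hm := map_lincomb (μ := μ) (Real.sin θ'') β
  rw [← h1, ← h2] at hm
  have hgi : Integrable g (μ.map fun w => Real.sin θ'' • w) := by
    rw [integrable_map_measure hgm.aestronglyMeasurable (by fun_prop)]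
    exact hx3
  have hgi2 := hgi
  rw [← hm, integrable_map_measure hgm.aestronglyMeasurable (by fun_prop)] at hgi2
  have e1 : mehler μ θ'' F x = ∫ v, g v ∂(μ.map fun w => Real.sin θ'' • w) := by
    rw [integral_map (by fun_prop) hgm.aestronglyMeasurable]
    rfl
  rw [e1, ← hm, integral_map (by fun_prop) hgm.aestronglyMeasurable]
  refine Eq.trans ?_ (integral_prod _ hgi2).symm
  refine integral_congr_ae (Eventually.of_forall fun y => ?_)
  refine integral_congr_ae (Eventually.of_forall fun z => ?_)
  simp only [hg, mix_apply, smul_add, smul_smul, h]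
  congr 1
  rw [mul_comm (Real.cos θ') (Real.cos θ), add_assoc]

end Mehler

/-! ### Symmetry of Mehler's operators. -/

section Pairing

variable {X : Type*} [MeasurableSpace X] {μ : Measure X} {p q : ℝ≥0∞}
  [hpq : p.HolderConjugate q] {Ξ : Type*} [NormedAddCommGroup Ξ] [InnerProductSpace ℝ Ξ]

theorem _root_.MeasureTheory.MemLp.integrable_inner' {f g : X → Ξ} (hf : MemLp f p μ)
    (hg : MemLp g q μ) : Integrable (fun x => inner ℝ (f x) (g x)) μ := by
  have h := hf.norm.integrable_mul hg.norm
  exact h.mono' (hf.1.inner hg.1) (Eventually.of_forall fun x => norm_inner_le_norm _ _)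

theorem abs_integral_inner_le {f g : X → Ξ} (hf : MemLp f p μ) (hg : MemLp g q μ) :
    |∫ x, inner ℝ (f x) (g x) ∂μ| ≤ (eLpNorm f p μ).toReal * (eLpNorm g q μ).toReal := by
  rw [← ENNReal.toReal_mul, ← Real.norm_eq_abs, ← toReal_enorm]
  refine ENNReal.toReal_mono (ENNReal.mul_ne_top hf.2.ne hg.2.ne) ?_
  calc ‖∫ x, inner ℝ (f x) (g x) ∂μ‖ₑ ≤ ∫⁻ x, ‖(inner ℝ (f x) (g x) : ℝ)‖ₑ ∂μ :=
        enorm_integral_le_lintegral_enorm _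
    _ = eLpNorm (fun x => (inner ℝ (f x) (g x) : ℝ)) 1 μ := eLpNorm_one_eq_lintegral_enorm.symm
    _ ≤ (1 : NNReal) * eLpNorm f p μ * eLpNorm g q μ := by
        refine eLpNorm_le_eLpNorm_mul_eLpNorm_of_nnnorm hf.1 hg.1 (fun a b => inner ℝ a b) 1 ?_
        exact Eventually.of_forall fun x => by
          simpa using nnnorm_inner_le_nnnorm (𝕜 := ℝ) (f x) (g x)
    _ = _ := by simp

variable {E : Type*} [NormedAddCommGroup E] [NormedSpace ℝ E] [MeasurableSpace E] [BorelSpace E]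
  [SecondCountableTopology E] {μ : Measure E} [IsRotationInvariant μ]
  [Fact (1 ≤ p)] [Fact (p ≠ ⊤)] [Fact (1 ≤ q)] [Fact (q ≠ ⊤)]

theorem mehlerLp_neg (θ : ℝ) (F : Lp Ξ p μ) : mehlerLp μ (-θ) F = mehlerLp μ θ F := by
  refine Lp.ext ?_
  filter_upwards [coeFn_mehlerLp θ (ae_eq_refl F), coeFn_mehlerLp (-θ) (ae_eq_refl F)] with x h1 h2
  rw [h1, h2, mehler, mehler]
  rw [← (measurePreserving_neg (μ := μ)).integral_comp (MeasurableEquiv.neg E).measurableEmbedding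
    (fun y => F (mix θ (x, y)))]
  simp [mix_apply]

theorem integral_inner_mehlerLp [CompleteSpace Ξ] (θ : ℝ) (F : Lp Ξ p μ) (u : Lp Ξ q μ) :
    ∫ x, inner ℝ (mehlerLp μ θ F x) (u x) ∂μ =
      ∫ z, inner ℝ (F (mix θ z)) (u z.1) ∂(μ.prod μ) := by
  have hF : MemLp (fun z => F (mix θ z)) p (μ.prod μ) :=
    (Lp.memLp F).comp_measurePreserving (measurePreserving_mix θ)
  have hu : MemLp (fun z : E × E => u z.1) q (μ.prod μ) :=
    (Lp.memLp u).comp_measurePreserving measurePreserving_fst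
  rw [integral_prod _ (hF.integrable_inner' hu)]
  refine integral_congr_ae ?_
  filter_upwards [coeFn_mehlerLp θ (ae_eq_refl F), (hF.integrable Fact.out).prod_right_ae]
    with x h1 h2
  rw [h1, mehler]
  simp only [real_inner_comm (u x)]
  rw [integral_inner h2, real_inner_comm]

/-- Rotating the pair by `-θ` turns `cos θ x + sin θ y` into `x`, and `x` into `cos θ x - sin θ y`.
The sign of the angle does not matter, since `μ` is symmetric. -/
theorem integral_inner_mehlerLp_comm [CompleteSpace Ξ] (θ : ℝ) (F : Lp Ξ p μ) (u : Lp Ξ q μ) :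
    ∫ x, inner ℝ (mehlerLp μ θ F x) (u x) ∂μ = ∫ x, inner ℝ (F x) (mehlerLp μ θ u x) ∂μ := by
  have : q.HolderConjugate p := hpq.symm
  have e1 : ∫ x, inner ℝ (F x) (mehlerLp μ θ u x) ∂μ =
      ∫ x, inner ℝ (mehlerLp μ (-θ) u x) (F x) ∂μ := by
    rw [mehlerLp_neg]; simp only [real_inner_comm]
  rw [e1, integral_inner_mehlerLp, integral_inner_mehlerLp]
  have hF : StronglyMeasurable F := Lp.stronglyMeasurable F
  have hu : StronglyMeasurable u := Lp.stronglyMeasurable u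
  conv_lhs => rw [← (measurePreserving_rotation (μ := μ) (-θ)).map_eq]
  rw [integral_map (by fun_prop)]
  · refine integral_congr_ae (Eventually.of_forall fun z => ?_)
    have h1 : mix θ (ContinuousLinearMap.rotation (-θ) z) = z.1 := by
      rw [mix_apply, ContinuousLinearMap.rotation_apply]
      simp only [Real.cos_neg, Real.sin_neg, smul_add, smul_smul, neg_neg]
      have := Real.cos_sq_add_sin_sq θ
      have e : z.1 = (Real.cos θ ^ 2 + Real.sin θ ^ 2) • z.1 := by rw [this, one_smul]
      conv_rhs => rw [e]
      module
    simp only [h1]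
    rw [real_inner_comm]
    rfl
  · exact ((hF.comp_measurable (by fun_prop)).inner
      (hu.comp_measurable (by fun_prop))).aestronglyMeasurable

end Pairing

/-! ### The semigroup in the time variable and its Bessel potentials. -/

section Semigroup

/-- The angle `θ ∈ [0, π/2]` with `cos θ = exp (-t)`. -/
def ouAngle (t : ℝ) : ℝ := Real.arccos (Real.exp (-t))

/-- For `t < 0` the arccosine returns `0`, so continuity and the contraction bounds hold for all
real `t`; only the semigroup law needs `t ≥ 0`. -/
theorem continuous_ouAngle : Continuous ouAngle := by unfold ouAngle; fun_prop

theorem cos_ouAngle {t : ℝ} (ht : 0 ≤ t) : Real.cos (ouAngle t) = Real.exp (-t) :=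
  Real.cos_arccos (by linarith [Real.exp_pos (-t)]) (by simpa using ht)

theorem sin_ouAngle_nonneg (t : ℝ) : 0 ≤ Real.sin (ouAngle t) :=
  Real.sin_nonneg_of_nonneg_of_le_pi (Real.arccos_nonneg _) (Real.arccos_le_pi _)

theorem abs_cos_ouAngle_pow_le (t : ℝ) (c : ℕ) : |Real.cos (ouAngle t) ^ c| ≤ 1 := by
  rw [abs_pow]
  exact pow_le_one₀ (abs_nonneg _) (Real.abs_cos_le_one _)

variable {E : Type*} [NormedAddCommGroup E] [NormedSpace ℝ E] [MeasurableSpace E] [BorelSpace E]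
  [SecondCountableTopology E] {μ : Measure E} [IsRotationInvariant μ]
  {Ξ : Type*} [NormedAddCommGroup Ξ] [NormedSpace ℝ Ξ]
  {p : ℝ≥0∞} [Fact (1 ≤ p)] [Fact (p ≠ ⊤)]

variable (μ) in
/-- The semigroup `exp (-c t) P_t` (for `t ≥ 0`). -/
def ouLp (c : ℕ) (t : ℝ) : Lp Ξ p μ →L[ℝ] Lp Ξ p μ :=
  Real.cos (ouAngle t) ^ c • mehlerLp μ (ouAngle t)

theorem ouLp_apply (c : ℕ) (t : ℝ) (F : Lp Ξ p μ) :
    ouLp μ c t F = Real.cos (ouAngle t) ^ c • mehlerLp μ (ouAngle t) F := rfl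

theorem norm_ouLp_apply_le (c : ℕ) (t : ℝ) (F : Lp Ξ p μ) : ‖ouLp μ c t F‖ ≤ ‖F‖ := by
  rw [ouLp_apply, norm_smul]
  calc _ ≤ 1 * ‖F‖ := mul_le_mul (abs_cos_ouAngle_pow_le t c) (norm_mehlerLp_apply_le _ F)
        (norm_nonneg _) zero_le_one
    _ = _ := one_mul _

variable [CompleteSpace E]

theorem continuous_ouLp (c : ℕ) (F : Lp Ξ p μ) : Continuous fun t => ouLp μ c t F := by
  simp only [ouLp_apply]
  exact ((Real.continuous_cos.comp continuous_ouAngle).pow c).smul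
    ((continuous_mehlerLp F).comp continuous_ouAngle)

variable [CompleteSpace Ξ]

theorem ouLp_zero (c : ℕ) (F : Lp Ξ p μ) : ouLp μ c 0 F = F := by
  have h : Real.cos (ouAngle 0) = 1 := by rw [cos_ouAngle le_rfl]; simp
  rw [ouLp_apply, mehlerLp_of_cos_eq_one h, h, one_pow, one_smul]

theorem ouLp_ouLp (c : ℕ) {s t : ℝ} (hs : 0 ≤ s) (ht : 0 ≤ t) (F : Lp Ξ p μ) :
    ouLp μ c s (ouLp μ c t F) = ouLp μ c (s + t) F := by
  have h : Real.cos (ouAngle (s + t)) = Real.cos (ouAngle s) * Real.cos (ouAngle t) := by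
    rw [cos_ouAngle hs, cos_ouAngle ht, cos_ouAngle (add_nonneg hs ht), ← Real.exp_add]
    ring_nf
  rw [ouLp_apply, ouLp_apply, ouLp_apply, map_smul, mehlerLp_mehlerLp h (sin_ouAngle_nonneg _),
    smul_smul, h, mul_pow]

theorem integrable_ouLp (ν : Measure ℝ) [IsFiniteMeasure ν] (c : ℕ) (F : Lp Ξ p μ) :
    Integrable (fun t => ouLp μ c t F) ν :=
  Integrable.of_bound (continuous_ouLp c F).aestronglyMeasurable ‖F‖
    (Eventually.of_forall fun t => norm_ouLp_apply_le c t F)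

/-- The gamma distribution with shape `(k + 1) / 2` and rate `1`. -/
def gammaHalf (k : ℕ) : Measure ℝ := gammaMeasure (((k : ℝ) + 1) / 2) 1

instance (k : ℕ) : IsProbabilityMeasure (gammaHalf k) :=
  isProbabilityMeasure_gammaMeasure (by positivity) one_pos

theorem gammaHalf_conv (j k : ℕ) : (gammaHalf j).conv (gammaHalf k) = gammaHalf (j + k + 1) := by
  rw [gammaHalf, gammaHalf, gammaMeasure_conv (by positivity) (by positivity), gammaHalf]
  push_cast
  congr 1
  ring

variable (μ) in
/-- The Bessel potential `((c + 1) I + 𝓛)^{-(k + 1) / 2}`. -/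
def pot (c k : ℕ) : Lp Ξ p μ →L[ℝ] Lp Ξ p μ :=
  LinearMap.mkContinuous
    { toFun := fun F => ∫ t, ouLp μ c t F ∂gammaHalf k
      map_add' := fun F G => by
        simp only [map_add]
        exact integral_add (integrable_ouLp _ c F) (integrable_ouLp _ c G)
      map_smul' := fun a F => by
        simp only [map_smul, RingHom.id_apply]
        exact integral_smul _ _ }
    1 fun F => by
      refine (norm_integral_le_of_norm_le_const
        (Eventually.of_forall fun t => norm_ouLp_apply_le c t F)).trans ?_
      simp

theorem pot_apply (c k : ℕ) (F : Lp Ξ p μ) : pot μ c k F = ∫ t, ouLp μ c t F ∂gammaHalf k := rfl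

theorem norm_pot_apply_le (c k : ℕ) (F : Lp Ξ p μ) : ‖pot μ c k F‖ ≤ ‖F‖ := by
  rw [pot_apply]
  refine (norm_integral_le_of_norm_le_const
    (Eventually.of_forall fun t => norm_ouLp_apply_le c t F)).trans ?_
  simp

theorem ouLp_pot (c k : ℕ) {s : ℝ} (hs : 0 ≤ s) (F : Lp Ξ p μ) :
    ouLp μ c s (pot μ c k F) = ∫ t, ouLp μ c (s + t) F ∂gammaHalf k := by
  rw [pot_apply, ← ContinuousLinearMap.integral_comp_comm _ (integrable_ouLp _ c F)]
  refine integral_congr_ae ?_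
  filter_upwards [ae_gammaMeasure_pos] with t ht
  rw [ouLp_ouLp c hs ht.le]

theorem pot_ouLp (c k : ℕ) {s : ℝ} (hs : 0 ≤ s) (F : Lp Ξ p μ) :
    pot μ c k (ouLp μ c s F) = ouLp μ c s (pot μ c k F) := by
  rw [ouLp_pot c k hs, pot_apply]
  refine integral_congr_ae ?_
  filter_upwards [ae_gammaMeasure_pos] with t ht
  rw [ouLp_ouLp c ht.le hs, add_comm]

/-- Integrating the semigroup law against two gamma distributions yields their convolution. The
shift by `1` arises because index `k` stands for the exponent `-(k+1)/2`. -/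
theorem pot_pot (c j k : ℕ) (F : Lp Ξ p μ) :
    pot μ c j (pot μ c k F) = pot μ c (j + k + 1) F := by
  rw [pot_apply c (j + k + 1), ← gammaHalf_conv, integral_conv]
  · rw [pot_apply]
    refine integral_congr_ae ?_
    filter_upwards [ae_gammaMeasure_pos] with t ht
    rw [ouLp_pot c k ht.le]
  · rw [gammaHalf_conv]
    exact integrable_ouLp _ c F

theorem pot_one_eq (c : ℕ) (F : Lp Ξ p μ) :
    pot μ c 1 F = ∫ t in Set.Ioi (0 : ℝ), Real.exp (-t) • ouLp μ c t F := by
  rw [pot_apply, gammaHalf, integral_gammaMeasure (by positivity)]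
  refine setIntegral_congr_fun measurableSet_Ioi fun t _ => ?_
  norm_num

theorem integrableOn_exp_smul_ouLp (c : ℕ) (F : Lp Ξ p μ) (a : ℝ) :
    IntegrableOn (fun t => Real.exp (-t) • ouLp μ c t F) (Set.Ioi a) := by
  refine Integrable.smul_of_top_left (f := fun t => ouLp μ c t F) (φ := fun t => Real.exp (-t))
    (integrableOn_exp_neg_Ioi a) ?_
  exact memLp_top_of_bound (continuous_ouLp c F).aestronglyMeasurable ‖F‖
    (Eventually.of_forall fun t => norm_ouLp_apply_le c t F)

/-- Applying `exp(-h)` times the semigroup translates the Laplace integral by `h`, so only the part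
over `[0, h]` survives in the difference. Divided by `h`, this approximates the inverse of the
resolvent without mentioning a generator. -/
theorem pot_one_sub (c : ℕ) {h : ℝ} (hh : 0 ≤ h) (F : Lp Ξ p μ) :
    pot μ c 1 (F - Real.exp (-h) • ouLp μ c h F) =
      ∫ t in (0 : ℝ)..h, Real.exp (-t) • ouLp μ c t F := by
  have e : pot μ c 1 (Real.exp (-h) • ouLp μ c h F) =
      ∫ t in Set.Ioi h, Real.exp (-t) • ouLp μ c t F := by
    rw [map_smul, pot_one_eq, ← integral_smul]
    have h1 := ((measurePreserving_add_right volume h).setIntegral_preimage_emb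
      (measurableEmbedding_addRight h) (fun t => Real.exp (-t) • ouLp μ c t F) (Set.Ioi h))
    rw [← h1, Set.preimage_add_const_Ioi, sub_self]
    refine setIntegral_congr_fun measurableSet_Ioi fun t (ht : 0 < t) => ?_
    rw [ouLp_ouLp c ht.le hh, smul_smul, ← Real.exp_add]
    ring_nf
  rw [map_sub, e, pot_one_eq, intervalIntegral.integral_of_le hh]
  rw [← Set.Ioc_union_Ioi_eq_Ioi hh, setIntegral_union (Set.Ioc_disjoint_Ioi le_rfl)
    measurableSet_Ioi ((integrableOn_exp_smul_ouLp c F 0).mono_set Set.Ioc_subset_Ioi_self)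
    (integrableOn_exp_smul_ouLp c F h), add_sub_cancel_right]

theorem tendsto_average_ouLp (c : ℕ) (F : Lp Ξ p μ) :
    Tendsto (fun h : ℝ => h⁻¹ • ∫ t in (0 : ℝ)..h, Real.exp (-t) • ouLp μ c t F) (𝓝[>] 0)
      (𝓝 F) := by
  have hc : Continuous fun t : ℝ => Real.exp (-t) • ouLp μ c t F :=
    (by fun_prop : Continuous fun t : ℝ => Real.exp (-t)).smul (continuous_ouLp c F)
  have h := intervalIntegral.integral_hasDerivAt_right (hc.intervalIntegrable 0 0)
    (hc.stronglyMeasurableAtFilter _ _) hc.continuousAt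
  have h2 := h.tendsto_slope_zero_right
  simpa [ouLp_zero] using h2

/-- If the resolvent kills `F`, then by `pot_one_sub` all averages of the semigroup over `[0, h]`
vanish, while they tend to `F`. -/
theorem pot_one_injective (c : ℕ) : Function.Injective (pot (Ξ := Ξ) (p := p) μ c 1) := by
  rw [injective_iff_map_eq_zero]
  intro F hF
  refine (tendsto_nhds_unique (tendsto_average_ouLp c F) ?_)
  refine tendsto_const_nhds.congr' ?_
  filter_upwards [self_mem_nhdsWithin] with h (hh : 0 < h)
  rw [← pot_one_sub c hh.le, map_sub, map_smul, pot_ouLp c 1 hh.le, hF]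
  simp

theorem pot_zero_injective (c : ℕ) : Function.Injective (pot (Ξ := Ξ) (p := p) μ c 0) := by
  rw [injective_iff_map_eq_zero]
  intro F hF
  refine (injective_iff_map_eq_zero _).1 (pot_one_injective (μ := μ) c) F ?_
  have := pot_pot c 0 0 F
  rw [hF, map_zero] at this
  exact this.symm

theorem stronglyMeasurable_mehler {f : E → Ξ} (hf : StronglyMeasurable f) :
    StronglyMeasurable fun z : ℝ × E => mehler μ (ouAngle z.1) f z.2 := by
  have h : StronglyMeasurable fun z : (ℝ × E) × E => f (mix (ouAngle z.1.1) (z.1.2, z.2)) := by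
    refine hf.comp_measurable ?_
    simp only [mix_apply]
    have := continuous_ouAngle
    exact Continuous.measurable (by fun_prop)
  exact h.integral_prod_right'

/-- Links the Bochner integral with the pointwise formula; a strongly measurable representative is
required for joint measurability in `(t, x)`. -/
theorem coeFn_pot (c k : ℕ) {F : Lp Ξ p μ} {f : E → Ξ} (hf : StronglyMeasurable f)
    (hFf : F =ᵐ[μ] f) :
    pot μ c k F =ᵐ[μ]
      fun x => ∫ t, Real.cos (ouAngle t) ^ c • mehler μ (ouAngle t) f x ∂gammaHalf k := by
  rw [pot_apply]
  have hae : ∀ t, ouLp μ c t F =ᵐ[μ]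
      fun x => Real.cos (ouAngle t) ^ c • mehler μ (ouAngle t) f x := by
    intro t
    filter_upwards [Lp.coeFn_smul (Real.cos (ouAngle t) ^ c) (mehlerLp μ (ouAngle t) F),
      coeFn_mehlerLp (ouAngle t) hFf] with x h1 h2
    rw [ouLp_apply, h1, Pi.smul_apply, h2]
  have hm : StronglyMeasurable fun z : ℝ × E =>
      Real.cos (ouAngle z.1) ^ c • mehler μ (ouAngle z.1) f z.2 := by
    refine StronglyMeasurable.smul ?_ (stronglyMeasurable_mehler hf)
    have := continuous_ouAngle
    exact Continuous.stronglyMeasurable (by fun_prop)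
  refine coeFn_integral_Lp (g := fun z => Real.cos (ouAngle z.1) ^ c • mehler μ (ouAngle z.1) f z.2)
    (integrable_ouLp _ c F) ?_ (Eventually.of_forall hae)
  rw [integrable_prod_iff hm.aestronglyMeasurable]
  have hi : ∀ t, Integrable (fun x => Real.cos (ouAngle t) ^ c • mehler μ (ouAngle t) f x) μ :=
    fun t => ((Lp.memLp (ouLp μ c t F)).integrable Fact.out).congr (hae t)
  refine ⟨Eventually.of_forall hi, ?_⟩
  refine Integrable.of_bound hm.norm.integral_prod_right'.aestronglyMeasurable ‖F‖
    (Eventually.of_forall fun t => ?_)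
  rw [Real.norm_of_nonneg (integral_nonneg fun _ => norm_nonneg _)]
  rw [integral_norm_eq_lintegral_enorm (hi t).1, ← eLpNorm_one_eq_lintegral_enorm,
    ← eLpNorm_congr_ae (hae t)]
  refine (ENNReal.toReal_mono (Lp.memLp (ouLp μ c t F)).2.ne
    (eLpNorm_le_eLpNorm_of_exponent_le Fact.out (Lp.memLp (ouLp μ c t F)).1)).trans ?_
  rw [← Lp.norm_def]
  exact norm_ouLp_apply_le c t F

end Semigroup

/-! ### The duality pairing and the semigroup. -/

section PairLp

variable {X : Type*} [MeasurableSpace X] {μ : Measure X} {p q : ℝ≥0∞}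
  [hpq : p.HolderConjugate q] [Fact (1 ≤ p)] [Fact (1 ≤ q)]
  {Ξ : Type*} [NormedAddCommGroup Ξ] [InnerProductSpace ℝ Ξ]

variable (q) in
/-- The duality pairing of `L^p` and `L^q`. -/
def pairLp : Lp Ξ p μ →L[ℝ] Lp Ξ q μ →L[ℝ] ℝ := ContinuousLinearMap.lpPairing μ p q (innerSL ℝ)

theorem pairLp_apply (F : Lp Ξ p μ) (u : Lp Ξ q μ) :
    pairLp q F u = ∫ x, inner ℝ (F x) (u x) ∂μ :=
  ContinuousLinearMap.lpPairing_eq_integral (innerSL ℝ) F u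

theorem abs_pairLp_le (F : Lp Ξ p μ) (u : Lp Ξ q μ) : |pairLp q F u| ≤ ‖F‖ * ‖u‖ := by
  rw [pairLp_apply, Lp.norm_def, Lp.norm_def]
  exact abs_integral_inner_le (Lp.memLp F) (Lp.memLp u)

variable {E : Type*} [NormedAddCommGroup E] [NormedSpace ℝ E] [MeasurableSpace E] [BorelSpace E]
  [SecondCountableTopology E] {μ : Measure E} [IsRotationInvariant μ]
  [Fact (p ≠ ⊤)] [Fact (q ≠ ⊤)] [CompleteSpace E] [CompleteSpace Ξ]

theorem pairLp_ouLp (c : ℕ) (t : ℝ) (F : Lp Ξ p μ) (u : Lp Ξ q μ) :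
    pairLp q (ouLp μ c t F) u = pairLp q F (ouLp μ c t u) := by
  rw [ouLp_apply, ouLp_apply, map_smul, smul_apply, map_smul, pairLp_apply,
    pairLp_apply, integral_inner_mehlerLp_comm]

theorem pairLp_pot (c k : ℕ) (F : Lp Ξ p μ) (u : Lp Ξ q μ) :
    pairLp q (pot μ c k F) u = pairLp q F (pot μ c k u) := by
  have h1 := ContinuousLinearMap.integral_comp_comm ((pairLp q (μ := μ) (p := p)).flip u)
    (integrable_ouLp (gammaHalf k) c F)
  have h2 := ContinuousLinearMap.integral_comp_comm (pairLp q F)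
    (integrable_ouLp (gammaHalf k) c u)
  simp only [ContinuousLinearMap.flip_apply] at h1
  rw [pot_apply, pot_apply, ← h1, ← h2]
  simp only [pairLp_ouLp]

end PairLp

end OrnsteinUhlenbeck

namespace Wiener

open OrnsteinUhlenbeck

/-! ### Elementary tensors -/

section Tensor

variable {d : ℕ} {Ξ : Type} [NormedAddCommGroup Ξ] [InnerProductSpace ℝ Ξ]

theorem coeFn_elemTensor (h : HTensor d ℝ) (ξ : Ξ) :
    elemTensor h ξ =ᵐ[cmMeasure d] fun s => h s • ξ :=
  ContinuousLinearMap.coeFn_compLp _ _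

theorem inner_elemTensor (h h' : HTensor d ℝ) (ξ ξ' : Ξ) :
    inner ℝ (elemTensor h ξ) (elemTensor h' ξ') = inner ℝ h h' * inner ℝ ξ ξ' := by
  rw [L2.inner_def, L2.inner_def, ← integral_mul_const]
  refine integral_congr_ae ?_
  filter_upwards [coeFn_elemTensor h ξ, coeFn_elemTensor h' ξ'] with s h1 h2
  rw [h1, h2, real_inner_smul_left, real_inner_smul_right]
  simp
  ring

theorem norm_elemTensor (h : HTensor d ℝ) (ξ : Ξ) : ‖elemTensor h ξ‖ = ‖h‖ * ‖ξ‖ := by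
  have := inner_elemTensor h h ξ ξ
  simp only [real_inner_self_eq_norm_sq] at this
  rw [← mul_pow] at this
  exact (sq_eq_sq₀ (norm_nonneg _) (by positivity)).1 this

/-- The elementary tensor `h ⊗ ξ` as a continuous linear map in `ξ`. -/
def elemTensorL (h : HTensor d ℝ) : Ξ →L[ℝ] HTensor d Ξ :=
  LinearMap.mkContinuous
    { toFun := fun ξ => elemTensor h ξ
      map_add' := fun ξ ξ' => by
        refine Lp.ext ?_
        filter_upwards [coeFn_elemTensor h ξ, coeFn_elemTensor h ξ', coeFn_elemTensor h (ξ + ξ'),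
          Lp.coeFn_add (elemTensor h ξ) (elemTensor h ξ')] with s h1 h2 h3 h4
        rw [h3, h4, Pi.add_apply, h1, h2, smul_add]
      map_smul' := fun c ξ => by
        refine Lp.ext ?_
        filter_upwards [coeFn_elemTensor h ξ, coeFn_elemTensor h (c • ξ),
          Lp.coeFn_smul c (elemTensor h ξ)] with s h1 h2 h3
        rw [RingHom.id_apply, h2, h3, Pi.smul_apply, h1, smul_comm] }
    ‖h‖ fun ξ => (norm_elemTensor h ξ).le

theorem elemTensorL_apply (h : HTensor d ℝ) (ξ : Ξ) : elemTensorL h ξ = elemTensor h ξ := rfl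

theorem inner_evalVec (s t : I) (a b : Fin d) :
    inner ℝ (evalVec s a) (evalVec t b) = if a = b then min (s : ℝ) (t : ℝ) else 0 := by
  rw [evalVec, evalVec, L2.real_inner_indicatorConstLp_one_indicatorConstLp_one,
    Set.prod_inter_prod, Set.Iic_inter_Iic, cmMeasure, measureReal_prod_prod]
  by_cases hab : a = b
  · subst hab
    have : (volume : Measure I).real (Set.Iic (s ⊓ t)) = ((s ⊓ t : I) : ℝ) := by
      rw [measureReal_def, unitInterval.volume_Iic]
      exact ENNReal.toReal_ofReal (s ⊓ t).2.1
    rw [this]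
    simp
  · have : ({a} ∩ {b} : Set (Fin d)) = ∅ := by simp [hab]
    simp [this, hab]

/-- The element `∑ U_{t_i, a} ⊗ L e_{i,a}` of `H ⊗ Ξ` associated with a linear function
`w ↦ L (w(t_1), …, w(t_n))`. -/
def gradL {n : ℕ} (t : Fin n → I) :
    ((Fin n → EuclideanSpace ℝ (Fin d)) →L[ℝ] Ξ) →L[ℝ] HTensor d Ξ :=
  ∑ i : Fin n, ∑ a : Fin d, (elemTensorL (evalVec (t i) a)).comp
    (ContinuousLinearMap.apply ℝ Ξ (Pi.single i (EuclideanSpace.single a (1 : ℝ))))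

theorem gradL_apply {n : ℕ} (t : Fin n → I)
    (L : (Fin n → EuclideanSpace ℝ (Fin d)) →L[ℝ] Ξ) :
    gradL t L = ∑ i : Fin n, ∑ a : Fin d, elemTensor (evalVec (t i) a)
      (L (Pi.single i (EuclideanSpace.single a (1 : ℝ)))) := by
  simp [gradL, elemTensorL_apply]

theorem cylGrad_eq {n : ℕ} (t : Fin n → I) (f : 𝓢(Fin n → EuclideanSpace ℝ (Fin d), Ξ))
    (w : WienerSpace d) : cylGrad t f w = gradL t (fderiv ℝ f (evalPts t w)) :=
  (gradL_apply t _).symm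

/-- The isometry property of `gradL`. -/
theorem IsWienerMeasure.integral_inner_evalPts {μ : Measure (WienerSpace d)}
    (hμ : IsWienerMeasure μ) {n m : ℕ} (t : Fin n → I) (t' : Fin m → I)
    (L : (Fin n → EuclideanSpace ℝ (Fin d)) →L[ℝ] Ξ)
    (L' : (Fin m → EuclideanSpace ℝ (Fin d)) →L[ℝ] Ξ) :
    ∫ y, inner ℝ (L (evalPts t y)) (L' (evalPts t' y)) ∂μ = inner ℝ (gradL t L) (gradL t' L') := by
  have hL : ∀ y, inner ℝ (L (evalPts t y)) (L' (evalPts t' y)) =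
      ∑ i, ∑ a, ∑ j, ∑ b, (y.1 (t i) a * y.1 (t' j) b) *
        inner ℝ (L (Pi.single i (EuclideanSpace.single a (1 : ℝ))))
          (L' (Pi.single j (EuclideanSpace.single b (1 : ℝ)))) := by
    intro y
    rw [map_pi_eq_sum L, map_pi_eq_sum L']
    rw [sum_inner]
    refine Finset.sum_congr rfl fun i _ => ?_
    rw [sum_inner]
    refine Finset.sum_congr rfl fun a _ => ?_
    rw [inner_sum]
    refine Finset.sum_congr rfl fun j _ => ?_
    rw [inner_sum]
    refine Finset.sum_congr rfl fun b _ => ?_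
    rw [real_inner_smul_left, real_inner_smul_right, evalPts_apply, evalPts_apply]
    ring
  have hint : ∀ i a j b, Integrable (fun y : WienerSpace d => (y.1 (t i) a * y.1 (t' j) b) *
        inner ℝ (L (Pi.single i (EuclideanSpace.single a (1 : ℝ))))
          (L' (Pi.single j (EuclideanSpace.single b (1 : ℝ))))) μ := fun i a j b =>
    ((hμ.memLp_coord (t i) a ENNReal.ofNat_ne_top).integrable_mul
      (hμ.memLp_coord (t' j) b ENNReal.ofNat_ne_top) (p := 2) (q := 2)).mul_const _
  simp only [hL]
  rw [gradL_apply, gradL_apply]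
  rw [integral_finsetSum _ fun i _ => integrable_finsetSum _ fun a _ =>
    integrable_finsetSum _ fun j _ => integrable_finsetSum _ fun b _ => hint i a j b, sum_inner]
  refine Finset.sum_congr rfl fun i _ => ?_
  rw [integral_finsetSum _ fun a _ => integrable_finsetSum _ fun j _ =>
    integrable_finsetSum _ fun b _ => hint i a j b, sum_inner]
  refine Finset.sum_congr rfl fun a _ => ?_
  rw [integral_finsetSum _ fun j _ => integrable_finsetSum _ fun b _ => hint i a j b, inner_sum]
  refine Finset.sum_congr rfl fun j _ => ?_
  rw [integral_finsetSum _ fun b _ => hint i a j b, inner_sum]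
  refine Finset.sum_congr rfl fun b _ => ?_
  rw [integral_mul_const, hμ.covariance, inner_elemTensor, inner_evalVec]

end Tensor

/-! ### Moments of linear functions -/

section Moments

variable {d : ℕ} {Ξ : Type} [NormedAddCommGroup Ξ] [InnerProductSpace ℝ Ξ]
  {μ : Measure (WienerSpace d)}

/-- A linear functional of finitely many values is centred Gaussian, and by the isometry property
its variance is the squared norm of `gradL t L`. -/
theorem IsWienerMeasure.eLpNorm_evalPts_real (hμ : IsWienerMeasure μ) {n : ℕ} (t : Fin n → I)
    (L : (Fin n → EuclideanSpace ℝ (Fin d)) →L[ℝ] ℝ) {r : ℝ≥0∞} (hr0 : r ≠ 0) (hr : r ≠ ⊤) :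
    eLpNorm (fun y => L (evalPts t y)) r μ =
      ‖gradL t L‖ₑ * ConjugateFunction.gaussMoment r.toReal ^ (1 / r.toReal) := by
  have := hμ.isProbabilityMeasure
  have hlaw : HasGaussianLaw (fun y => L (evalPts t y)) μ :=
    (hμ.hasGaussianLaw_evalPts t).map_fun L
  have hmean : ∫ y, L (evalPts t y) ∂μ = 0 := hμ.integral_dual_evalPts t L
  have hvar : variance (fun y => L (evalPts t y)) μ = ‖gradL t L‖ ^ 2 := by
    rw [variance_of_integral_eq_zero (by fun_prop) hmean, ← real_inner_self_eq_norm_sq,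
      ← hμ.integral_inner_evalPts]
    simp [pow_two]
  have hm := hlaw.map_eq_gaussianReal
  rw [hmean, hvar] at hm
  rw [eLpNorm_eq_lintegral_rpow_enorm_toReal hr0 hr]
  have h1 : ∫⁻ y, ‖L (evalPts t y)‖ₑ ^ r.toReal ∂μ =
      ∫⁻ x, ‖x‖ₑ ^ r.toReal ∂(μ.map fun y => L (evalPts t y)) := by
    rw [lintegral_map (by fun_prop) (by fun_prop)]
  have hr' := ENNReal.toReal_pos hr0 hr
  rw [h1, hm, ConjugateFunction.lintegral_gaussianReal_rpow ENNReal.toReal_nonneg,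
    ENNReal.mul_rpow_of_nonneg _ _ (by positivity), ← ENNReal.rpow_mul,
    mul_one_div_cancel hr'.ne', ENNReal.rpow_one]
  congr 1
  rw [Real.coe_toNNReal _ (sq_nonneg _), Real.sqrt_sq (norm_nonneg _), enorm_norm]

/-- The constant in the moment inequality for Gaussian vectors. -/
def momentConst (r : ℝ≥0∞) : ℝ≥0∞ :=
  ConjugateFunction.gaussMoment (max r 2).toReal ^ (1 / (max r 2).toReal)

theorem momentConst_ne_top {r : ℝ≥0∞} (hr : r ≠ ⊤) : momentConst r ≠ ⊤ :=
  ENNReal.rpow_ne_top_of_nonneg (by positivity) (ConjugateFunction.gaussMoment_ne_top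
    (ENNReal.toReal_pos (by positivity) (by simp [hr])))

/-- In an orthonormal basis of the range of `L`, the function `|L|²` is a sum of squares of real
Gaussian variables. The triangle inequality for these squares in `L^{R/2}`, with `R = max r 2`, adds
up the variances, so the constant does not depend on the rank. -/
theorem IsWienerMeasure.eLpNorm_evalPts_le (hμ : IsWienerMeasure μ) {n : ℕ} (t : Fin n → I)
    (L : (Fin n → EuclideanSpace ℝ (Fin d)) →L[ℝ] Ξ) {r : ℝ≥0∞} (hr : r ≠ ⊤) :
    eLpNorm (fun y => L (evalPts t y)) r μ ≤ momentConst r * ‖gradL t L‖ₑ := by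
  have := hμ.isProbabilityMeasure
  set R := max r 2 with hR
  have hR2 : 2 ≤ R := le_max_right _ _
  have hRt : R ≠ ⊤ := by simp [hR, hr]
  have hR0 : R ≠ 0 := by positivity
  have hLc : Continuous fun y : WienerSpace d => L (evalPts t y) := by fun_prop
  refine (eLpNorm_le_eLpNorm_of_exponent_le (le_max_left r 2) hLc.aestronglyMeasurable).trans ?_
  let S := L.toLinearMap.range
  let b := stdOrthonormalBasis ℝ S
  let Λ : Fin (Module.finrank ℝ S) → ((Fin n → EuclideanSpace ℝ (Fin d)) →L[ℝ] ℝ) := fun k =>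
    (innerSL ℝ (b k : Ξ)).comp L
  have hsum : ∀ v, ‖L v‖ ^ 2 = ∑ k, ‖Λ k v‖ ^ 2 := by
    intro v
    have h := b.sum_sq_norm_inner_right ⟨L v, LinearMap.mem_range_self _ v⟩
    simp only [Submodule.coe_norm, Submodule.coe_inner] at h
    rw [← h]
    simp [Λ]
  have hgrad : ‖gradL t L‖ₑ ^ 2 = ∑ k, ‖gradL t (Λ k)‖ₑ ^ 2 := by
    have h1 : ‖gradL t L‖ ^ 2 = ∑ k, ‖gradL t (Λ k)‖ ^ 2 := by
      simp only [← real_inner_self_eq_norm_sq, ← hμ.integral_inner_evalPts]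
      rw [← integral_finsetSum]
      · refine integral_congr_ae (Eventually.of_forall fun y => ?_)
        have := hsum (evalPts t y)
        simp only [real_inner_self_eq_norm_sq]
        exact this
      · intro k _
        have h := ((hμ.hasGaussianLaw_evalPts t).map_fun (Λ k)).memLp
          (ENNReal.ofNat_ne_top (n := 2))
        exact MemLp.integrable_inner' (p := 2) (q := 2) h h
    simp only [← ofReal_norm, ← ENNReal.ofReal_pow (norm_nonneg _)]
    rw [h1, ENNReal.ofReal_sum_of_nonneg fun _ _ => by positivity]
  -- The reason for the maximum with `2`: the triangle inequality needs `R/2 ≥ 1`.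
  have hR2' : 1 ≤ R / 2 := by
    rw [ENNReal.le_div_iff_mul_le (by simp) (by simp)]; simpa using hR2
  have key : ∀ {Ξ' : Type} [NormedAddCommGroup Ξ'] (f : WienerSpace d → Ξ'),
      eLpNorm (fun y => ‖f y‖ ^ 2) (R / 2) μ = eLpNorm f R μ ^ 2 := by
    intro Ξ' _ f
    have h := eLpNorm_norm_rpow (μ := μ) (p := R / 2) f (q := 2) two_pos
    simp only [Real.rpow_two] at h
    rw [h]
    simp only [ENNReal.ofReal_ofNat]
    rw [ENNReal.div_mul_cancel (by simp) (by simp)]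
    exact_mod_cast ENNReal.rpow_natCast _ 2
  have hsq : eLpNorm (fun y => L (evalPts t y)) R μ ^ 2 ≤ (momentConst r * ‖gradL t L‖ₑ) ^ 2 := by
    rw [← key, mul_pow, hgrad, Finset.mul_sum]
    have e1 : (fun y => ‖L (evalPts t y)‖ ^ 2) =
        ∑ k, fun y => ‖Λ k (evalPts t y)‖ ^ 2 := by
      ext y
      rw [hsum, Finset.sum_apply]
    rw [e1]
    refine (eLpNorm_sum_le (fun k _ => Continuous.aestronglyMeasurable (by fun_prop)) hR2').trans ?_
    refine Finset.sum_le_sum fun k _ => ?_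
    rw [key, hμ.eLpNorm_evalPts_real t (Λ k) hR0 hRt, momentConst, mul_pow, mul_comm]
  exact (ENNReal.pow_le_pow_left_iff two_ne_zero).1 hsq

end Moments

end Wiener

/-! ### Bounded convergence in `L^p` -/

section BoundedConvergence

variable {X : Type*} [MeasurableSpace X] {μ : Measure X} [IsFiniteMeasure μ] {Ξ : Type*}
  [NormedAddCommGroup Ξ] {p : ℝ≥0∞}

theorem tendsto_eLpNorm_sub_of_bounded {ι : Type*} {l : Filter ι} [l.IsCountablyGenerated]
    (hp0 : p ≠ 0) (hp : p ≠ ⊤) {f : ι → X → Ξ} {g : X → Ξ}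
    (hf : ∀ n, AEStronglyMeasurable (f n) μ) (hg : AEStronglyMeasurable g μ) {C : ℝ}
    (hC : ∀ n x, ‖f n x‖ ≤ C) (hgC : ∀ x, ‖g x‖ ≤ C)
    (h : ∀ x, Tendsto (fun n => f n x) l (𝓝 (g x))) :
    Tendsto (fun n => eLpNorm (fun x => f n x - g x) p μ) l (𝓝 0) := by
  have hpr := ENNReal.toReal_pos hp0 hp
  have h2 : Tendsto (fun n => ∫⁻ x, ‖f n x - g x‖ₑ ^ p.toReal ∂μ) l (𝓝 0) := by
    refine tendsto_of_seq_tendsto fun u hu => ?_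
    have h3 := tendsto_lintegral_of_dominated_convergence' (μ := μ)
      (F := fun n x => ‖f (u n) x - g x‖ₑ ^ p.toReal) (f := fun _ => 0)
      (fun _ => ENNReal.ofReal (2 * C) ^ p.toReal)
      (fun n => ((hf (u n)).sub hg).enorm.pow_const _)
      (fun n => Eventually.of_forall fun x => ?_) ?_ (Eventually.of_forall fun x => ?_)
    · simpa [Function.comp_def] using h3
    · refine ENNReal.rpow_le_rpow ?_ hpr.le
      rw [← ofReal_norm]
      refine ENNReal.ofReal_le_ofReal ((norm_sub_le _ _).trans ?_)
      linarith [hC (u n) x, hgC x]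
    · rw [lintegral_const]
      exact ENNReal.mul_ne_top (ENNReal.rpow_ne_top_of_nonneg hpr.le ENNReal.ofReal_ne_top)
        (measure_ne_top _ _)
    · have h4 : Tendsto (fun n => ‖f (u n) x - g x‖ₑ ^ p.toReal) atTop
          (𝓝 (‖g x - g x‖ₑ ^ p.toReal)) := by
        refine ((ENNReal.continuous_rpow_const.comp continuous_enorm).tendsto _).comp ?_
        exact ((h x).comp hu).sub_const _
      simpa [ENNReal.zero_rpow_of_pos hpr] using h4
  simp_rw [eLpNorm_eq_lintegral_rpow_enorm_toReal hp0 hp]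
  have h5 := (ENNReal.continuous_rpow_const (y := 1 / p.toReal)).tendsto 0 |>.comp h2
  rw [ENNReal.zero_rpow_of_pos (by positivity)] at h5
  exact h5

theorem continuous_toLp_of_bounded {Y Z : Type*} [TopologicalSpace Y] [FirstCountableTopology Y]
    [TopologicalSpace Z] [MeasurableSpace Z] [BorelSpace Z] [SecondCountableTopology Z]
    [TopologicalSpace.PseudoMetrizableSpace Z] {ν : Measure Z} [IsFiniteMeasure ν]
    [Fact (1 ≤ p)] (hp : p ≠ ⊤) {Φ : Y → Z → Ξ}
    (hΦ : Continuous (Function.uncurry Φ)) {C : ℝ} (hC : ∀ y z, ‖Φ y z‖ ≤ C)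
    (hm : ∀ y, MemLp (Φ y) p ν) : Continuous fun y => (hm y).toLp (Φ y) := by
  rw [continuous_iff_continuousAt]
  intro y
  rw [ContinuousAt, Lp.tendsto_Lp_iff_tendsto_eLpNorm']
  have hp0 : p ≠ 0 := (zero_lt_one.trans_le (Fact.out : 1 ≤ p)).ne'
  have hc : ∀ y, Continuous (Φ y) := fun y => hΦ.comp (by fun_prop : Continuous fun z => (y, z))
  have h := tendsto_eLpNorm_sub_of_bounded (μ := ν) (l := 𝓝 y) hp0 hp
    (f := Φ) (g := Φ y) (fun y => (hc y).aestronglyMeasurable) (hc y).aestronglyMeasurable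
    hC (hC y) (fun z => ?_)
  · refine h.congr fun y' => eLpNorm_congr_ae ?_
    filter_upwards [(hm y).coeFn_toLp, (hm y').coeFn_toLp] with z h1 h2
    rw [Pi.sub_apply, h1, h2]
  · exact (hΦ.comp (by fun_prop : Continuous fun y => (y, z))).continuousAt

end BoundedConvergence

namespace Wiener

open OrnsteinUhlenbeck

/-! ### The closed graph of the derivative -/

section Graph

variable {d : ℕ} {Ξ : Type} [NormedAddCommGroup Ξ] [InnerProductSpace ℝ Ξ]

/-- Smooth bounded functions with bounded derivative. -/
structure BddSmooth {n : ℕ} (f : (Fin n → EuclideanSpace ℝ (Fin d)) → Ξ) : Prop where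
  contDiff : ContDiff ℝ (⊤ : ℕ∞) f
  bdd : ∃ C, ∀ v, ‖f v‖ ≤ C
  bdd_fderiv : ∃ C, ∀ v, ‖fderiv ℝ f v‖ ≤ C

namespace BddSmooth

variable {n m : ℕ} {f g : (Fin n → EuclideanSpace ℝ (Fin d)) → Ξ}

theorem continuous (hf : BddSmooth f) : Continuous f := hf.contDiff.continuous

theorem continuous_fderiv (hf : BddSmooth f) : Continuous (fderiv ℝ f) :=
  hf.contDiff.continuous_fderiv (by simp)

theorem differentiable (hf : BddSmooth f) : Differentiable ℝ f :=
  hf.contDiff.differentiable (by simp)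

theorem of_schwartz (f : 𝓢(Fin n → EuclideanSpace ℝ (Fin d), Ξ)) : BddSmooth f where
  contDiff := f.smooth _
  bdd := ⟨_, f.norm_le_seminorm ℝ⟩
  bdd_fderiv := ⟨_, (SchwartzMap.fderivCLM ℝ _ _ f).norm_le_seminorm ℝ⟩

theorem add (hf : BddSmooth f) (hg : BddSmooth g) : BddSmooth fun v => f v + g v := by
  obtain ⟨A, hA⟩ := hf.bdd
  obtain ⟨B, hB⟩ := hg.bdd
  obtain ⟨A', hA'⟩ := hf.bdd_fderiv
  obtain ⟨B', hB'⟩ := hg.bdd_fderiv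
  refine ⟨hf.contDiff.add hg.contDiff,
    ⟨A + B, fun v => (norm_add_le _ _).trans (add_le_add (hA v) (hB v))⟩, ⟨A' + B', fun v => ?_⟩⟩
  rw [fderiv_fun_add (hf.differentiable v) (hg.differentiable v)]
  exact (norm_add_le _ _).trans (add_le_add (hA' v) (hB' v))

theorem smul (hf : BddSmooth f) (c : ℝ) : BddSmooth fun v => c • f v := by
  obtain ⟨A, hA⟩ := hf.bdd
  obtain ⟨A', hA'⟩ := hf.bdd_fderiv
  refine ⟨hf.contDiff.const_smul c, ⟨|c| * A, fun v => ?_⟩, ⟨|c| * A', fun v => ?_⟩⟩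
  · rw [norm_smul]; exact mul_le_mul_of_nonneg_left (hA v) (abs_nonneg c)
  · rw [fderiv_fun_const_smul (hf.differentiable v), norm_smul]
    exact mul_le_mul_of_nonneg_left (hA' v) (abs_nonneg c)

theorem fderiv_comp_affine (hf : BddSmooth f)
    (A : (Fin m → EuclideanSpace ℝ (Fin d)) →L[ℝ] (Fin n → EuclideanSpace ℝ (Fin d)))
    (b : Fin n → EuclideanSpace ℝ (Fin d)) (v : Fin m → EuclideanSpace ℝ (Fin d)) :
    fderiv ℝ (fun v => f (A v + b)) v = (fderiv ℝ f (A v + b)).comp A :=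
  ((hf.differentiable _).hasFDerivAt.comp v (A.hasFDerivAt.add_const b)).fderiv

/-- This is why the Schwartz class is enlarged: projections onto fewer coordinates and degenerate
dilations destroy decay but preserve boundedness. -/
theorem comp_affine (hf : BddSmooth f)
    (A : (Fin m → EuclideanSpace ℝ (Fin d)) →L[ℝ] (Fin n → EuclideanSpace ℝ (Fin d)))
    (b : Fin n → EuclideanSpace ℝ (Fin d)) : BddSmooth fun v => f (A v + b) := by
  obtain ⟨B, hB⟩ := hf.bdd
  obtain ⟨B', hB'⟩ := hf.bdd_fderiv
  refine ⟨hf.contDiff.comp (A.contDiff.add contDiff_const), ⟨B, fun v => hB _⟩,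
    ⟨B' * ‖A‖, fun v => ?_⟩⟩
  rw [hf.fderiv_comp_affine A b v]
  exact (ContinuousLinearMap.opNorm_comp_le _ _).trans
    (mul_le_mul_of_nonneg_right (hB' _) (norm_nonneg _))

/-- Approximation by compactly supported functions. -/
theorem exists_schwartz_seq (hf : BddSmooth f) :
    ∃ (g : ℕ → 𝓢(Fin n → EuclideanSpace ℝ (Fin d), Ξ)) (C : ℝ),
      (∀ m v, ‖g m v‖ ≤ C) ∧ (∀ m v, ‖fderiv ℝ (g m) v‖ ≤ C) ∧
      (∀ v, ‖f v‖ ≤ C) ∧ (∀ v, ‖fderiv ℝ f v‖ ≤ C) ∧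
      (∀ v, ∀ᶠ m in atTop, g m v = f v) ∧ ∀ v, ∀ᶠ m in atTop, fderiv ℝ (g m) v = fderiv ℝ f v := by
  obtain ⟨B, hB⟩ := hf.bdd
  obtain ⟨B', hB'⟩ := hf.bdd_fderiv
  let χ : ContDiffBump (0 : Fin n → EuclideanSpace ℝ (Fin d)) := ⟨1, 2, one_pos, one_lt_two⟩
  have hχs : ContDiff ℝ (⊤ : ℕ∞) χ := χ.contDiff
  obtain ⟨K, hK⟩ := (hχs.continuous_fderiv (by simp)).bounded_above_of_compact_support
    (χ.hasCompactSupport.fderiv ℝ)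
  -- Cutoffs at scale `m + 1`. Since the dilation factor is at most `1`, the derivative of the
  -- cutoff is bounded uniformly in `m`.
  let c : ℕ → ℝ := fun m => ((m : ℝ) + 1)⁻¹
  have hc0 : ∀ m, 0 < c m := fun m => by positivity
  have hc1 : ∀ m, c m ≤ 1 := fun m => inv_le_one_of_one_le₀ (by simp)
  have hcl : Tendsto c atTop (𝓝 0) := by
    simpa [c, one_div] using tendsto_one_div_add_atTop_nhds_zero_nat (𝕜 := ℝ)
  let g : ℕ → (Fin n → EuclideanSpace ℝ (Fin d)) → Ξ := fun m v => χ (c m • v) • f v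
  have hgc : ∀ m, HasCompactSupport (g m) := fun m =>
    (χ.hasCompactSupport.comp_smul (hc0 m).ne').smul_right
  have hgs : ∀ m, ContDiff ℝ (⊤ : ℕ∞) (g m) := fun m =>
    (hχs.comp (contDiff_const_smul (c m))).smul hf.contDiff
  have hB0 : 0 ≤ B := (norm_nonneg _).trans (hB 0)
  have hB0' : 0 ≤ B' := (norm_nonneg _).trans (hB' 0)
  have hK0 : 0 ≤ K := (norm_nonneg _).trans (hK 0)
  have hχ1 : ∀ v, ‖χ v‖ ≤ 1 := fun v => by
    rw [Real.norm_of_nonneg χ.nonneg]; exact χ.le_one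
  have hev : ∀ v, ∀ᶠ m in atTop, g m =ᶠ[𝓝 v] f := by
    intro v
    have h1 : Tendsto (fun m => c m * ‖v‖) atTop (𝓝 0) := by simpa using hcl.mul_const ‖v‖
    filter_upwards [h1.eventually_lt_const one_pos] with m hm
    have h2 : ∀ᶠ w in 𝓝 v, c m * ‖w‖ < 1 := by
      have hcont : Continuous fun w : Fin n → EuclideanSpace ℝ (Fin d) => c m * ‖w‖ := by fun_prop
      exact hcont.continuousAt.eventually_lt_const hm
    filter_upwards [h2] with w hw
    have h3 : χ (c m • w) = 1 := by
      refine χ.one_of_mem_closedBall ?_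
      rw [mem_closedBall_zero_iff, norm_smul, Real.norm_of_nonneg (hc0 m).le]
      exact hw.le
    simp [g, h3]
  refine ⟨fun m => (hgc m).toSchwartzMap (hgs m), B + B' + K * B, fun m v => ?_, fun m v => ?_,
    fun v => ?_, fun v => ?_, fun v => ?_, fun v => ?_⟩
  · change ‖χ (c m • v) • f v‖ ≤ _
    rw [norm_smul]
    calc ‖χ (c m • v)‖ * ‖f v‖ ≤ 1 * B := mul_le_mul (hχ1 _) (hB v) (norm_nonneg _) zero_le_one
      _ ≤ _ := by nlinarith
  · change ‖fderiv ℝ (g m) v‖ ≤ _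
    have hd : HasFDerivAt (fun w => χ (c m • w)) (c m • fderiv ℝ χ (c m • v)) v := by
      have h1 : HasFDerivAt χ (fderiv ℝ χ (c m • v)) (c m • v) :=
        (hχs.differentiable (by simp) _).hasFDerivAt
      have h2 := h1.comp v ((hasFDerivAt_id v).const_smul (c m))
      refine h2.congr_fderiv ?_
      ext w; simp
    have h3 := (hd.smul (hf.differentiable v).hasFDerivAt).fderiv
    rw [show fderiv ℝ (g m) v = _ from h3]
    refine (norm_add_le _ _).trans ?_
    rw [norm_smul, ContinuousLinearMap.norm_smulRight_apply, norm_smul,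
      Real.norm_of_nonneg (hc0 m).le]
    have e1 : ‖χ (c m • v)‖ * ‖fderiv ℝ f v‖ ≤ 1 * B' :=
      mul_le_mul (hχ1 _) (hB' v) (norm_nonneg _) zero_le_one
    have e2 : c m * ‖fderiv ℝ χ (c m • v)‖ * ‖f v‖ ≤ 1 * K * B :=
      mul_le_mul (mul_le_mul (hc1 m) (hK _) (norm_nonneg _) zero_le_one) (hB v) (norm_nonneg _)
        (by positivity)
    linarith
  · nlinarith [hB v]
  · nlinarith [hB' v]
  · filter_upwards [hev v] with m hm using hm.self_of_nhds
  · filter_upwards [hev v] with m hm using hm.fderiv_eq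

end BddSmooth

theorem gradL_append {n m : ℕ} (t : Fin n → I) (t' : Fin m → I)
    (L : (Fin (n + m) → EuclideanSpace ℝ (Fin d)) →L[ℝ] Ξ) :
    gradL (Fin.append t t') L =
      gradL t (L.comp (ContinuousLinearMap.pi fun i => Fin.addCases
        (motive := fun _ => (Fin n → EuclideanSpace ℝ (Fin d)) →L[ℝ] EuclideanSpace ℝ (Fin d))
        (fun i => ContinuousLinearMap.proj i) (fun _ => 0) i)) +
      gradL t' (L.comp (ContinuousLinearMap.pi fun i => Fin.addCases
        (motive := fun _ => (Fin m → EuclideanSpace ℝ (Fin d)) →L[ℝ] EuclideanSpace ℝ (Fin d))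
        (fun _ => 0) (fun i => ContinuousLinearMap.proj i) i)) := by
  rw [gradL_apply, gradL_apply, gradL_apply, Fin.sum_univ_add]
  congr 1
  · refine Finset.sum_congr rfl fun i _ => Finset.sum_congr rfl fun a _ => ?_
    rw [Fin.append_left, ContinuousLinearMap.comp_apply]
    congr 2
    ext j : 1
    refine Fin.addCases (fun j => ?_) (fun j => ?_) j
    · simp [Pi.single_apply]
    · simp [Pi.single_apply, Fin.ext_iff]
      intro h
      have := i.2
      omega
  · refine Finset.sum_congr rfl fun i _ => Finset.sum_congr rfl fun a _ => ?_
    rw [Fin.append_right, ContinuousLinearMap.comp_apply]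
    congr 2
    ext j : 1
    refine Fin.addCases (fun j => ?_) (fun j => ?_) j
    · simp [Pi.single_apply, Fin.ext_iff]
      intro h
      have := j.2
      omega
    · simp [Pi.single_apply]

/-- The cylindrical function defined by `f`. -/
def smoothCyl {n : ℕ} (t : Fin n → I) (f : (Fin n → EuclideanSpace ℝ (Fin d)) → Ξ)
    (w : WienerSpace d) : Ξ := f (evalPts t w)

/-- The derivative of `smoothCyl t f`. -/
def smoothCylGrad {n : ℕ} (t : Fin n → I) (f : (Fin n → EuclideanSpace ℝ (Fin d)) → Ξ)
    (w : WienerSpace d) : HTensor d Ξ := gradL t (fderiv ℝ f (evalPts t w))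

theorem BddSmooth.continuous_smoothCyl {n : ℕ} {t : Fin n → I}
    {f : (Fin n → EuclideanSpace ℝ (Fin d)) → Ξ} (hf : BddSmooth f) :
    Continuous (smoothCyl t f) := hf.continuous.comp (evalPts t).continuous

theorem BddSmooth.continuous_smoothCylGrad {n : ℕ} {t : Fin n → I}
    {f : (Fin n → EuclideanSpace ℝ (Fin d)) → Ξ} (hf : BddSmooth f) :
    Continuous (smoothCylGrad t f) :=
  (gradL t).continuous.comp (hf.continuous_fderiv.comp (evalPts t).continuous)

theorem BddSmooth.exists_norm_smoothCylGrad_le {n : ℕ} {t : Fin n → I}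
    {f : (Fin n → EuclideanSpace ℝ (Fin d)) → Ξ} (hf : BddSmooth f) :
    ∃ C, ∀ w, ‖smoothCylGrad t f w‖ ≤ C := by
  obtain ⟨C, hC⟩ := hf.bdd_fderiv
  exact ⟨‖gradL (Ξ := Ξ) t‖ * C, fun w => (gradL t).le_opNorm_of_le (hC _)⟩

theorem BddSmooth.memLp_smoothCyl {n : ℕ} {t : Fin n → I} {μ : Measure (WienerSpace d)}
    [IsFiniteMeasure μ] {f : (Fin n → EuclideanSpace ℝ (Fin d)) → Ξ} (hf : BddSmooth f)
    (p : ℝ≥0∞) : MemLp (smoothCyl t f) p μ := by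
  obtain ⟨C, hC⟩ := hf.bdd
  exact MemLp.of_bound hf.continuous_smoothCyl.aestronglyMeasurable C
    (Eventually.of_forall fun w => hC _)

theorem BddSmooth.memLp_smoothCylGrad {n : ℕ} {t : Fin n → I} {μ : Measure (WienerSpace d)}
    [IsFiniteMeasure μ] {f : (Fin n → EuclideanSpace ℝ (Fin d)) → Ξ} (hf : BddSmooth f)
    (p : ℝ≥0∞) : MemLp (smoothCylGrad t f) p μ := by
  obtain ⟨C, hC⟩ := hf.exists_norm_smoothCylGrad_le (t := t)
  exact MemLp.of_bound hf.continuous_smoothCylGrad.aestronglyMeasurable C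
    (Eventually.of_forall hC)

/-- Functions based on different times are put over the concatenated list of times; this makes the
graph on cylindrical functions a linear subspace. -/
theorem exists_smoothCyl_add {n m : ℕ} (t : Fin n → I) (t' : Fin m → I)
    {f : (Fin n → EuclideanSpace ℝ (Fin d)) → Ξ} (hf : BddSmooth f)
    {f' : (Fin m → EuclideanSpace ℝ (Fin d)) → Ξ} (hf' : BddSmooth f') :
    ∃ g : (Fin (n + m) → EuclideanSpace ℝ (Fin d)) → Ξ, BddSmooth g ∧
      (∀ w, smoothCyl (Fin.append t t') g w = smoothCyl t f w + smoothCyl t' f' w) ∧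
      ∀ w, smoothCylGrad (Fin.append t t') g w = smoothCylGrad t f w + smoothCylGrad t' f' w := by
  let P : (Fin (n + m) → EuclideanSpace ℝ (Fin d)) →L[ℝ] (Fin n → EuclideanSpace ℝ (Fin d)) :=
    ContinuousLinearMap.pi fun i => ContinuousLinearMap.proj (Fin.castAdd m i)
  let P' : (Fin (n + m) → EuclideanSpace ℝ (Fin d)) →L[ℝ] (Fin m → EuclideanSpace ℝ (Fin d)) :=
    ContinuousLinearMap.pi fun i => ContinuousLinearMap.proj (Fin.natAdd n i)
  have hP : ∀ w, P (evalPts (Fin.append t t') w) = evalPts t w := by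
    intro w; ext i : 1; simp [P]
  have hP' : ∀ w, P' (evalPts (Fin.append t t') w) = evalPts t' w := by
    intro w; ext i : 1; simp [P']
  have h1 := hf.comp_affine P 0
  have h2 := hf'.comp_affine P' 0
  refine ⟨_, h1.add h2, fun w => ?_, fun w => ?_⟩
  · simp only [smoothCyl, add_zero, hP, hP']
  · rw [smoothCylGrad, fderiv_fun_add (h1.differentiable _) (h2.differentiable _), map_add,
      hf.fderiv_comp_affine, hf'.fderiv_comp_affine, gradL_append, gradL_append]
    simp only [add_zero, hP, hP']
    rw [smoothCylGrad, smoothCylGrad]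
    -- The first function ignores the second block of coordinates, and conversely, so the cross
    -- terms vanish.
    have e1 : gradL t' (((fderiv ℝ f (evalPts t w)).comp P).comp
        (ContinuousLinearMap.pi fun i => Fin.addCases
        (motive := fun _ => (Fin m → EuclideanSpace ℝ (Fin d)) →L[ℝ] EuclideanSpace ℝ (Fin d))
        (fun _ => 0) (fun i => ContinuousLinearMap.proj i) i)) = 0 := by
      convert map_zero (gradL (Ξ := Ξ) t')
      ext v
      simp only [ContinuousLinearMap.comp_apply, zero_apply]
      convert map_zero (fderiv ℝ f (evalPts t w))
      ext i : 1
      simp [P]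
    have e2 : gradL t (((fderiv ℝ f' (evalPts t' w)).comp P').comp
        (ContinuousLinearMap.pi fun i => Fin.addCases
        (motive := fun _ => (Fin n → EuclideanSpace ℝ (Fin d)) →L[ℝ] EuclideanSpace ℝ (Fin d))
        (fun i => ContinuousLinearMap.proj i) (fun _ => 0) i)) = 0 := by
      convert map_zero (gradL (Ξ := Ξ) t)
      ext v
      simp only [ContinuousLinearMap.comp_apply, zero_apply]
      convert map_zero (fderiv ℝ f' (evalPts t' w))
      ext i : 1
      simp [P']
    rw [e1, e2, add_zero, zero_add]
    congr 2
    · ext v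
      simp only [ContinuousLinearMap.comp_apply]
      congr 1
      ext i : 1
      simp [P]
    · ext v
      simp only [ContinuousLinearMap.comp_apply]
      congr 1
      ext i : 1
      simp [P']

variable {μ : Measure (WienerSpace d)} [hμ : Fact (IsWienerMeasure μ)]

instance instIsProbabilityMeasure : IsProbabilityMeasure μ := hμ.out.isProbabilityMeasure

instance instIsFiniteMeasure : IsFiniteMeasure μ :=
  ⟨by rw [hμ.out.isProbabilityMeasure.measure_univ]; exact ENNReal.one_lt_top⟩

set_option synthInstance.maxHeartbeats 200000 in
instance instSFinite : SFinite μ := inferInstance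

instance instIsRotationInvariant : IsRotationInvariant μ where
  toIsProbabilityMeasure := hμ.out.isProbabilityMeasure
  map_rotation := hμ.out.map_rotation

variable {p : ℝ≥0∞} [Fact (1 ≤ p)]

variable (Ξ μ p) in
/-- The graph of the derivative on smooth cylindrical functions. -/
def smoothGraph : Submodule ℝ (Lp Ξ p μ × Lp (HTensor d Ξ) p μ) where
  carrier := {z | ∃ (n : ℕ) (t : Fin n → I) (f : (Fin n → EuclideanSpace ℝ (Fin d)) → Ξ),
    BddSmooth f ∧ z.1 =ᵐ[μ] smoothCyl t f ∧ z.2 =ᵐ[μ] smoothCylGrad t f}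
  zero_mem' := by
    refine ⟨0, Fin.elim0, 0, ⟨contDiff_const, ⟨0, by simp⟩, ⟨0, by simp⟩⟩, ?_, ?_⟩
    · exact Lp.coeFn_zero _ _ _
    · refine (Lp.coeFn_zero _ _ _).trans (Eventually.of_forall fun w => ?_)
      simp [smoothCylGrad]
  add_mem' := by
    rintro z z' ⟨n, t, f, hf, h1, h2⟩ ⟨m, t', f', hf', h1', h2'⟩
    obtain ⟨g, hg, hg1, hg2⟩ := exists_smoothCyl_add t t' hf hf'
    refine ⟨_, Fin.append t t', g, hg, ?_, ?_⟩
    · filter_upwards [h1, h1', Lp.coeFn_add z.1 z'.1] with w e1 e2 e3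
      rw [hg1, Prod.fst_add, e3, Pi.add_apply, e1, e2]
    · filter_upwards [h2, h2', Lp.coeFn_add z.2 z'.2] with w e1 e2 e3
      rw [hg2, Prod.snd_add, e3, Pi.add_apply, e1, e2]
  smul_mem' := by
    rintro c z ⟨n, t, f, hf, h1, h2⟩
    refine ⟨n, t, _, hf.smul c, ?_, ?_⟩
    · filter_upwards [h1, Lp.coeFn_smul c z.1] with w e1 e2
      rw [Prod.smul_fst, e2, Pi.smul_apply, e1]
      rfl
    · filter_upwards [h2, Lp.coeFn_smul c z.2] with w e1 e2
      rw [Prod.smul_snd, e2, Pi.smul_apply, e1, smoothCylGrad, smoothCylGrad,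
        fderiv_fun_const_smul (hf.differentiable _), map_smul]

variable (Ξ μ p) in
/-- The closed graph of the derivative. -/
def gradGraph : Submodule ℝ (Lp Ξ p μ × Lp (HTensor d Ξ) p μ) :=
  (smoothGraph Ξ μ p).topologicalClosure

theorem isClosed_gradGraph : IsClosed (gradGraph Ξ μ p : Set (Lp Ξ p μ × Lp (HTensor d Ξ) p μ)) :=
  Submodule.isClosed_topologicalClosure _

theorem BddSmooth.toLp_mem_gradGraph {n : ℕ} {t : Fin n → I}
    {f : (Fin n → EuclideanSpace ℝ (Fin d)) → Ξ} (hf : BddSmooth f) :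
    ((hf.memLp_smoothCyl p).toLp (smoothCyl t f),
      (hf.memLp_smoothCylGrad p).toLp (smoothCylGrad t f)) ∈ gradGraph Ξ μ p :=
  Submodule.le_topologicalClosure _ ⟨n, t, f, hf,
    (hf.memLp_smoothCyl p).coeFn_toLp, (hf.memLp_smoothCylGrad p).coeFn_toLp⟩

/-- Schwartz functions are bounded smooth, and bounded smooth functions are limits of compactly
supported ones together with their gradients; the two closures therefore agree. From here on the
derivative is handled as a closed subspace. -/
theorem hasGrad_iff [hp : Fact (p ≠ ⊤)] {F : Lp Ξ p μ} {G : Lp (HTensor d Ξ) p μ} :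
    HasGrad F G ↔ (F, G) ∈ gradGraph Ξ μ p := by
  have hcg : ∀ {n : ℕ} (t : Fin n → I) (f : 𝓢(Fin n → EuclideanSpace ℝ (Fin d), Ξ)),
      cylGrad t f = smoothCylGrad t f := fun t f => funext fun w => cylGrad_eq t f w
  have hp0 : p ≠ 0 := (zero_lt_one.trans_le (Fact.out : 1 ≤ p)).ne'
  constructor
  · rintro ⟨n, t, f, h1, h2⟩
    refine isClosed_gradGraph.mem_of_tendsto (b := atTop) (f := fun m =>
      (((BddSmooth.of_schwartz (f m)).memLp_smoothCyl p).toLp (smoothCyl (t m) (f m)),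
      ((BddSmooth.of_schwartz (f m)).memLp_smoothCylGrad p).toLp (smoothCylGrad (t m) (f m)))) ?_
      (Eventually.of_forall fun m => (BddSmooth.of_schwartz (f m)).toLp_mem_gradGraph)
    refine Tendsto.prodMk_nhds ?_ ?_
    · rw [Lp.tendsto_Lp_iff_tendsto_eLpNorm']
      refine h1.congr fun m => eLpNorm_congr_ae ?_
      filter_upwards [((BddSmooth.of_schwartz (f m)).memLp_smoothCyl (μ := μ) (t := t m)
        p).coeFn_toLp] with w hw
      rw [Pi.sub_apply, hw]
      rfl
    · rw [Lp.tendsto_Lp_iff_tendsto_eLpNorm']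
      refine h2.congr fun m => eLpNorm_congr_ae ?_
      filter_upwards [((BddSmooth.of_schwartz (f m)).memLp_smoothCylGrad (μ := μ) (t := t m)
        p).coeFn_toLp] with w hw
      rw [Pi.sub_apply, hw, hcg]
  · intro h
    let S : Set (Lp Ξ p μ × Lp (HTensor d Ξ) p μ) :=
      {z | ∃ (n : ℕ) (t : Fin n → I) (f : 𝓢(Fin n → EuclideanSpace ℝ (Fin d), Ξ)),
        z.1 =ᵐ[μ] cyl t f ∧ z.2 =ᵐ[μ] cylGrad t f}
    have hS : (smoothGraph Ξ μ p : Set (Lp Ξ p μ × Lp (HTensor d Ξ) p μ)) ⊆ closure S := by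
      rintro z ⟨n, t, f, hf, h1, h2⟩
      obtain ⟨g, C, g1, g2, g3, g4, g5, g6⟩ := hf.exists_schwartz_seq
      have hg := fun m => BddSmooth.of_schwartz (g m)
      refine mem_closure_of_tendsto (b := atTop) (f := fun m =>
        (((hg m).memLp_smoothCyl p).toLp (smoothCyl t (g m)),
        ((hg m).memLp_smoothCylGrad p).toLp (smoothCylGrad t (g m)))) ?_
        (Eventually.of_forall fun m => ⟨n, t, g m,
          ((hg m).memLp_smoothCyl p).coeFn_toLp, ?_⟩)
      · refine Tendsto.prodMk_nhds ?_ ?_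
        · rw [Lp.tendsto_Lp_iff_tendsto_eLpNorm']
          have := tendsto_eLpNorm_sub_of_bounded (μ := μ) (l := atTop) hp0 hp.out
            (f := fun m => smoothCyl t (g m)) (g := smoothCyl t f)
            (fun m => (hg m).continuous_smoothCyl.aestronglyMeasurable)
            hf.continuous_smoothCyl.aestronglyMeasurable (fun m w => g1 m _) (fun w => g3 _)
            (fun w => tendsto_const_nhds.congr' (by
              filter_upwards [g5 (evalPts t w)] with m hm using hm.symm))
          refine this.congr fun m => eLpNorm_congr_ae ?_
          filter_upwards [((hg m).memLp_smoothCyl (μ := μ) (t := t) p).coeFn_toLp, h1] with w e1 e2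
          rw [Pi.sub_apply, e1, e2]
        · rw [Lp.tendsto_Lp_iff_tendsto_eLpNorm']
          have := tendsto_eLpNorm_sub_of_bounded (μ := μ) (l := atTop) hp0 hp.out
            (f := fun m => smoothCylGrad t (g m)) (g := smoothCylGrad t f)
            (fun m => (hg m).continuous_smoothCylGrad.aestronglyMeasurable)
            hf.continuous_smoothCylGrad.aestronglyMeasurable
            (C := ‖gradL (Ξ := Ξ) t‖ * C)
            (fun m w => (gradL t).le_opNorm_of_le (g2 m _))
            (fun w => (gradL t).le_opNorm_of_le (g4 _))
            (fun w => tendsto_const_nhds.congr' (by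
              filter_upwards [g6 (evalPts t w)] with m hm
              rw [smoothCylGrad, smoothCylGrad, hm]))
          refine this.congr fun m => eLpNorm_congr_ae ?_
          filter_upwards [((hg m).memLp_smoothCylGrad (μ := μ) (t := t) p).coeFn_toLp, h2]
            with w e1 e2
          rw [Pi.sub_apply, e1, e2]
      · rw [hcg]; exact ((hg m).memLp_smoothCylGrad p).coeFn_toLp
    have h' : (F, G) ∈ closure S := closure_minimal hS isClosed_closure h
    obtain ⟨z, hz, hlim⟩ := mem_closure_iff_seq_limit.1 h'
    choose n t f hf1 hf2 using hz
    refine ⟨n, t, f, ?_, ?_⟩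
    · have h1 := (Lp.tendsto_Lp_iff_tendsto_eLpNorm' _ _).1
        ((continuous_fst.tendsto (F, G)).comp hlim)
      refine h1.congr fun m => eLpNorm_congr_ae ?_
      filter_upwards [hf1 m] with w hw
      rw [Pi.sub_apply, Function.comp_apply, hw]
    · have h1 := (Lp.tendsto_Lp_iff_tendsto_eLpNorm' _ _).1
        ((continuous_snd.tendsto (F, G)).comp hlim)
      refine h1.congr fun m => eLpNorm_congr_ae ?_
      filter_upwards [hf2 m] with w hw
      rw [Pi.sub_apply, Function.comp_apply, hw]

end Graph

end Wiener

namespace Wiener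

open OrnsteinUhlenbeck

instance instSecondCountableTopologyEitherWienerSpace (d : ℕ) (X : Type*) [TopologicalSpace X] :
    SecondCountableTopologyEither (WienerSpace d) X :=
  secondCountableTopologyEither_of_left _ _

/-! ### The graph of the derivative under the semigroup. -/

section Stability

variable {d : ℕ} {Ξ : Type} [NormedAddCommGroup Ξ] [InnerProductSpace ℝ Ξ] [CompleteSpace Ξ]
  {μ : Measure (WienerSpace d)} [hμ : Fact (IsWienerMeasure μ)]
  {p : ℝ≥0∞} [Fact (1 ≤ p)] [hp : Fact (p ≠ ⊤)]

/-- Integrals of elements of the closed graph. -/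
theorem integral_mem_gradGraph {T : Type*} [MeasurableSpace T] {ν : Measure T}
    [IsProbabilityMeasure ν] {F : T → Lp Ξ p μ} {G : T → Lp (HTensor d Ξ) p μ}
    (hF : Integrable F ν) (hG : Integrable G ν) (h : ∀ᵐ t ∂ν, (F t, G t) ∈ gradGraph Ξ μ p) :
    (∫ t, F t ∂ν, ∫ t, G t ∂ν) ∈ gradGraph Ξ μ p := by
  rw [← integral_pair hF hG]
  exact Convex.integral_mem (Submodule.convex _) isClosed_gradGraph h (hF.prodMk hG)

/-- Rewrites Mehler's formula as a Bochner integral over `y` of elements of `L^p`, so that a closed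
subspace containing the integrand contains the integral. -/
theorem integral_toLp_eq_mehlerLp {Ξ' : Type} [NormedAddCommGroup Ξ'] [InnerProductSpace ℝ Ξ']
    [CompleteSpace Ξ'] {f : WienerSpace d → Ξ'} (hf : Continuous f) {C : ℝ} (hC : ∀ x, ‖f x‖ ≤ C)
    {F : Lp Ξ' p μ} (hF : F =ᵐ[μ] f) (θ : ℝ)
    (hm : ∀ y, MemLp (fun x => f (mix θ (x, y))) p μ) :
    Integrable (fun y => (hm y).toLp _) μ ∧ ∫ y, (hm y).toLp _ ∂μ = mehlerLp μ θ F := by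
  have hΦ : Continuous (Function.uncurry fun (y x : WienerSpace d) => f (mix θ (x, y))) :=
    hf.comp ((mix θ).continuous.comp (by fun_prop : Continuous fun z : WienerSpace d × WienerSpace d
      => (z.2, z.1)))
  have hint : Integrable (fun y => (hm y).toLp _) μ := by
    refine Integrable.of_bound (continuous_toLp_of_bounded hp.out hΦ (fun y x => hC _)
      hm).aestronglyMeasurable (C) (Eventually.of_forall fun y => ?_)
    have h := Lp.norm_le_of_ae_bound (f := (hm y).toLp _) (C := C)
      ((norm_nonneg _).trans (hC 0)) (by
        filter_upwards [(hm y).coeFn_toLp] with x hx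
        rw [hx]; exact hC _)
    simpa [measureUnivNNReal] using h
  refine ⟨hint, Lp.ext ?_⟩
  refine (coeFn_integral_Lp (g := fun z => f (mix θ (z.2, z.1))) hint ?_
    (Eventually.of_forall fun y => (hm y).coeFn_toLp)).trans (coeFn_mehlerLp θ hF).symm
  exact Integrable.of_bound hΦ.aestronglyMeasurable C (Eventually.of_forall fun z => hC _)

/-- For fixed `y` the function `x ↦ F(cos θ x + sin θ y)` is cylindrical in `x`, and the chain rule
produces the factor `cos θ`. Integration over `y` stays in the closed graph. -/
theorem mehlerLp_mem_gradGraph (θ : ℝ) {F : Lp Ξ p μ} {G : Lp (HTensor d Ξ) p μ}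
    (h : (F, G) ∈ gradGraph Ξ μ p) :
    (mehlerLp μ θ F, Real.cos θ • mehlerLp μ θ G) ∈ gradGraph Ξ μ p := by
  have hcl : IsClosed {z : Lp Ξ p μ × Lp (HTensor d Ξ) p μ |
      (mehlerLp μ θ z.1, Real.cos θ • mehlerLp μ θ z.2) ∈ gradGraph Ξ μ p} := by
    refine isClosed_gradGraph.preimage ?_
    have h2 : Continuous fun z : Lp Ξ p μ × Lp (HTensor d Ξ) p μ =>
        Real.cos θ • mehlerLp μ θ z.2 :=
      (continuous_const_smul (Real.cos θ)).comp ((mehlerLp μ θ).continuous.comp continuous_snd)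
    exact ((mehlerLp μ θ).continuous.comp continuous_fst).prodMk h2
  refine closure_minimal ?_ hcl h
  rintro z ⟨n, t, f, hf, h1, h2⟩
  rw [Set.mem_ofPred_eq]
  obtain ⟨C, hC⟩ := hf.bdd
  obtain ⟨C', hC'⟩ := hf.exists_norm_smoothCylGrad_le (t := t)
  let A : (Fin n → EuclideanSpace ℝ (Fin d)) →L[ℝ] (Fin n → EuclideanSpace ℝ (Fin d)) :=
    Real.cos θ • ContinuousLinearMap.id ℝ _
  have hfy : ∀ y : WienerSpace d, BddSmooth fun v => f (A v + Real.sin θ • evalPts t y) :=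
    fun y => hf.comp_affine A _
  have hev : ∀ x y : WienerSpace d, A (evalPts t x) + Real.sin θ • evalPts t y =
      evalPts t (mix θ (x, y)) := by
    intro x y; simp [A, mix_apply]
  have hm : ∀ y, MemLp (fun x => smoothCyl t f (mix θ (x, y))) p μ := by
    intro y
    refine MemLp.of_bound (hf.continuous_smoothCyl.comp ((mix θ).continuous.comp
      (by fun_prop))).aestronglyMeasurable C (Eventually.of_forall fun w => hC _)
  have hm' : ∀ y, MemLp (fun x => smoothCylGrad t f (mix θ (x, y))) p μ := by
    intro y
    refine MemLp.of_bound (hf.continuous_smoothCylGrad.comp ((mix θ).continuous.comp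
      (by fun_prop))).aestronglyMeasurable C' (Eventually.of_forall fun w => hC' _)
  obtain ⟨i1, e1⟩ := integral_toLp_eq_mehlerLp hf.continuous_smoothCyl (fun x => hC _) h1 θ hm
  obtain ⟨i2, e2⟩ := integral_toLp_eq_mehlerLp hf.continuous_smoothCylGrad hC' h2 θ hm'
  rw [← e1, ← e2, ← integral_smul]
  refine integral_mem_gradGraph i1 (i2.smul (Real.cos θ) :) (Eventually.of_forall fun y => ?_)
  refine Submodule.le_topologicalClosure _ ⟨n, t, _, hfy y, ?_, ?_⟩
  · refine (hm y).coeFn_toLp.trans (Eventually.of_forall fun x => ?_)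
    simp only [smoothCyl, hev]
  · filter_upwards [(hm' y).coeFn_toLp, Lp.coeFn_smul (Real.cos θ) ((hm' y).toLp _)] with x g1 g2
    rw [g2, Pi.smul_apply, g1, smoothCylGrad, smoothCylGrad, hf.fderiv_comp_affine, hev,
      ← map_smul]
    congr 1
    ext v
    simp [A]

theorem ouLp_mem_gradGraph (c : ℕ) (s : ℝ) {F : Lp Ξ p μ} {G : Lp (HTensor d Ξ) p μ}
    (h : (F, G) ∈ gradGraph Ξ μ p) :
    (ouLp μ c s F, ouLp μ (c + 1) s G) ∈ gradGraph Ξ μ p := by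
  have := (gradGraph Ξ μ p).smul_mem (Real.cos (ouAngle s) ^ c)
    (mehlerLp_mem_gradGraph (ouAngle s) h)
  rw [Prod.smul_mk, smul_smul, ← pow_succ] at this
  exact this

/-- The factor `cos θ = exp(-t)` gained by each derivative is absorbed by raising `c` to `c + 1`. -/
theorem pot_mem_gradGraph (c k : ℕ) {F : Lp Ξ p μ} {G : Lp (HTensor d Ξ) p μ}
    (h : (F, G) ∈ gradGraph Ξ μ p) :
    (pot μ c k F, pot μ (c + 1) k G) ∈ gradGraph Ξ μ p :=
  integral_mem_gradGraph (integrable_ouLp _ c F) (integrable_ouLp _ (c + 1) G)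
    (Eventually.of_forall fun s => ouLp_mem_gradGraph c s h)

/-- Every function in `L^p` is a limit of functions in the domain of the derivative. -/
theorem exists_mem_gradGraph_norm_sub_le (F : Lp Ξ p μ) {ε : ℝ} (hε : 0 < ε) :
    ∃ z ∈ smoothGraph Ξ μ p, ‖F - z.1‖ ≤ ε := by
  obtain ⟨n, t, f, hf⟩ := hμ.out.exists_cyl_eLpNorm_sub_le Fact.out hp.out (Lp.memLp F)
    (ε := ENNReal.ofReal ε) (by simpa using hε)
  have hb := BddSmooth.of_schwartz f
  refine ⟨((hb.memLp_smoothCyl p).toLp (smoothCyl t f),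
      (hb.memLp_smoothCylGrad p).toLp (smoothCylGrad t f)),
    ⟨n, t, f, hb, (hb.memLp_smoothCyl p).coeFn_toLp, (hb.memLp_smoothCylGrad p).coeFn_toLp⟩, ?_⟩
  rw [Lp.norm_def]
  refine ENNReal.toReal_le_of_le_ofReal hε.le (le_trans (le_of_eq (eLpNorm_congr_ae ?_)) hf)
  filter_upwards [(hb.memLp_smoothCyl (t := t) (μ := μ) p).coeFn_toLp,
    Lp.coeFn_sub F ((hb.memLp_smoothCyl (t := t) (μ := μ) p).toLp _)] with w h1 h2
  rw [h2, Pi.sub_apply, h1]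
  rfl

theorem mem_closure_fst_smoothGraph (F : Lp Ξ p μ) :
    F ∈ closure (Prod.fst '' (smoothGraph Ξ μ p : Set (Lp Ξ p μ × Lp (HTensor d Ξ) p μ))) := by
  rw [Metric.mem_closure_iff]
  intro ε hε
  obtain ⟨z, hz, h⟩ := exists_mem_gradGraph_norm_sub_le F (half_pos hε)
  exact ⟨z.1, ⟨z, hz, rfl⟩, by rw [dist_eq_norm]; linarith⟩

end Stability

end Wiener

namespace Wiener

open OrnsteinUhlenbeck

/-! ### Integration by parts -/

section IntegrationByParts

variable {d : ℕ} {Ξ : Type} [NormedAddCommGroup Ξ] [InnerProductSpace ℝ Ξ] [CompleteSpace Ξ]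
  {μ : Measure (WienerSpace d)} [hμ : Fact (IsWienerMeasure μ)]

theorem memLp_evalPts {n : ℕ} (t : Fin n → I) {r : ℝ≥0∞} (hr : r ≠ ⊤) :
    MemLp (fun w : WienerSpace d => evalPts t w) r μ :=
  (hμ.out.hasGaussianLaw_evalPts t).memLp hr

theorem memLp_evalPts_prod {n : ℕ} (t : Fin n → I) {r : ℝ≥0∞} (hr : r ≠ ⊤) :
    MemLp (fun z : WienerSpace d × WienerSpace d => ‖evalPts t z.1‖ + ‖evalPts t z.2‖) r
      (μ.prod μ) :=
  ((memLp_evalPts t hr).comp_measurePreserving measurePreserving_fst).norm.add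
    ((memLp_evalPts t hr).comp_measurePreserving measurePreserving_snd).norm

theorem evalPts_mix {n : ℕ} (t : Fin n → I) (θ : ℝ) (z : WienerSpace d × WienerSpace d) :
    evalPts t (mix θ z) = Real.cos θ • evalPts t z.1 + Real.sin θ • evalPts t z.2 := by
  simp [mix_apply]

theorem norm_cos_smul_add_sin_smul_le {V : Type*} [NormedAddCommGroup V] [NormedSpace ℝ V]
    (θ : ℝ) (x y : V) : ‖-Real.sin θ • x + Real.cos θ • y‖ ≤ ‖x‖ + ‖y‖ := by
  refine (norm_add_le _ _).trans (add_le_add ?_ ?_)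
  · rw [norm_smul, norm_neg]
    exact mul_le_of_le_one_left (norm_nonneg _) (Real.abs_sin_le_one θ)
  · rw [norm_smul]
    exact mul_le_of_le_one_left (norm_nonneg _) (Real.abs_cos_le_one θ)

theorem hasDerivAt_cos_smul_add_sin_smul {V : Type*} [NormedAddCommGroup V] [NormedSpace ℝ V]
    (θ : ℝ) (x y : V) : HasDerivAt (fun θ => Real.cos θ • x + Real.sin θ • y)
      (-Real.sin θ • x + Real.cos θ • y) θ :=
  ((Real.hasDerivAt_cos θ).smul_const x).add ((Real.hasDerivAt_sin θ).smul_const y)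

/-- By rotation invariance `E⟨L(-sin θ x + cos θ y), f(cos θ x + sin θ y)⟩` does not depend on `θ`.
Its derivative at `0` is `E⟨L y, f'(x) y⟩ - E⟨L x, f(x)⟩`, and the isometry property in `y`
evaluates the first term. -/
theorem integral_inner_evalPts_smoothCyl {n m : ℕ} (t : Fin n → I) (t' : Fin m → I)
    (L : (Fin n → EuclideanSpace ℝ (Fin d)) →L[ℝ] Ξ)
    {f : (Fin m → EuclideanSpace ℝ (Fin d)) → Ξ} (hf : BddSmooth f) :
    ∫ y, inner ℝ (L (evalPts t y)) (smoothCyl t' f y) ∂μ =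
      ∫ y, inner ℝ (gradL t L) (smoothCylGrad t' f y) ∂μ := by
  obtain ⟨A, hA⟩ := hf.bdd
  obtain ⟨B, hB⟩ := hf.bdd_fderiv
  have hA0 : 0 ≤ A := (norm_nonneg _).trans (hA 0)
  have hB0 : 0 ≤ B := (norm_nonneg _).trans (hB 0)
  have hfc := hf.continuous
  have hfc' := hf.continuous_fderiv
  let P : ℝ → WienerSpace d × WienerSpace d → Ξ := fun θ z =>
    L (-Real.sin θ • evalPts t z.1 + Real.cos θ • evalPts t z.2)
  let P' : ℝ → WienerSpace d × WienerSpace d → Ξ := fun θ z =>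
    L (-Real.cos θ • evalPts t z.1 + -Real.sin θ • evalPts t z.2)
  let Q : ℝ → WienerSpace d × WienerSpace d → Ξ := fun θ z =>
    f (Real.cos θ • evalPts t' z.1 + Real.sin θ • evalPts t' z.2)
  let Q' : ℝ → WienerSpace d × WienerSpace d → Ξ := fun θ z =>
    fderiv ℝ f (Real.cos θ • evalPts t' z.1 + Real.sin θ • evalPts t' z.2)
      (-Real.sin θ • evalPts t' z.1 + Real.cos θ • evalPts t' z.2)
  let X : WienerSpace d × WienerSpace d → ℝ := fun z => ‖evalPts t z.1‖ + ‖evalPts t z.2‖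
  let Y : WienerSpace d × WienerSpace d → ℝ := fun z => ‖evalPts t' z.1‖ + ‖evalPts t' z.2‖
  have hX : MemLp X 2 (μ.prod μ) := memLp_evalPts_prod t ENNReal.ofNat_ne_top
  have hY : MemLp Y 2 (μ.prod μ) := memLp_evalPts_prod t' ENNReal.ofNat_ne_top
  have hXi : Integrable X (μ.prod μ) := hX.integrable (by norm_num)
  have hPn : ∀ θ z, ‖P θ z‖ ≤ ‖L‖ * X z := fun θ z =>
    L.le_opNorm_of_le (norm_cos_smul_add_sin_smul_le θ _ _)
  have hPn' : ∀ θ z, ‖P' θ z‖ ≤ ‖L‖ * X z := by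
    intro θ z
    refine L.le_opNorm_of_le ?_
    have h := norm_cos_smul_add_sin_smul_le (θ + Real.pi / 2) (evalPts t z.1) (evalPts t z.2)
    rwa [Real.sin_add_pi_div_two, Real.cos_add_pi_div_two] at h
  have hQn' : ∀ θ z, ‖Q' θ z‖ ≤ B * Y z := fun θ z =>
    ((fderiv ℝ f _).le_opNorm_of_le (norm_cos_smul_add_sin_smul_le θ _ _)).trans
      (mul_le_mul_of_nonneg_right (hB _) (by positivity))
  have hPc : ∀ θ, Continuous (P θ) := fun θ => by fun_prop
  have hPc' : ∀ θ, Continuous (P' θ) := fun θ => by fun_prop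
  have hQc : ∀ θ, Continuous (Q θ) := fun θ => by fun_prop
  have hQc' : ∀ θ, Continuous (Q' θ) := fun θ => by fun_prop
  have hPi : ∀ θ, Integrable (fun z => inner ℝ (P θ z) (Q θ z)) (μ.prod μ) := by
    intro θ
    refine Integrable.mono' ((hXi.const_mul ‖L‖).mul_const A)
      ((hPc θ).inner (hQc θ)).aestronglyMeasurable (Eventually.of_forall fun z => ?_)
    exact (norm_inner_le_norm _ _).trans
      (mul_le_mul (hPn θ z) (hA _) (norm_nonneg _) (by positivity))
  have hderiv := hasDerivAt_integral_of_dominated_loc_of_deriv_le (μ := μ.prod μ) (𝕜 := ℝ)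
    (F := fun θ z => inner ℝ (P θ z) (Q θ z)) (x₀ := 0) (s := Set.univ)
    (F' := fun θ z => inner ℝ (P θ z) (Q' θ z) + inner ℝ (P' θ z) (Q θ z))
    (bound := fun z => ‖L‖ * B * (X z * Y z) + ‖L‖ * X z * A) Filter.univ_mem
    (Eventually.of_forall fun θ => ((hPc θ).inner (hQc θ)).aestronglyMeasurable) (hPi 0)
    (((hPc 0).inner (hQc' 0)).add ((hPc' 0).inner (hQc 0))).aestronglyMeasurable
    (Eventually.of_forall fun z θ _ => ?_)
    (((hX.integrable_mul hY).const_mul _).add ((hXi.const_mul _).mul_const _))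
    (Eventually.of_forall fun z θ _ => ?_)
  rotate_left
  · refine (norm_add_le _ _).trans (add_le_add ?_ ?_)
    · refine (norm_inner_le_norm _ _).trans ((mul_le_mul (hPn θ z) (hQn' θ z) (norm_nonneg _)
        (by positivity)).trans (le_of_eq (by ring)))
    · exact (norm_inner_le_norm _ _).trans
        (mul_le_mul (hPn' θ z) (hA _) (norm_nonneg _) (by positivity))
  · have h1 : HasDerivAt (fun θ => P θ z) (P' θ z) θ := by
      have h := hasDerivAt_cos_smul_add_sin_smul (θ + Real.pi / 2) (evalPts t z.1) (evalPts t z.2)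
      have h2 := h.comp_add_const θ (Real.pi / 2)
      simp only [Real.sin_add_pi_div_two, Real.cos_add_pi_div_two] at h2
      exact L.hasFDerivAt.comp_hasDerivAt θ h2
    have h2 : HasDerivAt (fun θ => Q θ z) (Q' θ z) θ :=
      (hf.differentiable _).hasFDerivAt.comp_hasDerivAt θ
        (hasDerivAt_cos_smul_add_sin_smul θ (evalPts t' z.1) (evalPts t' z.2))
    exact h1.inner ℝ h2
  have hconst : ∀ θ, ∫ z, inner ℝ (P θ z) (Q θ z) ∂(μ.prod μ) =
      ∫ z, inner ℝ (P 0 z) (Q 0 z) ∂(μ.prod μ) := by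
    intro θ
    have h := integral_map (μ := μ.prod μ) (φ := ContinuousLinearMap.rotation θ)
      (f := fun z => inner ℝ (P 0 z) (Q 0 z)) (by fun_prop)
      ((hPc 0).inner (hQc 0)).aestronglyMeasurable
    rw [(measurePreserving_rotation (μ := μ) θ).map_eq] at h
    rw [h]
    refine integral_congr_ae (Eventually.of_forall fun z => ?_)
    simp [P, Q, ContinuousLinearMap.rotation_apply]
  -- The derivative of a constant function vanishes.
  have h0 := hderiv.2.unique ((hasDerivAt_const (0 : ℝ) _).congr_of_eventuallyEq
    (Eventually.of_forall hconst))
  have hi1 : Integrable (fun z => inner ℝ (P 0 z) (Q' 0 z)) (μ.prod μ) := by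
    refine Integrable.mono' ((hX.integrable_mul hY).const_mul (‖L‖ * B))
      ((hPc 0).inner (hQc' 0)).aestronglyMeasurable (Eventually.of_forall fun z => ?_)
    exact (norm_inner_le_norm _ _).trans ((mul_le_mul (hPn 0 z) (hQn' 0 z) (norm_nonneg _)
        (by positivity)).trans (le_of_eq (by simp only [Pi.mul_apply]; ring)))
  have hi2 : Integrable (fun z => inner ℝ (P' 0 z) (Q 0 z)) (μ.prod μ) := by
    refine Integrable.mono' ((hXi.const_mul ‖L‖).mul_const A)
      ((hPc' 0).inner (hQc 0)).aestronglyMeasurable (Eventually.of_forall fun z => ?_)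
    exact (norm_inner_le_norm _ _).trans
      (mul_le_mul (hPn' 0 z) (hA _) (norm_nonneg _) (by positivity))
  rw [integral_add hi1 hi2, integral_prod _ hi1, integral_prod _ hi2] at h0
  have e1 : ∀ x, ∫ y, inner ℝ (P 0 (x, y)) (Q' 0 (x, y)) ∂μ =
      inner ℝ (gradL t L) (smoothCylGrad t' f x) := by
    intro x
    rw [smoothCylGrad, ← hμ.out.integral_inner_evalPts]
    simp [P, Q']
  have e2 : ∀ x, ∫ y, inner ℝ (P' 0 (x, y)) (Q 0 (x, y)) ∂μ =
      -inner ℝ (L (evalPts t x)) (smoothCyl t' f x) := by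
    intro x
    simp [P', Q, smoothCyl]
  simp only [e1, e2, integral_neg] at h0
  linarith

/-- Integration by parts in `y` with `x` frozen; the inner derivative contributes `sin θ`. -/
theorem integral_inner_evalPts_mix {n m : ℕ} (t : Fin n → I) (t' : Fin m → I)
    (L : (Fin n → EuclideanSpace ℝ (Fin d)) →L[ℝ] Ξ)
    {f : (Fin m → EuclideanSpace ℝ (Fin d)) → Ξ} (hf : BddSmooth f) (θ : ℝ)
    (x : WienerSpace d) :
    ∫ y, inner ℝ (L (evalPts t y)) (smoothCyl t' f (mix θ (x, y))) ∂μ =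
      Real.sin θ * ∫ y, inner ℝ (gradL t L) (smoothCylGrad t' f (mix θ (x, y))) ∂μ := by
  have h := integral_inner_evalPts_smoothCyl (μ := μ) t t' L
    (hf.comp_affine (Real.sin θ • ContinuousLinearMap.id ℝ _) (Real.cos θ • evalPts t' x))
  have hev : ∀ y, (Real.sin θ • ContinuousLinearMap.id ℝ _) (evalPts t' y) +
      Real.cos θ • evalPts t' x = evalPts t' (mix θ (x, y)) := by
    intro y; rw [evalPts_mix, add_comm]; rfl
  rw [← integral_const_mul]
  simp only [smoothCyl, hev] at h ⊢
  rw [h]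
  refine integral_congr_ae (Eventually.of_forall fun y => ?_)
  simp only [smoothCylGrad]
  rw [hf.fderiv_comp_affine, hev, ← real_inner_smul_right, ← map_smul]
  congr 2
  ext v
  simp

end IntegrationByParts

end Wiener

namespace Wiener

open OrnsteinUhlenbeck

/-! ### First chaos and the smoothing property. -/

section Smoothing

variable {d : ℕ} {Ξ : Type} [NormedAddCommGroup Ξ] [InnerProductSpace ℝ Ξ] [CompleteSpace Ξ]
  {μ : Measure (WienerSpace d)} [hμ : Fact (IsWienerMeasure μ)]
  {p q : ℝ≥0∞} [hpq : p.HolderConjugate q] [Fact (1 ≤ p)] [hp : Fact (p ≠ ⊤)] [hq : Fact (q ≠ ⊤)]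

theorem gradGraph_induction {P : Lp Ξ p μ × Lp (HTensor d Ξ) p μ → Prop}
    (hcl : IsClosed {z | P z}) (hs : ∀ z ∈ smoothGraph Ξ μ p, P z)
    {z : Lp Ξ p μ × Lp (HTensor d Ξ) p μ} (hz : z ∈ gradGraph Ξ μ p) : P z :=
  closure_minimal (t := {z | P z}) hs hcl hz

/-- The hypothesis says that `gradL t L` represents the part of `Φ` seen by its own Gaussian
functional. Hölder bounds the square by `‖L‖_q ‖Φ‖_p`, the moment inequality turns `‖L‖_q` into a
multiple of `‖gradL t L‖`, and one factor cancels. It serves both the smoothing estimate and the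
Riesz transform. -/
theorem enorm_gradL_le {n : ℕ} (t : Fin n → I) (L : (Fin n → EuclideanSpace ℝ (Fin d)) →L[ℝ] Ξ)
    {Φ : WienerSpace d → Ξ} (hΦ : MemLp Φ p μ)
    (h : ‖gradL t L‖ ^ 2 = ∫ y, inner ℝ (L (evalPts t y)) (Φ y) ∂μ) :
    ‖gradL t L‖ₑ ≤ momentConst q * eLpNorm Φ p μ := by
  have : q.HolderConjugate p := hpq.symm
  rcases eq_or_ne (gradL t L) 0 with h0 | h0
  · simp [h0]
  have hL : MemLp (fun y => L (evalPts t y)) q μ :=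
    L.comp_memLp' (memLp_evalPts t hq.out)
  have h1 : ‖gradL t L‖ ^ 2 ≤
      (eLpNorm (fun y => L (evalPts t y)) q μ).toReal * (eLpNorm Φ p μ).toReal := by
    rw [h]; exact (le_abs_self _).trans (abs_integral_inner_le hL hΦ)
  have h2 : ‖gradL t L‖ₑ * ‖gradL t L‖ₑ ≤
      ‖gradL t L‖ₑ * (momentConst q * eLpNorm Φ p μ) := by
    calc ‖gradL t L‖ₑ * ‖gradL t L‖ₑ = ENNReal.ofReal (‖gradL t L‖ ^ 2) := by
          rw [← ofReal_norm, ← ENNReal.ofReal_mul (norm_nonneg _), pow_two]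
      _ ≤ ENNReal.ofReal ((eLpNorm (fun y => L (evalPts t y)) q μ).toReal *
          (eLpNorm Φ p μ).toReal) := ENNReal.ofReal_le_ofReal h1
      _ = eLpNorm (fun y => L (evalPts t y)) q μ * eLpNorm Φ p μ := by
          rw [← ENNReal.toReal_mul, ENNReal.ofReal_toReal (ENNReal.mul_ne_top hL.2.ne hΦ.2.ne)]
      _ ≤ momentConst q * ‖gradL t L‖ₑ * eLpNorm Φ p μ := by
          gcongr; exact hμ.out.eLpNorm_evalPts_le t L hq.out
      _ = _ := by ring
  exact (ENNReal.mul_le_mul_iff_right (by simpa using h0) enorm_ne_top).1 h2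

theorem eLpNorm_le_of_forall_enorm_le {X Y Ξ₁ Ξ₂ : Type*} [MeasurableSpace X] [MeasurableSpace Y]
    [NormedAddCommGroup Ξ₁] [NormedAddCommGroup Ξ₂] {μ₁ : Measure X} {μ₂ : Measure Y}
    [SFinite μ₂] {r : ℝ≥0∞} (hr0 : r ≠ 0) (hr : r ≠ ⊤) {K : X → Ξ₁} {Φ : X × Y → Ξ₂}
    (hΦ : AEStronglyMeasurable Φ (μ₁.prod μ₂)) {C : ℝ≥0∞} (hC : C ≠ ⊤)
    (h : ∀ x, ‖K x‖ₑ ≤ C * eLpNorm (fun y => Φ (x, y)) r μ₂) :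
    eLpNorm K r μ₁ ≤ C * eLpNorm Φ r (μ₁.prod μ₂) := by
  have hr' := ENNReal.toReal_pos hr0 hr
  rw [eLpNorm_eq_lintegral_rpow_enorm_toReal hr0 hr, eLpNorm_eq_lintegral_rpow_enorm_toReal hr0 hr,
    lintegral_prod _ (hΦ.enorm.pow_const _)]
  have h2 : ∫⁻ x, ‖K x‖ₑ ^ r.toReal ∂μ₁ ≤
      C ^ r.toReal * ∫⁻ x, ∫⁻ y, ‖Φ (x, y)‖ₑ ^ r.toReal ∂μ₂ ∂μ₁ := by
    rw [← lintegral_const_mul' _ _ (ENNReal.rpow_ne_top_of_nonneg hr'.le hC)]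
    refine lintegral_mono fun x => ?_
    refine (ENNReal.rpow_le_rpow (h x) hr'.le).trans (le_of_eq ?_)
    rw [ENNReal.mul_rpow_of_nonneg _ _ hr'.le, eLpNorm_eq_lintegral_rpow_enorm_toReal hr0 hr,
      ← ENNReal.rpow_mul, one_div_mul_cancel hr'.ne', ENNReal.rpow_one]
  refine (ENNReal.rpow_le_rpow h2 (by positivity)).trans (le_of_eq ?_)
  rw [ENNReal.mul_rpow_of_nonneg _ _ (by positivity), ← ENNReal.rpow_mul,
    mul_one_div_cancel hr'.ne', ENNReal.rpow_one]

theorem continuous_fderiv_mix {n : ℕ} (t : Fin n → I)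
    {f : (Fin n → EuclideanSpace ℝ (Fin d)) → Ξ} (hf : BddSmooth f) (θ : ℝ)
    (x : WienerSpace d) : Continuous fun y => fderiv ℝ f (evalPts t (mix θ (x, y))) := by
  have := hf.continuous_fderiv
  have h2 := (mix (E := WienerSpace d) θ).continuous
  fun_prop

/-- An average of gradients still comes from a single linear map, namely the averaged derivative, as
`enorm_gradL_le` requires. -/
theorem mehler_smoothCylGrad {n : ℕ} (t : Fin n → I)
    {f : (Fin n → EuclideanSpace ℝ (Fin d)) → Ξ} (hf : BddSmooth f) (θ : ℝ)
    (x : WienerSpace d) :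
    mehler μ θ (smoothCylGrad t f) x =
      gradL t (∫ y, fderiv ℝ f (evalPts t (mix θ (x, y))) ∂μ) := by
  obtain ⟨B, hB⟩ := hf.bdd_fderiv
  rw [mehler, ← ContinuousLinearMap.integral_comp_comm]
  · rfl
  · exact Integrable.of_bound (continuous_fderiv_mix t hf θ x).aestronglyMeasurable B
      (Eventually.of_forall fun y => hB _)

theorem integrable_smoothCylGrad_mix {n : ℕ} (t : Fin n → I)
    {f : (Fin n → EuclideanSpace ℝ (Fin d)) → Ξ} (hf : BddSmooth f) (θ : ℝ)
    (x : WienerSpace d) : Integrable (fun y => smoothCylGrad t f (mix θ (x, y))) μ := by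
  obtain ⟨C, hC⟩ := hf.exists_norm_smoothCylGrad_le (t := t)
  refine Integrable.of_bound (hf.continuous_smoothCylGrad.comp
    ((mix θ).continuous.comp (by fun_prop))).aestronglyMeasurable C (Eventually.of_forall fun y => hC _)

theorem memLp_smoothCyl_mix {n : ℕ} (t : Fin n → I)
    {f : (Fin n → EuclideanSpace ℝ (Fin d)) → Ξ} (hf : BddSmooth f) (θ : ℝ)
    (x : WienerSpace d) (r : ℝ≥0∞) : MemLp (fun y => smoothCyl t f (mix θ (x, y))) r μ := by
  obtain ⟨C, hC⟩ := hf.bdd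
  refine MemLp.of_bound (hf.continuous_smoothCyl.comp
    ((mix θ).continuous.comp (by fun_prop))).aestronglyMeasurable C (Eventually.of_forall fun y => hC _)

/-- The smoothing property of the Ornstein–Uhlenbeck semigroup. -/
theorem norm_sin_smul_mehlerLp_le (θ : ℝ) {F : Lp Ξ p μ} {G : Lp (HTensor d Ξ) p μ}
    (h : (F, G) ∈ gradGraph Ξ μ p) :
    ‖Real.sin θ • mehlerLp μ θ G‖ ≤ (momentConst q).toReal * ‖F‖ := by
  have hcl : IsClosed {z : Lp Ξ p μ × Lp (HTensor d Ξ) p μ |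
      ‖Real.sin θ • mehlerLp μ θ z.2‖ ≤ (momentConst q).toReal * ‖z.1‖} := by
    have g1 : Continuous fun z : Lp Ξ p μ × Lp (HTensor d Ξ) p μ => Real.sin θ • mehlerLp μ θ z.2 :=
      (continuous_const_smul (Real.sin θ)).comp ((mehlerLp μ θ).continuous.comp continuous_snd)
    have g2 : Continuous fun z : Lp Ξ p μ × Lp (HTensor d Ξ) p μ =>
        (momentConst q).toReal * ‖z.1‖ := (continuous_fst.norm).const_mul _
    have g3 : Continuous fun z : Lp Ξ p μ × Lp (HTensor d Ξ) p μ =>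
        ‖Real.sin θ • mehlerLp μ θ z.2‖ := g1.norm
    exact isClosed_le g3 g2
  refine gradGraph_induction (P := fun z => ‖Real.sin θ • mehlerLp μ θ z.2‖ ≤
    (momentConst q).toReal * ‖z.1‖) (z := (F, G)) hcl ?_ h
  rintro z ⟨n, t, f, hf, h1, h2⟩
  rw [Lp.norm_def, Lp.norm_def, ← ENNReal.toReal_mul]
  refine ENNReal.toReal_mono (ENNReal.mul_ne_top (momentConst_ne_top hq.out)
    (Lp.memLp z.1).2.ne) ?_
  have hp0 : p ≠ 0 := (zero_lt_one.trans_le (Fact.out : 1 ≤ p)).ne'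
  have e1 : eLpNorm (Real.sin θ • mehlerLp μ θ z.2 : Lp (HTensor d Ξ) p μ) p μ =
      eLpNorm (fun x => Real.sin θ • mehler μ θ (smoothCylGrad t f) x) p μ := by
    refine eLpNorm_congr_ae ?_
    filter_upwards [Lp.coeFn_smul (Real.sin θ) (mehlerLp μ θ z.2), coeFn_mehlerLp θ h2] with x g1 g2
    rw [g1, Pi.smul_apply, g2]
  have e2 : eLpNorm z.1 p μ = eLpNorm (fun z => smoothCyl t f (mix θ z)) p (μ.prod μ) := by
    rw [← eLpNorm_comp_measurePreserving (Lp.aestronglyMeasurable z.1)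
      (measurePreserving_mix (μ := μ) θ)]
    exact eLpNorm_congr_ae
      ((measurePreserving_mix (μ := μ) θ).quasiMeasurePreserving.ae_eq_comp h1)
  rw [e1, e2]
  refine eLpNorm_le_of_forall_enorm_le hp0 hp.out (hf.continuous_smoothCyl.comp
    (mix θ).continuous).aestronglyMeasurable (momentConst_ne_top hq.out) fun x => ?_
  -- With `x` fixed, integration by parts in `y` identifies `sin θ` times the averaged gradient with
  -- the first chaos of `y ↦ F(cos θ x + sin θ y)`.
  set L := ∫ y, fderiv ℝ f (evalPts t (mix θ (x, y))) ∂μ with hL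
  have e3 : Real.sin θ • mehler μ θ (smoothCylGrad t f) x = gradL t (Real.sin θ • L) := by
    rw [mehler_smoothCylGrad t hf, map_smul]
  rw [e3]
  refine enorm_gradL_le t _ (memLp_smoothCyl_mix t hf θ x p) ?_
  simp only [Function.comp_apply]
  rw [integral_inner_evalPts_mix t t _ hf, integral_inner (integrable_smoothCylGrad_mix t hf θ x),
    ← real_inner_smul_right, ← real_inner_self_eq_norm_sq]
  congr 1
  exact e3.symm

end Smoothing

/-! ### The derivative of the semigroup in the angle, in weak form. -/

section WeakIdentity

variable {d : ℕ} {Ξ : Type} [NormedAddCommGroup Ξ] [InnerProductSpace ℝ Ξ] [CompleteSpace Ξ]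
  {μ : Measure (WienerSpace d)} [hμ : Fact (IsWienerMeasure μ)]
  {p q : ℝ≥0∞} [hpq : p.HolderConjugate q] [Fact (1 ≤ p)] [hp : Fact (p ≠ ⊤)]
  [Fact (1 ≤ q)] [hq : Fact (q ≠ ⊤)]

/-- Weak form of `d/dθ T_θ = -sin θ ∇* T_θ ∇`. The derivative of `F(cos θ x + sin θ y)` has the
direction `-sin θ x + cos θ y`; after a rotation by `-θ` this direction becomes the independent
variable `y`, in which integration by parts applies to `u(cos θ x - sin θ y)`. -/
theorem hasDerivAt_pairLp_mehlerLp {F : Lp Ξ p μ} {G : Lp (HTensor d Ξ) p μ}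
    (h : (F, G) ∈ smoothGraph Ξ μ p) {u : Lp Ξ q μ} {v : Lp (HTensor d Ξ) q μ}
    (hu : (u, v) ∈ smoothGraph Ξ μ q) (θ : ℝ) :
    HasDerivAt (fun θ => pairLp q (mehlerLp μ θ F) u)
      (-(Real.sin θ * pairLp q (mehlerLp μ θ G) v)) θ := by
  have : q.HolderConjugate p := hpq.symm
  obtain ⟨n, t, f, hf, hF, hG⟩ := h
  obtain ⟨m, t', g, hg, hu, hv⟩ := hu
  simp only at hF hG hu hv
  obtain ⟨A, hA⟩ := hg.bdd
  obtain ⟨A', hA'⟩ := hf.bdd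
  obtain ⟨B, hB⟩ := hf.bdd_fderiv
  have hB0 : 0 ≤ B := (norm_nonneg _).trans (hB 0)
  have hfc := hf.continuous
  have hfc' := hf.continuous_fderiv
  have hgc := hg.continuous_smoothCyl (t := t')
  let Q : ℝ → WienerSpace d × WienerSpace d → Ξ := fun θ z =>
    f (Real.cos θ • evalPts t z.1 + Real.sin θ • evalPts t z.2)
  let Q' : ℝ → WienerSpace d × WienerSpace d → Ξ := fun θ z =>
    fderiv ℝ f (Real.cos θ • evalPts t z.1 + Real.sin θ • evalPts t z.2)
      (-Real.sin θ • evalPts t z.1 + Real.cos θ • evalPts t z.2)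
  let U : WienerSpace d × WienerSpace d → Ξ := fun z => smoothCyl t' g z.1
  let X : WienerSpace d × WienerSpace d → ℝ := fun z => ‖evalPts t z.1‖ + ‖evalPts t z.2‖
  have hXi : Integrable X (μ.prod μ) :=
    (memLp_evalPts_prod t ENNReal.one_ne_top).integrable le_rfl
  have hQn' : ∀ θ z, ‖Q' θ z‖ ≤ B * X z := fun θ z =>
    ((fderiv ℝ f _).le_opNorm_of_le (norm_cos_smul_add_sin_smul_le θ _ _)).trans
      (mul_le_mul_of_nonneg_right (hB _) (by positivity))
  have hQc : ∀ θ, Continuous (Q θ) := fun θ => by fun_prop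
  have hQc' : ∀ θ, Continuous (Q' θ) := fun θ => by fun_prop
  have hUc : Continuous U := by fun_prop
  have hbd : ∀ θ z, ‖(inner ℝ (Q' θ z) (U z) : ℝ)‖ ≤ B * X z * A := fun θ z =>
    (norm_inner_le_norm _ _).trans (mul_le_mul (hQn' θ z) (hA _) (norm_nonneg _) (by positivity))
  have hderiv := hasDerivAt_integral_of_dominated_loc_of_deriv_le (μ := μ.prod μ) (𝕜 := ℝ)
    (F := fun θ z => inner ℝ (Q θ z) (U z)) (x₀ := θ) (s := Set.univ)
    (F' := fun θ z => inner ℝ (Q' θ z) (U z))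
    (bound := fun z => B * X z * A) Filter.univ_mem
    (Eventually.of_forall fun θ => ((hQc θ).inner hUc).aestronglyMeasurable)
    (Integrable.of_bound ((hQc θ).inner hUc).aestronglyMeasurable (A' * A)
      (Eventually.of_forall fun z => (norm_inner_le_norm _ _).trans (mul_le_mul (hA' _) (hA _)
        (norm_nonneg _) ((norm_nonneg _).trans (hA' 0)))))
    ((hQc' θ).inner hUc).aestronglyMeasurable
    (Eventually.of_forall fun z θ _ => hbd θ z)
    ((hXi.const_mul _).mul_const _)
    (Eventually.of_forall fun z θ _ => ?_)
  rotate_left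
  · have h2 : HasDerivAt (fun θ => Q θ z) (Q' θ z) θ :=
      (hf.differentiable _).hasFDerivAt.comp_hasDerivAt θ
        (hasDerivAt_cos_smul_add_sin_smul θ (evalPts t z.1) (evalPts t z.2))
    simpa using h2.inner ℝ (hasDerivAt_const θ (U z))
  have e0 : ∀ θ, pairLp q (mehlerLp μ θ F) u = ∫ z, inner ℝ (Q θ z) (U z) ∂(μ.prod μ) := by
    intro θ
    rw [pairLp_apply, integral_inner_mehlerLp]
    refine integral_congr_ae ?_
    filter_upwards [(measurePreserving_mix (μ := μ) θ).quasiMeasurePreserving.ae_eq_comp hF,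
      (measurePreserving_fst (μ := μ) (ν := μ)).quasiMeasurePreserving.ae_eq_comp hu] with z g1 g2
    simp only [Function.comp_apply] at g1 g2
    rw [g1, g2, smoothCyl, evalPts_mix]
  have e1 : -(Real.sin θ * pairLp q (mehlerLp μ θ G) v) =
      ∫ z, inner ℝ (Q' θ z) (U z) ∂(μ.prod μ) := by
    -- The rotation that makes the base point `x` and the direction `y` independent.
    have hrot := integral_map (μ := μ.prod μ) (φ := ContinuousLinearMap.rotation (-θ))
      (f := fun z => inner ℝ (Q' θ z) (U z)) (by fun_prop)
      ((hQc' θ).inner hUc).aestronglyMeasurable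
    rw [(measurePreserving_rotation (μ := μ) (-θ)).map_eq] at hrot
    have hint : Integrable (fun z => inner ℝ (Q' θ z) (U z)) (μ.prod μ) := hderiv.1
    have hint2 := (measurePreserving_rotation (μ := μ) (-θ)).integrable_comp_of_integrable hint
    have key : ∀ z : WienerSpace d × WienerSpace d,
        inner ℝ (Q' θ (ContinuousLinearMap.rotation (-θ) z)) (U (ContinuousLinearMap.rotation (-θ) z))
        = inner ℝ (fderiv ℝ f (evalPts t z.1) (evalPts t z.2)) (smoothCyl t' g (mix (-θ) z)) := by
      intro z
      have hcs := Real.cos_sq_add_sin_sq θ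
      have k1 : Real.cos θ • evalPts t (ContinuousLinearMap.rotation (-θ) z).1 +
          Real.sin θ • evalPts t (ContinuousLinearMap.rotation (-θ) z).2 = evalPts t z.1 := by
        simp only [ContinuousLinearMap.rotation_apply, Real.cos_neg, Real.sin_neg, map_add, map_smul,
          neg_neg]
        conv_rhs => rw [← one_smul ℝ (evalPts t z.1), ← hcs]
        module
      have k2 : -Real.sin θ • evalPts t (ContinuousLinearMap.rotation (-θ) z).1 +
          Real.cos θ • evalPts t (ContinuousLinearMap.rotation (-θ) z).2 = evalPts t z.2 := by
        simp only [ContinuousLinearMap.rotation_apply, Real.cos_neg, Real.sin_neg, map_add, map_smul,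
          neg_neg]
        conv_rhs => rw [← one_smul ℝ (evalPts t z.2), ← hcs]
        module
      simp only [Q', U, k1, k2]
      rfl
    have hint3 : Integrable (fun z : WienerSpace d × WienerSpace d =>
        inner ℝ (fderiv ℝ f (evalPts t z.1) (evalPts t z.2)) (smoothCyl t' g (mix (-θ) z)))
        (μ.prod μ) := hint2.congr (Eventually.of_forall key)
    rw [hrot, integral_congr_ae (Eventually.of_forall key), integral_prod _ hint3]
    have k3 : ∀ x, ∫ y, inner ℝ (fderiv ℝ f (evalPts t x) (evalPts t y))
        (smoothCyl t' g (mix (-θ) (x, y))) ∂μ =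
        -Real.sin θ * inner ℝ (smoothCylGrad t f x) (mehler μ (-θ) (smoothCylGrad t' g) x) := by
      intro x
      rw [integral_inner_evalPts_mix t t' _ hg, Real.sin_neg,
        integral_inner (integrable_smoothCylGrad_mix t' hg _ x)]
      rfl
    simp only [k3]
    rw [integral_const_mul, ← neg_mul]
    congr 1
    rw [pairLp_apply, integral_inner_mehlerLp_comm]
    refine integral_congr_ae ?_
    rw [← mehlerLp_neg θ v]
    filter_upwards [hG, coeFn_mehlerLp (-θ) hv] with x g1 g2
    rw [g1, g2]
  rw [e1]
  simp only [e0]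
  exact hderiv.2

end WeakIdentity

end Wiener

namespace OrnsteinUhlenbeck

/-! ### The `L^p` norm by duality. -/

section Duality

variable {X : Type*} [MeasurableSpace X] {μ : Measure X} {p q : ℝ≥0∞}
  [hpq : p.HolderConjugate q] [Fact (1 ≤ p)] [Fact (1 ≤ q)] [hp : Fact (p ≠ ⊤)] [hq : Fact (q ≠ ⊤)]
  {Ξ : Type*} [NormedAddCommGroup Ξ] [InnerProductSpace ℝ Ξ]

/-- Tested against `|F|^{p-2} F`, whose `L^q` norm is `‖F‖^{p-1}`. -/
theorem norm_le_of_forall_pairLp_le {F : Lp Ξ p μ} {C : ℝ} (hC : 0 ≤ C)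
    (h : ∀ u : Lp Ξ q μ, pairLp q F u ≤ C * ‖u‖) : ‖F‖ ≤ C := by
  have hPQ : p.toReal.HolderConjugate q.toReal := ENNReal.HolderConjugate.toReal_of_ne_top hp.out hq.out
  set P := p.toReal with hP
  have hP1 : 1 < P := hPQ.lt
  have hP0 : 0 < P := by linarith
  have hmul : q * ENNReal.ofReal (P - 1) = p := by
    rw [← ENNReal.ofReal_toReal hq.out, ← ENNReal.ofReal_mul ENNReal.toReal_nonneg,
      ← ENNReal.ofReal_toReal hp.out, mul_comm, hPQ.sub_one_mul_conj]
  set g : X → Ξ := fun x => ‖F x‖ ^ (P - 2) • F x with hg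
  have hgn : ∀ x, ‖g x‖ = ‖F x‖ ^ (P - 1) := by
    intro x
    rcases eq_or_ne (F x) 0 with h0 | h0
    · simp [hg, h0, Real.zero_rpow (by linarith : P - 1 ≠ 0)]
    · rw [hg, norm_smul, Real.norm_of_nonneg (by positivity)]
      nth_rewrite 2 [← Real.rpow_one ‖F x‖]
      rw [← Real.rpow_add (norm_pos_iff.2 h0)]
      ring_nf
  have hgm : AEStronglyMeasurable g μ :=
    ((Lp.aestronglyMeasurable F).norm.aemeasurable.pow_const _).aestronglyMeasurable.smul
      (Lp.aestronglyMeasurable F)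
  have hge : eLpNorm g q μ = eLpNorm F p μ ^ (P - 1) := by
    rw [← eLpNorm_norm, funext hgn, eLpNorm_norm_rpow _ (by linarith), hmul]
  have hgL : MemLp g q μ := ⟨hgm, by
    rw [hge]
    exact ENNReal.rpow_lt_top_of_nonneg (by linarith) (Lp.eLpNorm_ne_top F)⟩
  have h1 := h (hgL.toLp g)
  rw [Lp.norm_toLp, hge, ← ENNReal.toReal_rpow, ← Lp.norm_def, pairLp_apply] at h1
  have h2 : ∫ x, inner ℝ (F x) (hgL.toLp g x) ∂μ = ‖F‖ ^ P := by
    have e : ∫ x, inner ℝ (F x) (hgL.toLp g x) ∂μ = ∫ x, ‖F x‖ ^ P ∂μ := by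
      refine integral_congr_ae ?_
      filter_upwards [hgL.coeFn_toLp] with x hx
      rw [hx, hg, real_inner_smul_right, real_inner_self_eq_norm_sq]
      rcases eq_or_ne (F x) 0 with h0 | h0
      · simp [h0, Real.zero_rpow hP0.ne']
      · rw [← Real.rpow_natCast, ← Real.rpow_add (norm_pos_iff.2 h0)]
        norm_num
    have hp0 : p ≠ 0 := (zero_lt_one.trans_le (Fact.out : 1 ≤ p)).ne'
    have hi : 0 ≤ ∫ x, ‖F x‖ ^ P ∂μ := integral_nonneg fun x => by positivity
    rw [e, Lp.norm_def, (Lp.memLp F).eLpNorm_eq_integral_rpow_norm hp0 hp.out,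
      ENNReal.toReal_ofReal (by positivity), ← Real.rpow_mul hi, inv_mul_cancel₀ hP0.ne',
      Real.rpow_one]
  rw [h2] at h1
  rcases (norm_nonneg F).eq_or_lt with h0 | h0
  · rwa [← h0]
  · have h3 : ‖F‖ ^ P = ‖F‖ * ‖F‖ ^ (P - 1) := by
      nth_rewrite 2 [← Real.rpow_one ‖F‖]
      rw [← Real.rpow_add h0]; ring_nf
    rw [h3] at h1
    exact le_of_mul_le_mul_right h1 (by positivity)

end Duality

end OrnsteinUhlenbeck

namespace Wiener

open OrnsteinUhlenbeck

/-! ### The identity `𝓛 = ∇*∇` in weak form. -/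

section WeakIdentity

variable {d : ℕ} {Ξ : Type} [NormedAddCommGroup Ξ] [InnerProductSpace ℝ Ξ] [CompleteSpace Ξ]
  {μ : Measure (WienerSpace d)} [hμ : Fact (IsWienerMeasure μ)]
  {p q : ℝ≥0∞} [hpq : p.HolderConjugate q] [Fact (1 ≤ p)] [hp : Fact (p ≠ ⊤)]
  [Fact (1 ≤ q)] [hq : Fact (q ≠ ⊤)]

theorem norm_le_of_forall_smoothGraph {F : Lp Ξ p μ} {C : ℝ} (hC : 0 ≤ C)
    (h : ∀ z ∈ smoothGraph Ξ μ q, pairLp q F z.1 ≤ C * ‖z.1‖) : ‖F‖ ≤ C := by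
  refine norm_le_of_forall_pairLp_le (q := q) hC fun u => ?_
  have h1 : Continuous fun u => pairLp q F u := (pairLp q F).continuous
  have h2 : Continuous fun u : Lp Ξ q μ => C * ‖u‖ := continuous_norm.const_mul _
  have h3 := closure_minimal (t := {u | pairLp q F u ≤ C * ‖u‖}) ?_ (isClosed_le h1 h2)
    (mem_closure_fst_smoothGraph u)
  · exact h3
  · rintro _ ⟨z, hz, rfl⟩
    exact h z hz

/-- Against a smooth `u` with gradient `v`, the angular derivative is `-⟨G, sin θ T_θ v⟩`. Smoothing
on the dual side bounds `sin θ T_θ v` by `u`, and for the exponent `q` the constant there is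
`momentConst p`. The mean value inequality concludes. -/
theorem norm_sub_mehlerLp_le (q : ℝ≥0∞) [hpq : p.HolderConjugate q] [Fact (1 ≤ q)]
    [hq : Fact (q ≠ ⊤)] (θ : ℝ) {F : Lp Ξ p μ} {G : Lp (HTensor d Ξ) p μ}
    (h : (F, G) ∈ gradGraph Ξ μ p) :
    ‖F - mehlerLp μ θ F‖ ≤ (momentConst p).toReal * |θ| * ‖G‖ := by
  have hcl : IsClosed {z : Lp Ξ p μ × Lp (HTensor d Ξ) p μ |
      ‖z.1 - mehlerLp μ θ z.1‖ ≤ (momentConst p).toReal * |θ| * ‖z.2‖} := by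
    have g1 : Continuous fun z : Lp Ξ p μ × Lp (HTensor d Ξ) p μ => ‖z.1 - mehlerLp μ θ z.1‖ :=
      (continuous_fst.sub ((mehlerLp μ θ).continuous.comp continuous_fst)).norm
    have g2 : Continuous fun z : Lp Ξ p μ × Lp (HTensor d Ξ) p μ =>
        (momentConst p).toReal * |θ| * ‖z.2‖ := continuous_snd.norm.const_mul _
    exact isClosed_le g1 g2
  refine gradGraph_induction (P := fun z => ‖z.1 - mehlerLp μ θ z.1‖ ≤
    (momentConst p).toReal * |θ| * ‖z.2‖) (z := (F, G)) hcl ?_ h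
  rintro ⟨F, G⟩ h
  refine norm_le_of_forall_smoothGraph (q := q) (by positivity) ?_
  rintro ⟨u, v⟩ hu
  have hqp : q.HolderConjugate p := hpq.symm
  have h1 := Convex.norm_image_sub_le_of_norm_hasDerivWithin_le (s := Set.univ) (x := θ) (y := 0)
    (C := (momentConst p).toReal * ‖G‖ * ‖u‖)
    (fun θ _ => (hasDerivAt_pairLp_mehlerLp h hu θ).hasDerivWithinAt) (fun s _ => ?_) convex_univ
    (Set.mem_univ _) (Set.mem_univ _)
  · rw [mehlerLp_of_cos_eq_one Real.cos_zero, ← sub_apply, ← map_sub] at h1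
    refine (le_abs_self _).trans (h1.trans (le_of_eq ?_))
    simp only [zero_sub, norm_neg, Real.norm_eq_abs]
    ring
  · have e : -(Real.sin s * pairLp q (mehlerLp μ s G) v) =
        -pairLp q G (Real.sin s • mehlerLp μ s v) := by
      rw [map_smul, smul_eq_mul, pairLp_apply, pairLp_apply, integral_inner_mehlerLp_comm]
    rw [e, norm_neg]
    refine (abs_pairLp_le _ _).trans ?_
    have := norm_sin_smul_mehlerLp_le (q := p) s (Submodule.le_topologicalClosure _ hu)
    calc _ ≤ ‖G‖ * ((momentConst p).toReal * ‖u‖) := by gcongr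
      _ = _ := by ring

theorem hasDerivAt_ouAngle {t : ℝ} (ht : 0 < t) :
    HasDerivAt ouAngle (Real.exp (-t) / Real.sin (ouAngle t)) t := by
  have hx : Real.exp (-t) < 1 := by simpa using ht
  have h1 := (Real.hasDerivAt_arccos (by linarith [Real.exp_pos (-t)] : Real.exp (-t) ≠ -1)
    hx.ne).comp t ((hasDerivAt_neg t).exp)
  refine h1.congr_deriv ?_
  rw [ouAngle, Real.sin_arccos]
  ring

theorem sin_ouAngle_pos {t : ℝ} (ht : 0 < t) : 0 < Real.sin (ouAngle t) := by
  have hx : Real.exp (-t) < 1 := by simpa using ht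
  rw [ouAngle, Real.sin_arccos]
  exact Real.sqrt_pos.2 (by nlinarith [Real.exp_pos (-t)])

theorem pairLp_pot_one (c : ℕ) (F : Lp Ξ p μ) (u : Lp Ξ q μ) :
    IntegrableOn (fun t => Real.exp (-t) * pairLp q (ouLp μ c t F) u) (Set.Ioi 0) ∧
    pairLp q (pot μ c 1 F) u =
      ∫ t in Set.Ioi (0 : ℝ), Real.exp (-t) * pairLp q (ouLp μ c t F) u := by
  have h1 := ContinuousLinearMap.integral_comp_comm ((pairLp q (μ := μ) (p := p)).flip u)
    (integrableOn_exp_smul_ouLp c F 0)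
  have h2 := ((pairLp q (μ := μ) (p := p)).flip u).integrable_comp
    (integrableOn_exp_smul_ouLp c F 0)
  simp only [map_smul, ContinuousLinearMap.flip_apply, smul_eq_mul] at h1 h2
  exact ⟨h2, by rw [pot_one_eq, h1]⟩

/-- Weak form of `((c+1)I + ∇*∇)((c+1)I + 𝓛)^{-1} = I`: the derivative of `exp(-(c+1)t) ⟨P_t F, u⟩`
is integrated over `(0, ∞)`. The potential of `G` has index `c + 1` because of the commutation of
`∇` with `P_t`. -/
theorem pairLp_eq_of_mem_smoothGraph (c : ℕ) {F : Lp Ξ p μ} {G : Lp (HTensor d Ξ) p μ}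
    (h : (F, G) ∈ smoothGraph Ξ μ p) {u : Lp Ξ q μ} {v : Lp (HTensor d Ξ) q μ}
    (hu : (u, v) ∈ smoothGraph Ξ μ q) :
    pairLp q F u = (c + 1) * pairLp q (pot μ c 1 F) u + pairLp q (pot μ (c + 1) 1 G) v := by
  obtain ⟨i1, e1⟩ := pairLp_pot_one c F u
  obtain ⟨i2, e2⟩ := pairLp_pot_one (c + 1) G v
  have hcont : Continuous fun t => pairLp q (ouLp μ c t F) u :=
    ((pairLp q (μ := μ) (p := p) (Ξ := Ξ)).flip u).continuous.comp (continuous_ouLp c F)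
  have hder : ∀ t ∈ Set.Ioi (0 : ℝ), HasDerivAt (fun t => Real.exp (-t) * pairLp q (ouLp μ c t F) u)
      (-((c + 1) * (Real.exp (-t) * pairLp q (ouLp μ c t F) u) +
        Real.exp (-t) * pairLp q (ouLp μ (c + 1) t G) v)) t := by
    intro t (ht : 0 < t)
    have hs := (sin_ouAngle_pos ht).ne'
    have hexp : ∀ (k : ℕ) (t : ℝ), HasDerivAt (fun t => Real.exp (-t) ^ k)
        (-(k * Real.exp (-t) ^ k)) t := by
      intro k t
      have := ((hasDerivAt_neg t).const_mul (k : ℝ)).exp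
      simp only [Real.exp_nat_mul] at this
      exact this.congr_deriv (by ring)
    -- The factor `sin θ` of the angular derivative cancels the denominator of `dθ/dt = exp(-t)/sin
    -- θ`.
    have h1 := (hexp (c + 1) t).mul
      ((hasDerivAt_pairLp_mehlerLp h hu (ouAngle t)).comp t (hasDerivAt_ouAngle ht))
    have h2 := h1.congr_of_eventuallyEq (f₁ := fun t => Real.exp (-t) * pairLp q (ouLp μ c t F) u)
      (by
        filter_upwards [lt_mem_nhds ht] with s hs
        rw [ouLp_apply, cos_ouAngle hs.le, map_smul, smul_apply]
        simp only [Pi.mul_apply, Function.comp_apply, smul_eq_mul]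
        ring)
    refine h2.congr_deriv ?_
    rw [ouLp_apply, ouLp_apply, cos_ouAngle ht.le, map_smul, map_smul, smul_apply, smul_apply]
    simp only [Function.comp_apply, smul_eq_mul]
    field_simp
    push_cast
    ring
  have hlim : Tendsto (fun t => Real.exp (-t) * pairLp q (ouLp μ c t F) u) atTop (𝓝 0) := by
    refine squeeze_zero_norm (a := fun t => Real.exp (-t) * (‖F‖ * ‖u‖)) (fun t => ?_) ?_
    · rw [norm_mul, Real.norm_of_nonneg (Real.exp_pos _).le]
      gcongr
      exact (abs_pairLp_le _ _).trans (by gcongr; exact norm_ouLp_apply_le c t F)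
    · simpa using (Real.tendsto_exp_neg_atTop_nhds_zero.mul_const (‖F‖ * ‖u‖))
  have h := integral_Ioi_of_hasDerivAt_of_tendsto
    ((by fun_prop : Continuous fun t : ℝ => Real.exp (-t) * pairLp q (ouLp μ c t F) u).continuousWithinAt)
    hder ((i1.const_mul (c + 1 : ℝ)).add i2).neg hlim
  rw [integral_neg, integral_add (i1.const_mul (c + 1 : ℝ)) i2, integral_const_mul, ← e1, ← e2] at h
  simp only [ouLp_zero, neg_zero, Real.exp_zero] at h
  linarith

theorem pairLp_eq_of_mem_gradGraph (c : ℕ) {F : Lp Ξ p μ} {G : Lp (HTensor d Ξ) p μ}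
    (h : (F, G) ∈ gradGraph Ξ μ p) {u : Lp Ξ q μ} {v : Lp (HTensor d Ξ) q μ}
    (hu : (u, v) ∈ gradGraph Ξ μ q) :
    pairLp q F u = (c + 1) * pairLp q (pot μ c 1 F) u + pairLp q (pot μ (c + 1) 1 G) v := by
  have key : ∀ w ∈ smoothGraph Ξ μ q, pairLp q F w.1 =
      (c + 1) * pairLp q (pot μ c 1 F) w.1 + pairLp q (pot μ (c + 1) 1 G) w.2 := by
    intro w hw
    have g1 : Continuous fun z : Lp Ξ p μ × Lp (HTensor d Ξ) p μ => pairLp q z.1 w.1 :=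
      ((pairLp q (μ := μ) (p := p)).flip w.1).continuous.comp continuous_fst
    have g2 : Continuous fun z : Lp Ξ p μ × Lp (HTensor d Ξ) p μ => pairLp q (pot μ c 1 z.1) w.1 :=
      ((pairLp q (μ := μ) (p := p)).flip w.1).continuous.comp
        ((pot μ c 1).continuous.comp continuous_fst)
    have g3 : Continuous fun z : Lp Ξ p μ × Lp (HTensor d Ξ) p μ =>
        pairLp q (pot μ (c + 1) 1 z.2) w.2 :=
      ((pairLp q (μ := μ) (p := p)).flip w.2).continuous.comp
        ((pot μ (c + 1) 1).continuous.comp continuous_snd)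
    exact gradGraph_induction (P := fun z => pairLp q z.1 w.1 = (c + 1) *
      pairLp q (pot μ c 1 z.1) w.1 + pairLp q (pot μ (c + 1) 1 z.2) w.2) (z := (F, G))
      (isClosed_eq g1 ((g2.const_mul _).add g3))
      (fun z hz => pairLp_eq_of_mem_smoothGraph c hz hw) h
  have g1 : Continuous fun z : Lp Ξ q μ × Lp (HTensor d Ξ) q μ => pairLp q F z.1 :=
    (pairLp q F).continuous.comp continuous_fst
  have g2 : Continuous fun z : Lp Ξ q μ × Lp (HTensor d Ξ) q μ => pairLp q (pot μ c 1 F) z.1 :=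
    (pairLp q (pot μ c 1 F)).continuous.comp continuous_fst
  have g3 : Continuous fun z : Lp Ξ q μ × Lp (HTensor d Ξ) q μ =>
      pairLp q (pot μ (c + 1) 1 G) z.2 :=
    (pairLp q (pot μ (c + 1) 1 G)).continuous.comp continuous_snd
  exact gradGraph_induction (P := fun z => pairLp q F z.1 = (c + 1) *
    pairLp q (pot μ c 1 F) z.1 + pairLp q (pot μ (c + 1) 1 G) z.2) (z := (u, v))
    (isClosed_eq g1 ((g2.const_mul _).add g3)) key hu

end WeakIdentity

end Wiener

namespace OrnsteinUhlenbeck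

/-! ### The kernel of the Riesz transform in the angular variable -/

section Kernel

/-- The kernel `cos^{c+1} θ / (2 √π √(-log cos θ))` on `(0, π/2)`, extended by zero. -/
def rieszKernel (c : ℕ) (θ : ℝ) : ℝ :=
  (2 * √Real.pi)⁻¹ * if θ < Real.pi / 2 then
    Real.cos θ ^ (c + 1) * (√(-Real.log (Real.cos θ)))⁻¹ else 0

theorem measurable_rieszKernel (c : ℕ) : Measurable (rieszKernel c) := by
  unfold rieszKernel
  refine Measurable.const_mul (Measurable.ite measurableSet_Iio ?_ measurable_const) _
  fun_prop

/-- With `a = cos θ` one has `1 - a ≤ -log a ≤ (1 - a)/a` and `1 - a = 2 sin²(θ/2)`, so `1/√(-log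
a)` lies between `a` times and once `1/(√2 sin(θ/2))`. Bernoulli's inequality absorbs the powers of
`a`, at a cost that grows with `c`. -/
theorem abs_sub_cot_half_le (c : ℕ) {θ : ℝ} (h0 : 0 < θ) (h1 : θ < Real.pi / 2) :
    |Real.cos θ ^ (c + 1) * (√(-Real.log (Real.cos θ)))⁻¹ - (√2)⁻¹ * Real.cot (θ / 2)| ≤ c + 3 := by
  have hpi := Real.pi_pos
  set a := Real.cos θ with ha
  set s := Real.sin (θ / 2) with hs
  set b := Real.cos (θ / 2) with hb
  have ha0 : 0 < a := Real.cos_pos_of_mem_Ioo ⟨by linarith, h1⟩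
  have hs0 : 0 < s := Real.sin_pos_of_pos_of_lt_pi (by linarith) (by linarith)
  have hs1 : s ≤ 1 := Real.sin_le_one _
  have hb0 : 0 < b := Real.cos_pos_of_mem_Ioo ⟨by linarith, by linarith⟩
  have hb1 : b ≤ 1 := Real.cos_le_one _
  have hsb : s ^ 2 + b ^ 2 = 1 := Real.sin_sq_add_cos_sq _
  have has : 1 - a = 2 * s ^ 2 := by
    have : a = 2 * b ^ 2 - 1 := by rw [ha, hb, ← Real.cos_two_mul]; ring_nf
    linarith
  have ha1 : a < 1 := by nlinarith
  have hl1 : 1 - a ≤ -Real.log a := by linarith [Real.log_le_sub_one_of_pos ha0]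
  have hl2 : -Real.log a ≤ (1 - a) / a := by
    have := Real.log_le_sub_one_of_pos (inv_pos.2 ha0)
    rw [Real.log_inv] at this
    rw [sub_div, div_self ha0.ne', one_div]
    exact this
  have h2 : 0 < √2 := by positivity
  have hsq : √(1 - a) = √2 * s := by
    rw [has, Real.sqrt_mul (by norm_num), Real.sqrt_sq hs0.le]
  have hu : (√(-Real.log a))⁻¹ ≤ (√2 * s)⁻¹ := by
    rw [← hsq]
    exact inv_anti₀ (by rw [hsq]; positivity) (Real.sqrt_le_sqrt hl1)
  have hlo : a * (√2 * s)⁻¹ ≤ (√(-Real.log a))⁻¹ := by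
    have hpos : 0 < √(-Real.log a) := Real.sqrt_pos.2 (by linarith)
    have h3 : √(-Real.log a) ≤ (√2 * s) / a := by
      rw [← hsq]
      refine Real.sqrt_le_iff.2 ⟨by positivity, hl2.trans ?_⟩
      rw [div_pow, Real.sq_sqrt (by linarith)]
      exact div_le_div_of_nonneg_left (by linarith) (by positivity) (by nlinarith)
    calc a * (√2 * s)⁻¹ = ((√2 * s) / a)⁻¹ := by rw [inv_div, div_eq_mul_inv]
      _ ≤ _ := inv_anti₀ hpos h3
  have hpow1 : a ^ (c + 1) ≤ 1 := pow_le_one₀ ha0.le ha1.le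
  have hber : 1 - (c + 2) * (1 - a) ≤ a ^ (c + 2) := by
    have := one_add_mul_le_pow (a := a - 1) (by linarith) (c + 2)
    push_cast at this
    calc _ = 1 + ((c : ℝ) + 2) * (a - 1) := by ring
      _ ≤ _ := by rw [show 1 + (a - 1) = a by ring] at this; exact this
  have hcot : Real.cot (θ / 2) = b / s := Real.cot_eq_cos_div_sin _
  have hgap : 0 ≤ (1 - b) / s ∧ (1 - b) / s ≤ 1 := by
    refine ⟨div_nonneg (by linarith) hs0.le, (div_le_one hs0).2 ?_⟩
    nlinarith
  have h2i : (√2)⁻¹ ≤ 1 := inv_le_one_of_one_le₀ (by rw [Real.one_le_sqrt]; norm_num)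
  have h2p : 0 < (√2)⁻¹ := by positivity
  have hsplit : (√2 * s)⁻¹ = (√2)⁻¹ * (b / s) + (√2)⁻¹ * ((1 - b) / s) := by
    field_simp; ring
  have hI : 0 < (√(-Real.log a))⁻¹ := inv_pos.2 (Real.sqrt_pos.2 (by linarith))
  rw [hcot, abs_le]
  constructor
  · have h4 : (1 - (c + 2) * (1 - a)) * (√2 * s)⁻¹ ≤ a ^ (c + 1) * (√(-Real.log a))⁻¹ := by
      calc _ ≤ a ^ (c + 2) * (√2 * s)⁻¹ := by gcongr
        _ = a ^ (c + 1) * (a * (√2 * s)⁻¹) := by ring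
        _ ≤ _ := by gcongr
    have h5 : (1 - a) * (√2 * s)⁻¹ = √2 * s := by
      have : (√2) * √2 = 2 := Real.mul_self_sqrt (by norm_num)
      rw [has]; field_simp; nlinarith
    have h6 : √2 * s ≤ 1 := by
      rw [← hsq, Real.sqrt_le_one]; linarith
    have h7 : (c + 2) * ((1 - a) * (√2 * s)⁻¹) ≤ c + 2 := by
      rw [h5]; exact mul_le_of_le_one_right (by positivity) h6
    have h8 : 0 ≤ (√2)⁻¹ * ((1 - b) / s) := mul_nonneg h2p.le hgap.1
    nlinarith
  · have h4 : a ^ (c + 1) * (√(-Real.log a))⁻¹ ≤ 1 * (√2 * s)⁻¹ := by gcongr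
    have h8 : (√2)⁻¹ * ((1 - b) / s) ≤ 1 := mul_le_one₀ h2i hgap.1 hgap.2
    have : (0 : ℝ) ≤ c := by positivity
    linarith

theorem abs_rieszKernel_sub_le (c : ℕ) {θ : ℝ} (h : θ ∈ Set.Ioo 0 Real.pi) :
    |rieszKernel c θ - (2 * √Real.pi)⁻¹ * (√2)⁻¹ * Real.cot (θ / 2)| ≤
      (2 * √Real.pi)⁻¹ * (c + 3) := by
  have hb : 0 < (2 * √Real.pi)⁻¹ := by have := Real.pi_pos; positivity
  rw [rieszKernel, mul_assoc, ← mul_sub, abs_mul, abs_of_pos hb]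
  refine mul_le_mul_of_nonneg_left ?_ hb.le
  split_ifs with h1
  · exact abs_sub_cot_half_le c h.1 h1
  · have hs0 : 0 < Real.sin (θ / 2) :=
      Real.sin_pos_of_pos_of_lt_pi (by linarith [h.1]) (by linarith [h.1, h.2])
    have hb0 : 0 < Real.cos (θ / 2) :=
      Real.cos_pos_of_mem_Ioo ⟨by linarith [h.1, Real.pi_pos], by linarith [h.2]⟩
    have hle : Real.cos (θ / 2) ≤ Real.sin (θ / 2) := by
      have h3 : Real.cos θ ≤ 0 :=
        Real.cos_nonpos_of_pi_div_two_le_of_le (not_lt.1 h1) (by linarith [h.2, Real.pi_pos])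
      have h4 : Real.cos θ = 2 * Real.cos (θ / 2) ^ 2 - 1 := by
        rw [← Real.cos_two_mul]; ring_nf
      have h5 := Real.sin_sq_add_cos_sq (θ / 2)
      nlinarith
    have hc1 : Real.cot (θ / 2) ≤ 1 := by
      rw [Real.cot_eq_cos_div_sin]; exact (div_le_one hs0).2 hle
    have hc0 : 0 ≤ Real.cot (θ / 2) := by rw [Real.cot_eq_cos_div_sin]; positivity
    have h2i : (√2)⁻¹ ≤ 1 := inv_le_one_of_one_le₀ (by rw [Real.one_le_sqrt]; norm_num)
    rw [zero_sub, abs_neg, abs_of_nonneg (by positivity)]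
    have : (0 : ℝ) ≤ c := by positivity
    linarith [mul_le_one₀ h2i hc0 hc1]

/-- The only singularity is that of `cot(θ/2)` at `0`, which `sin θ` cancels; this gives absolute
convergence on smooth functions. -/
theorem exists_abs_rieszKernel_mul_sin_le (c : ℕ) :
    ∃ M : ℝ, ∀ θ ∈ Set.Ioo 0 Real.pi, |rieszKernel c θ * Real.sin θ| ≤ M := by
  set κ := (2 * √Real.pi)⁻¹ * (√2)⁻¹ with hκ
  have hκ0 : 0 ≤ κ := by positivity
  refine ⟨(2 * √Real.pi)⁻¹ * (c + 3) + κ * 2, fun θ h => ?_⟩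
  have h1 := abs_rieszKernel_sub_le c h
  have hs0 : 0 < Real.sin (θ / 2) :=
    Real.sin_pos_of_pos_of_lt_pi (by linarith [h.1]) (by linarith [h.1, h.2])
  have h2 : Real.cot (θ / 2) * Real.sin θ = 2 * Real.cos (θ / 2) ^ 2 := by
    have : Real.sin θ = 2 * Real.sin (θ / 2) * Real.cos (θ / 2) := by
      rw [← Real.sin_two_mul]; ring_nf
    rw [this, Real.cot_eq_cos_div_sin]; field_simp
  have h3 : rieszKernel c θ * Real.sin θ =
      (rieszKernel c θ - κ * Real.cot (θ / 2)) * Real.sin θ +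
        κ * (2 * Real.cos (θ / 2) ^ 2) := by rw [← h2]; ring
  rw [h3]
  refine (abs_add_le _ _).trans (add_le_add ?_ ?_)
  · rw [abs_mul]
    calc _ ≤ (2 * √Real.pi)⁻¹ * (c + 3) * 1 :=
          mul_le_mul h1 (Real.abs_sin_le_one _) (abs_nonneg _) (by positivity)
      _ = _ := mul_one _
  · rw [abs_of_nonneg (by positivity)]
    refine mul_le_mul_of_nonneg_left ?_ hκ0
    nlinarith [Real.sin_sq_add_cos_sq (θ / 2)]

theorem ouAngle_neg_log_cos {θ : ℝ} (h : θ ∈ Set.Ioo 0 (Real.pi / 2)) :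
    ouAngle (-Real.log (Real.cos θ)) = θ := by
  have ha0 : 0 < Real.cos θ :=
    Real.cos_pos_of_mem_Ioo ⟨by linarith [h.1, Real.pi_pos], h.2⟩
  rw [ouAngle, neg_neg, Real.exp_log ha0, Real.arccos_cos h.1.le (by linarith [h.2, Real.pi_pos])]

theorem image_neg_log_cos :
    (fun θ => -Real.log (Real.cos θ)) '' Set.Ioo 0 (Real.pi / 2) = Set.Ioi 0 := by
  ext s
  constructor
  · rintro ⟨θ, h, rfl⟩
    have ha0 : 0 < Real.cos θ :=
      Real.cos_pos_of_mem_Ioo ⟨by linarith [h.1, Real.pi_pos], h.2⟩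
    have ha1 : Real.cos θ < 1 := by
      have := Real.cos_lt_cos_of_nonneg_of_le_pi_div_two le_rfl h.2.le h.1
      rwa [Real.cos_zero] at this
    simpa using Real.log_neg ha0 ha1
  · intro (hs : 0 < s)
    refine ⟨ouAngle s, ⟨?_, ?_⟩, ?_⟩
    · exact Real.arccos_pos.2 (by simpa using hs)
    · exact Real.arccos_lt_pi_div_two.2 (Real.exp_pos _)
    · simp only [cos_ouAngle hs.le, Real.log_exp, neg_neg]

/-- The substitution `s = -log cos θ`, `ds = tan θ dθ`. The weight `exp(-s) = cos θ` cancels the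
denominator of the tangent, and `s^{-1/2}/√π` supplies the rest of the kernel; the factor `2`
compensates the normalisation of `rieszKernel`. -/
theorem integral_gammaHalf_zero {V : Type*} [NormedAddCommGroup V] [NormedSpace ℝ V] (c : ℕ)
    (h : ℝ → V) :
    ∫ s, Real.cos (ouAngle s) ^ (c + 1) • h (ouAngle s) ∂gammaHalf 0 =
      ∫ θ in Set.Ioo 0 Real.pi, (2 * (rieszKernel c θ * Real.sin θ)) • h θ := by
  have hpi := Real.pi_pos
  rw [gammaHalf, integral_gammaMeasure (by positivity), ← image_neg_log_cos]
  rw [integral_image_eq_integral_abs_deriv_smul (f' := fun θ => Real.sin θ / Real.cos θ)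
    measurableSet_Ioo]
  · rw [setIntegral_eq_of_subset_of_forall_sdiff_eq_zero (t := Set.Ioo 0 Real.pi)
      (s := Set.Ioo 0 (Real.pi / 2)) measurableSet_Ioo (Set.Ioo_subset_Ioo_right (by linarith))
      (fun θ hθ => ?_)]
    · refine setIntegral_congr_fun measurableSet_Ioo fun θ hθ => ?_
      have ha0 : 0 < Real.cos θ :=
        Real.cos_pos_of_mem_Ioo ⟨by linarith [hθ.1, Real.pi_pos], hθ.2⟩
      have hs0 : 0 < Real.sin θ := Real.sin_pos_of_pos_of_lt_pi hθ.1 (by linarith [hθ.2])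
      have hl : 0 < -Real.log (Real.cos θ) := by
        have : -Real.log (Real.cos θ) ∈ Set.Ioi (0 : ℝ) := by
          rw [← image_neg_log_cos]; exact ⟨θ, hθ, rfl⟩
        exact this
      simp only [ouAngle_neg_log_cos hθ]
      rw [smul_smul, smul_smul]
      congr 1
      rw [rieszKernel, if_pos hθ.2, neg_neg, Real.exp_log ha0, abs_of_pos (by positivity)]
      have e1 : ((((0 : ℕ) : ℝ) + 1) / 2 - 1) = -(1 / 2) := by norm_num
      have e2 : (((0 : ℕ) : ℝ) + 1) / 2 = 1 / 2 := by norm_num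
      rw [e1, e2, Real.Gamma_one_half_eq, Real.rpow_neg hl.le, ← Real.sqrt_eq_rpow]
      field_simp
    · have : ¬ θ < Real.pi / 2 := fun h2 => hθ.2 ⟨hθ.1.1, h2⟩
      simp [rieszKernel, this]
  · intro θ hθ
    have ha0 : 0 < Real.cos θ :=
      Real.cos_pos_of_mem_Ioo ⟨by linarith [hθ.1, Real.pi_pos], hθ.2⟩
    have := ((Real.hasDerivAt_cos θ).log ha0.ne').neg
    refine (this.congr_deriv ?_).hasDerivWithinAt
    ring
  · intro θ hθ θ' hθ' he
    rw [← ouAngle_neg_log_cos hθ, ← ouAngle_neg_log_cos hθ']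
    exact congrArg _ he

end Kernel

end OrnsteinUhlenbeck

namespace Wiener

open OrnsteinUhlenbeck

/-! ### The Riesz transform -/

section Riesz

variable {d : ℕ} {Ξ : Type} [NormedAddCommGroup Ξ] [InnerProductSpace ℝ Ξ] [CompleteSpace Ξ]

/-- The singular integral along rotations whose first Gaussian chaos in the second variable is
`∇ (c + 1 + 𝓛)^{-1/2}`. -/
def rieszDouble (c : ℕ) {n : ℕ} (t : Fin n → I) (f : (Fin n → EuclideanSpace ℝ (Fin d)) → Ξ)
    (z : WienerSpace d × WienerSpace d) : Ξ :=
  ∫ θ in Set.Ioo 0 Real.pi, rieszKernel c θ •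
    (smoothCyl t f (mix θ z) - smoothCyl t f (mix (-θ) z))

variable {n : ℕ} {t : Fin n → I} {f : (Fin n → EuclideanSpace ℝ (Fin d)) → Ξ}

/-- The two arguments differ by `2 sin θ y`, which supplies the factor needed against the singular
kernel. -/
theorem norm_smoothCyl_mix_sub_le (hf : BddSmooth f) {B : ℝ} (hB : ∀ v, ‖fderiv ℝ f v‖ ≤ B)
    (θ : ℝ) (z : WienerSpace d × WienerSpace d) :
    ‖smoothCyl t f (mix θ z) - smoothCyl t f (mix (-θ) z)‖ ≤
      |Real.sin θ| * (2 * B * ‖evalPts t z.2‖) := by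
  have h := Convex.norm_image_sub_le_of_norm_fderiv_le (s := Set.univ) (𝕜 := ℝ)
    (fun v _ => hf.differentiable v) (fun v _ => hB v) convex_univ
    (Set.mem_univ (evalPts t (mix (-θ) z))) (Set.mem_univ (evalPts t (mix θ z)))
  refine h.trans (le_of_eq ?_)
  have e : evalPts t (mix θ z) - evalPts t (mix (-θ) z) = (2 * Real.sin θ) • evalPts t z.2 := by
    rw [evalPts_mix, evalPts_mix, Real.cos_neg, Real.sin_neg]; module
  rw [e, norm_smul, norm_mul, Real.norm_eq_abs, Real.norm_eq_abs, abs_two]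
  ring

theorem continuous_smoothCyl_mix (hf : BddSmooth f) :
    Continuous fun w : (WienerSpace d × WienerSpace d) × ℝ => smoothCyl t f (mix w.2 w.1) := by
  have := hf.continuous
  simp only [smoothCyl, mix_apply]
  fun_prop

theorem stronglyMeasurable_rieszKernel_smul (c : ℕ) (hf : BddSmooth f) :
    StronglyMeasurable fun w : (WienerSpace d × WienerSpace d) × ℝ => rieszKernel c w.2 •
      (smoothCyl t f (mix w.2 w.1) - smoothCyl t f (mix (-w.2) w.1)) := by
  have h1 := continuous_smoothCyl_mix (t := t) hf
  have h2 : Continuous fun w : (WienerSpace d × WienerSpace d) × ℝ =>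
      smoothCyl t f (mix (-w.2) w.1) := by
    have := hf.continuous
    simp only [smoothCyl, mix_apply]
    fun_prop
  exact ((measurable_rieszKernel c).comp measurable_snd).stronglyMeasurable.smul
    (h1.sub h2).stronglyMeasurable

theorem stronglyMeasurable_rieszDouble (c : ℕ) (hf : BddSmooth f) :
    StronglyMeasurable (rieszDouble c t f) :=
  (stronglyMeasurable_rieszKernel_smul c hf).integral_prod_right'

theorem norm_rieszKernel_smul_le (c : ℕ) (hf : BddSmooth f) {B : ℝ} (hB : ∀ v, ‖fderiv ℝ f v‖ ≤ B)
    {M : ℝ} (hM : ∀ θ ∈ Set.Ioo 0 Real.pi, |rieszKernel c θ * Real.sin θ| ≤ M)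
    {θ : ℝ} (hθ : θ ∈ Set.Ioo 0 Real.pi) (z : WienerSpace d × WienerSpace d) :
    ‖rieszKernel c θ • (smoothCyl t f (mix θ z) - smoothCyl t f (mix (-θ) z))‖ ≤
      2 * M * B * ‖evalPts t z.2‖ := by
  have hB0 : 0 ≤ B := (norm_nonneg _).trans (hB 0)
  rw [norm_smul]
  calc _ ≤ ‖rieszKernel c θ‖ * (|Real.sin θ| * (2 * B * ‖evalPts t z.2‖)) := by
        gcongr; exact norm_smoothCyl_mix_sub_le hf hB θ z
    _ = |rieszKernel c θ * Real.sin θ| * (2 * B * ‖evalPts t z.2‖) := by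
        rw [abs_mul, Real.norm_eq_abs]; ring
    _ ≤ M * (2 * B * ‖evalPts t z.2‖) := by gcongr; exact hM θ hθ
    _ = _ := by ring

theorem exists_norm_rieszDouble_le (c : ℕ) (hf : BddSmooth f) :
    ∃ C : ℝ, ∀ z, ‖rieszDouble c t f z‖ ≤ C * ‖evalPts t z.2‖ := by
  obtain ⟨B, hB⟩ := hf.bdd_fderiv
  obtain ⟨M, hM⟩ := exists_abs_rieszKernel_mul_sin_le c
  refine ⟨2 * M * B * Real.pi, fun z => ?_⟩
  have h := norm_setIntegral_le_of_norm_le_const (μ := volume) (s := Set.Ioo 0 Real.pi)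
    (f := fun θ => rieszKernel c θ • (smoothCyl t f (mix θ z) - smoothCyl t f (mix (-θ) z)))
    (by simp) (fun θ hθ => norm_rieszKernel_smul_le c hf hB hM hθ z)
  refine h.trans (le_of_eq ?_)
  simp [Measure.real, Real.pi_pos.le]
  ring

/-- Along an orbit of the rotation group the angle is simply translated, so the integral in `θ`
becomes a singular integral on the circle. -/
theorem mix_rotation (θ s : ℝ) (z : WienerSpace d × WienerSpace d) :
    mix θ (ContinuousLinearMap.rotation s z) = mix (s + θ) z := by
  rw [mix_apply, mix_apply, ContinuousLinearMap.rotation_apply, Real.cos_add, Real.sin_add]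
  module

variable {μ : Measure (WienerSpace d)} [hμ : Fact (IsWienerMeasure μ)]

/-- Transference: for fixed `z`, the function `s ↦ F(mix s z)` is periodic and Lipschitz, and
`rieszDouble` along the orbit of `z` is its singular integral. The circle estimate is integrated
over `z`; rotation invariance makes every `s` contribute equally on both sides, and the length `2π`
cancels. -/
theorem lintegral_rieszDouble_le (c : ℕ) (hf : BddSmooth f) {r : ℝ} {C : ℝ≥0∞}
    (hC : ∀ (g : ℝ → Ξ) (K : NNReal), LipschitzWith K g → Function.Periodic g (2 * Real.pi) →
      ∫⁻ s in Set.Ioc 0 (2 * Real.pi),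
        ‖∫ θ in Set.Ioo 0 Real.pi, rieszKernel c θ • (g (s + θ) - g (s - θ))‖ₑ ^ r ≤
      C * ∫⁻ s in Set.Ioc 0 (2 * Real.pi), ‖g s‖ₑ ^ r) :
    ∫⁻ z, ‖rieszDouble c t f z‖ₑ ^ r ∂(μ.prod μ) ≤ C * ∫⁻ x, ‖smoothCyl t f x‖ₑ ^ r ∂μ := by
  have hrot : Continuous fun w : ℝ × (WienerSpace d × WienerSpace d) =>
      ContinuousLinearMap.rotation w.1 w.2 := by
    simp only [ContinuousLinearMap.rotation_apply]; fun_prop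
  have hm : StronglyMeasurable (rieszDouble c t f) := stronglyMeasurable_rieszDouble c hf
  have hm1 : Measurable fun w : ℝ × (WienerSpace d × WienerSpace d) =>
      ‖rieszDouble c t f (ContinuousLinearMap.rotation w.1 w.2)‖ₑ ^ r :=
    ((hm.comp_measurable hrot.measurable).enorm).pow_const _
  have hm2 : Measurable fun w : ℝ × (WienerSpace d × WienerSpace d) =>
      ‖smoothCyl t f (mix w.1 w.2)‖ₑ ^ r :=
    (((continuous_smoothCyl_mix hf).comp continuous_swap).stronglyMeasurable.enorm).pow_const _
  have e1 : ∀ s, ∫⁻ z, ‖rieszDouble c t f (ContinuousLinearMap.rotation s z)‖ₑ ^ r ∂(μ.prod μ) =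
      ∫⁻ z, ‖rieszDouble c t f z‖ₑ ^ r ∂(μ.prod μ) := fun s =>
    (measurePreserving_rotation (μ := μ) s).lintegral_comp (hm.enorm.pow_const _)
  have e2 : ∀ s, ∫⁻ z, ‖smoothCyl t f (mix s z)‖ₑ ^ r ∂(μ.prod μ) =
      ∫⁻ x, ‖smoothCyl t f x‖ₑ ^ r ∂μ := fun s =>
    (measurePreserving_mix (μ := μ) s).lintegral_comp
      (hf.continuous_smoothCyl.stronglyMeasurable.enorm.pow_const _)
  have key : ∀ z : WienerSpace d × WienerSpace d,
      ∫⁻ s in Set.Ioc 0 (2 * Real.pi),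
        ‖rieszDouble c t f (ContinuousLinearMap.rotation s z)‖ₑ ^ r ≤
      C * ∫⁻ s in Set.Ioc 0 (2 * Real.pi), ‖smoothCyl t f (mix s z)‖ₑ ^ r := by
    intro z
    obtain ⟨B, hB⟩ := hf.bdd_fderiv
    have hB0 : 0 ≤ B := (norm_nonneg _).trans (hB 0)
    have hlip : LipschitzWith (Real.toNNReal (B * (‖evalPts t z.1‖ + ‖evalPts t z.2‖)))
        fun s => smoothCyl t f (mix s z) := by
      refine LipschitzWith.of_dist_le_mul fun a b => ?_
      rw [dist_eq_norm, dist_eq_norm, Real.coe_toNNReal _ (by positivity)]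
      refine Convex.norm_image_sub_le_of_norm_hasDerivWithin_le (s := Set.univ)
        (f := fun s => smoothCyl t f (mix s z))
        (f' := fun s => fderiv ℝ f (Real.cos s • evalPts t z.1 + Real.sin s • evalPts t z.2)
          (-Real.sin s • evalPts t z.1 + Real.cos s • evalPts t z.2))
        (fun s _ => ?_) (fun s _ => ?_) convex_univ (Set.mem_univ _) (Set.mem_univ _)
      · simp only [smoothCyl, evalPts_mix]
        exact ((hf.differentiable _).hasFDerivAt.comp_hasDerivAt s
          (hasDerivAt_cos_smul_add_sin_smul s (evalPts t z.1) (evalPts t z.2))).hasDerivWithinAt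
      · exact ((fderiv ℝ f _).le_opNorm_of_le (norm_cos_smul_add_sin_smul_le s _ _)).trans
          (mul_le_mul_of_nonneg_right (hB _) (by positivity))
    have h := hC (fun s => smoothCyl t f (mix s z)) _ hlip (fun s => by
      simp only [smoothCyl, evalPts_mix, Real.cos_add_two_pi, Real.sin_add_two_pi])
    refine le_trans (le_of_eq ?_) h
    refine lintegral_congr fun s => ?_
    simp only [rieszDouble, mix_rotation, sub_eq_add_neg]
  have h2pi : ENNReal.ofReal (2 * Real.pi) ≠ 0 := by simpa using Real.pi_pos
  have hfin : (volume (Set.Ioc 0 (2 * Real.pi))) = ENNReal.ofReal (2 * Real.pi) := by simp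
  have hmain : (∫⁻ z, ‖rieszDouble c t f z‖ₑ ^ r ∂(μ.prod μ)) * ENNReal.ofReal (2 * Real.pi) ≤
      (C * ∫⁻ x, ‖smoothCyl t f x‖ₑ ^ r ∂μ) * ENNReal.ofReal (2 * Real.pi) := by
    calc _ = ∫⁻ s in Set.Ioc 0 (2 * Real.pi), ∫⁻ z,
          ‖rieszDouble c t f (ContinuousLinearMap.rotation s z)‖ₑ ^ r ∂(μ.prod μ) := by
          simp only [e1]
          rw [setLIntegral_const, hfin]
      _ = ∫⁻ z, (∫⁻ s in Set.Ioc 0 (2 * Real.pi),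
          ‖rieszDouble c t f (ContinuousLinearMap.rotation s z)‖ₑ ^ r) ∂(μ.prod μ) :=
          lintegral_lintegral_swap hm1.aemeasurable
      _ ≤ ∫⁻ z, (C * ∫⁻ s in Set.Ioc 0 (2 * Real.pi), ‖smoothCyl t f (mix s z)‖ₑ ^ r) ∂(μ.prod μ) :=
          lintegral_mono key
      _ = C * ∫⁻ z, (∫⁻ s in Set.Ioc 0 (2 * Real.pi), ‖smoothCyl t f (mix s z)‖ₑ ^ r) ∂(μ.prod μ) := by
          refine lintegral_const_mul _ ?_
          exact (hm2.comp measurable_swap).lintegral_prod_right'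
      _ = C * ∫⁻ s in Set.Ioc 0 (2 * Real.pi), ∫⁻ z, ‖smoothCyl t f (mix s z)‖ₑ ^ r ∂(μ.prod μ) := by
          rw [lintegral_lintegral_swap]
          exact (hm2.comp measurable_swap).aemeasurable
      _ = _ := by
          simp only [e2]
          rw [setLIntegral_const, hfin, mul_assoc]
  exact (ENNReal.mul_le_mul_iff_left h2pi ENNReal.ofReal_ne_top).1 hmain

theorem mehler_neg {E Ξ' : Type*} [NormedAddCommGroup E] [NormedSpace ℝ E] [MeasurableSpace E]
    [BorelSpace E] [SecondCountableTopology E] {μ : Measure E} [IsRotationInvariant μ]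
    [NormedAddCommGroup Ξ'] [NormedSpace ℝ Ξ'] (θ : ℝ) (g : E → Ξ') (x : E) :
    mehler μ (-θ) g x = mehler μ θ g x := by
  rw [mehler, mehler, ← (measurePreserving_neg (μ := μ)).integral_comp
    (MeasurableEquiv.neg E).measurableEmbedding (fun y => g (mix θ (x, y)))]
  simp [mix_apply]

/-- The integration by parts factor `sin θ` is odd while the averaged gradient is even in `θ`, so
the antisymmetric difference doubles the term. -/
theorem integral_inner_evalPts_sub (hf : BddSmooth f)
    (L : (Fin n → EuclideanSpace ℝ (Fin d)) →L[ℝ] Ξ) (θ : ℝ) (x : WienerSpace d) :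
    ∫ y, inner ℝ (L (evalPts t y))
        (smoothCyl t f (mix θ (x, y)) - smoothCyl t f (mix (-θ) (x, y))) ∂μ =
      2 * Real.sin θ * inner ℝ (gradL t L) (mehler μ θ (smoothCylGrad t f) x) := by
  have hL : MemLp (fun y => L (evalPts t y)) 2 μ :=
    L.comp_memLp' (memLp_evalPts t ENNReal.ofNat_ne_top)
  have hi : ∀ θ, Integrable (fun y => inner ℝ (L (evalPts t y)) (smoothCyl t f (mix θ (x, y)))) μ :=
    fun θ => hL.integrable_inner' (memLp_smoothCyl_mix t hf θ x 2)
  have h : ∀ θ, ∫ y, inner ℝ (L (evalPts t y)) (smoothCyl t f (mix θ (x, y))) ∂μ =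
      Real.sin θ * inner ℝ (gradL t L) (mehler μ θ (smoothCylGrad t f) x) := fun θ => by
    rw [integral_inner_evalPts_mix t t L hf, integral_inner (integrable_smoothCylGrad_mix t hf θ x)]
    rfl
  simp only [inner_sub_right]
  rw [integral_sub (hi _) (hi _), h, h, mehler_neg, Real.sin_neg]
  ring

/-- The gradient of the potential, as the first chaos of the singular integral. -/
theorem exists_gradL_eq (c : ℕ) (hf : BddSmooth f) (x : WienerSpace d) :
    ∃ L : (Fin n → EuclideanSpace ℝ (Fin d)) →L[ℝ] Ξ,
      ∫ s, Real.cos (ouAngle s) ^ (c + 1) • mehler μ (ouAngle s) (smoothCylGrad t f) x ∂gammaHalf 0 =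
        gradL t L ∧
      ‖gradL t L‖ ^ 2 = ∫ y, inner ℝ (L (evalPts t y)) (rieszDouble c t f (x, y)) ∂μ := by
  obtain ⟨B, hB⟩ := hf.bdd_fderiv
  have hB0 : 0 ≤ B := (norm_nonneg _).trans (hB 0)
  obtain ⟨M, hM⟩ := exists_abs_rieszKernel_mul_sin_le c
  have hM0 : 0 ≤ M := (abs_nonneg _).trans
    (hM (Real.pi / 2) ⟨by linarith [Real.pi_pos], by linarith [Real.pi_pos]⟩)
  have hDc : Continuous fun w : WienerSpace d => fderiv ℝ f (evalPts t w) :=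
    hf.continuous_fderiv.comp (evalPts t).continuous
  have hDint : Integrable (fun s => Real.cos (ouAngle s) ^ (c + 1) •
      mehler μ (ouAngle s) (fun w => fderiv ℝ f (evalPts t w)) x) (gammaHalf 0) := by
    have hm : StronglyMeasurable fun s => mehler μ (ouAngle s) (fun w => fderiv ℝ f (evalPts t w)) x :=
      (stronglyMeasurable_mehler (μ := μ) hDc.stronglyMeasurable).comp_measurable
        (f := fun z : ℝ × WienerSpace d => mehler μ (ouAngle z.1) (fun w => fderiv ℝ f (evalPts t w)) z.2)
        (g := fun s => (s, x)) (by fun_prop)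
    have hcc := continuous_ouAngle
    have hm2 : StronglyMeasurable fun s => Real.cos (ouAngle s) ^ (c + 1) :=
      Continuous.stronglyMeasurable (by fun_prop)
    refine Integrable.of_bound (hm2.smul hm).aestronglyMeasurable B (Eventually.of_forall fun s => ?_)
    rw [norm_smul]
    have h1 : ‖mehler μ (ouAngle s) (fun w => fderiv ℝ f (evalPts t w)) x‖ ≤ B := by
      have := norm_integral_le_of_norm_le_const (μ := μ) (C := B)
        (f := fun y => fderiv ℝ f (evalPts t (mix (ouAngle s) (x, y))))
        (Eventually.of_forall fun y => hB _)
      rw [mehler]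
      simpa using this
    calc _ ≤ 1 * B := mul_le_mul (abs_cos_ouAngle_pow_le s _) h1 (norm_nonneg _) zero_le_one
      _ = B := one_mul B
  -- The gamma integral is taken at the level of linear maps, so that the potential of the gradient
  -- has the form `gradL t L`.
  set L := ∫ s, Real.cos (ouAngle s) ^ (c + 1) •
      mehler μ (ouAngle s) (fun w => fderiv ℝ f (evalPts t w)) x ∂gammaHalf 0 with hL
  have e1 : ∫ s, Real.cos (ouAngle s) ^ (c + 1) •
      mehler μ (ouAngle s) (smoothCylGrad t f) x ∂gammaHalf 0 = gradL t L := by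
    rw [hL, ← ContinuousLinearMap.integral_comp_comm _ hDint]
    refine integral_congr_ae (Eventually.of_forall fun s => ?_)
    simp only [map_smul]
    rw [mehler_smoothCylGrad t hf]
    rfl
  refine ⟨L, e1, ?_⟩
  have hgint : Integrable (fun s => Real.cos (ouAngle s) ^ (c + 1) •
      mehler μ (ouAngle s) (smoothCylGrad t f) x) (gammaHalf 0) := by
    refine ((gradL t).integrable_comp hDint).congr (Eventually.of_forall fun s => ?_)
    simp only [map_smul]
    rw [mehler_smoothCylGrad t hf]
    rfl
  -- One copy of `gradL t L` is expanded as the gamma integral, rewritten in the angle; integration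
  -- by parts then replaces the averaged gradient by the antisymmetric difference. Fubini below
  -- restores `rieszDouble`.
  have e2 : ‖gradL t L‖ ^ 2 = ∫ θ in Set.Ioo 0 Real.pi, ∫ y,
      inner ℝ (L (evalPts t y)) (rieszKernel c θ •
        (smoothCyl t f (mix θ (x, y)) - smoothCyl t f (mix (-θ) (x, y)))) ∂μ := by
    rw [← real_inner_self_eq_norm_sq]
    nth_rewrite 2 [← e1]
    rw [← integral_inner hgint]
    simp only [real_inner_smul_right]
    have := integral_gammaHalf_zero c
      (fun θ => (inner ℝ (gradL t L) (mehler μ θ (smoothCylGrad t f) x) : ℝ))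
    simp only [smul_eq_mul] at this
    rw [this]
    refine setIntegral_congr_fun measurableSet_Ioo fun θ _ => ?_
    simp only [integral_const_mul]
    rw [integral_inner_evalPts_sub hf]
    ring
  have hYi : Integrable (fun y => ‖evalPts (d := d) t y‖ ^ 2) μ :=
    (memLp_evalPts t ENNReal.ofNat_ne_top).integrable_norm_pow (p := 2) (by norm_num)
  rw [e2, integral_integral_swap]
  · refine integral_congr_ae (Eventually.of_forall fun y => ?_)
    refine integral_inner (f := fun θ => rieszKernel c θ •
        (smoothCyl t f (mix θ (x, y)) - smoothCyl t f (mix (-θ) (x, y)))) ?_ _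
    refine Integrable.of_bound (((stronglyMeasurable_rieszKernel_smul c hf).comp_measurable
      (g := fun θ => ((x, y), θ)) (by fun_prop)).aestronglyMeasurable)
      (2 * M * B * ‖evalPts t y‖) ?_
    filter_upwards [ae_restrict_mem measurableSet_Ioo] with θ hθ
    exact norm_rieszKernel_smul_le c hf hB hM hθ (x, y)
  · have hmeas : StronglyMeasurable (Function.uncurry fun (θ : ℝ) (y : WienerSpace d) =>
        inner ℝ (L (evalPts t y)) (rieszKernel c θ •
          (smoothCyl t f (mix θ (x, y)) - smoothCyl t f (mix (-θ) (x, y))))) := by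
      refine StronglyMeasurable.inner ?_ ((stronglyMeasurable_rieszKernel_smul c hf).comp_measurable
        (g := fun w : ℝ × WienerSpace d => ((x, w.2), w.1)) (by fun_prop))
      exact Continuous.stronglyMeasurable (by fun_prop)
    refine Integrable.mono' (g := fun w : ℝ × WienerSpace d =>
      (fun _ => ‖L‖ * (2 * M * B)) w.1 * (fun y => ‖evalPts t y‖ ^ 2) w.2)
      (Integrable.mul_prod (integrable_const _) hYi) hmeas.aestronglyMeasurable ?_
    have hae : ∀ᵐ w : ℝ × WienerSpace d ∂((volume.restrict (Set.Ioo 0 Real.pi)).prod μ),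
        w.1 ∈ Set.Ioo 0 Real.pi :=
      Measure.quasiMeasurePreserving_fst.ae (ae_restrict_mem measurableSet_Ioo)
    filter_upwards [hae] with w hw
    refine (norm_inner_le_norm _ _).trans ((mul_le_mul (L.le_opNorm _)
      (norm_rieszKernel_smul_le c hf hB hM hw (x, w.2)) (norm_nonneg _) (by positivity)).trans
      (le_of_eq ?_))
    ring

end Riesz

section RieszBound

/-- Boundedness of the Riesz transforms, with a dimension-free constant. -/
theorem exists_norm_pot_grad_le (p q : ℝ≥0∞) [hpq : p.HolderConjugate q] [Fact (1 ≤ p)]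
    [hp : Fact (p ≠ ⊤)] [hq : Fact (q ≠ ⊤)] (c : ℕ) : ∃ C : ℝ, 0 ≤ C ∧
    ∀ (d : ℕ) (Ξ : Type) [NormedAddCommGroup Ξ] [InnerProductSpace ℝ Ξ] [CompleteSpace Ξ]
      (μ : Measure (WienerSpace d)) [Fact (IsWienerMeasure μ)]
      (F : Lp Ξ p μ) (G : Lp (HTensor d Ξ) p μ), (F, G) ∈ gradGraph Ξ μ p →
      ‖pot μ (c + 1) 0 G‖ ≤ C * ‖F‖ := by
  have hPQ : p.toReal.HolderConjugate q.toReal :=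
    ENNReal.HolderConjugate.toReal_of_ne_top hp.out hq.out
  -- The two parameters are the coefficient of the cotangent and the bound for the remainder, both
  -- from `abs_rieszKernel_sub_le`.
  obtain ⟨C, hC⟩ := ConjugateFunction.exists_lintegral_singularIntegral_le hPQ.lt
    ((2 * √Real.pi)⁻¹ * (√2)⁻¹) ((2 * √Real.pi)⁻¹ * (c + 3))
  refine ⟨(momentConst q * (C : ℝ≥0∞) ^ (1 / p.toReal)).toReal, ENNReal.toReal_nonneg, ?_⟩
  intro d Ξ _ _ _ μ hμ F G h
  have hp0 : p ≠ 0 := (zero_lt_one.trans_le (Fact.out : 1 ≤ p)).ne'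
  have hfin : momentConst q * (C : ℝ≥0∞) ^ (1 / p.toReal) ≠ ⊤ :=
    ENNReal.mul_ne_top (momentConst_ne_top hq.out)
      (ENNReal.rpow_ne_top_of_nonneg (by positivity) ENNReal.coe_ne_top)
  set A := (momentConst q * (C : ℝ≥0∞) ^ (1 / p.toReal)).toReal with hA
  have g1 : Continuous fun z : Lp Ξ p μ × Lp (HTensor d Ξ) p μ => ‖pot μ (c + 1) 0 z.2‖ :=
    ((pot μ (c + 1) 0).continuous.comp continuous_snd).norm
  have g2 : Continuous fun z : Lp Ξ p μ × Lp (HTensor d Ξ) p μ => A * ‖z.1‖ :=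
    continuous_fst.norm.const_mul _
  refine gradGraph_induction (P := fun z => ‖pot μ (c + 1) 0 z.2‖ ≤ A * ‖z.1‖) (z := (F, G))
    (isClosed_le g1 g2) ?_ h
  rintro z ⟨n, t, f, hf, h1, h2⟩
  rw [Lp.norm_def, Lp.norm_def, hA, ← ENNReal.toReal_mul]
  refine ENNReal.toReal_mono (ENNReal.mul_ne_top hfin (Lp.memLp z.1).2.ne) ?_
  have hpot := coeFn_pot (μ := μ) (c + 1) 0 hf.continuous_smoothCylGrad.stronglyMeasurable h2
  rw [eLpNorm_congr_ae hpot, eLpNorm_congr_ae h1]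
  refine (eLpNorm_le_of_forall_enorm_le (μ₂ := μ) (Φ := rieszDouble c t f) hp0 hp.out
    (stronglyMeasurable_rieszDouble c hf).aestronglyMeasurable (momentConst_ne_top hq.out)
    fun x => ?_).trans ?_
  · obtain ⟨L, e1, e2⟩ := exists_gradL_eq (μ := μ) (t := t) c hf x
    rw [e1]
    obtain ⟨D, hD⟩ := exists_norm_rieszDouble_le (t := t) c hf
    refine enorm_gradL_le t L ?_ e2
    refine (memLp_evalPts t hp.out).of_le_mul (c := D)
      ((stronglyMeasurable_rieszDouble c hf).comp_measurable
        (g := fun y => (x, y)) (by fun_prop)).aestronglyMeasurable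
      (Eventually.of_forall fun y => hD (x, y))
  · rw [mul_assoc]
    refine mul_le_mul_right ?_ _
    have h3 := lintegral_rieszDouble_le (μ := μ) (t := t) c hf (r := p.toReal) (C := C)
      (fun g K hg hg' => hC Ξ (rieszKernel c) (measurable_rieszKernel c)
        (fun θ hθ => abs_rieszKernel_sub_le c hθ) g K hg hg')
    rw [eLpNorm_eq_lintegral_rpow_enorm_toReal hp0 hp.out,
      eLpNorm_eq_lintegral_rpow_enorm_toReal hp0 hp.out,
      ← ENNReal.mul_rpow_of_nonneg _ _ (by positivity)]
    exact ENNReal.rpow_le_rpow h3 (by positivity)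

end RieszBound

end Wiener

/-! ### Closed graphs of bounded, densely defined operators. -/

section ClosedGraph

variable {V W : Type*} [NormedAddCommGroup V] [NormedSpace ℝ V] [CompleteSpace V]
  [NormedAddCommGroup W] [NormedSpace ℝ W] [CompleteSpace W] {C : ℝ}

theorem Submodule.norm_snd_le_of_mem_topologicalClosure {S : Submodule ℝ (V × W)}
    (hS : ∀ z ∈ S, ‖z.2‖ ≤ C * ‖z.1‖) {z : V × W} (hz : z ∈ S.topologicalClosure) :
    ‖z.2‖ ≤ C * ‖z.1‖ :=
  closure_minimal (t := {z : V × W | ‖z.2‖ ≤ C * ‖z.1‖}) hS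
    (isClosed_le continuous_snd.norm (continuous_fst.norm.const_mul C)) hz

/-- The bound makes the first projection antilipschitz on the closed graph, so its range is closed.
-/
theorem Submodule.exists_mem_topologicalClosure_of_mem_closure {S : Submodule ℝ (V × W)}
    (hS : ∀ z ∈ S, ‖z.2‖ ≤ C * ‖z.1‖) {x : V}
    (hx : x ∈ closure (Prod.fst '' (S : Set (V × W)))) :
    ∃ y, (x, y) ∈ S.topologicalClosure ∧ ‖y‖ ≤ C * ‖x‖ := by
  suffices h : ∃ y, (x, y) ∈ S.topologicalClosure by
    obtain ⟨y, hy⟩ := h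
    exact ⟨y, hy, norm_snd_le_of_mem_topologicalClosure hS hy⟩
  let g : S.topologicalClosure → V := fun z => z.1.1
  have hanti : AntilipschitzWith (Real.toNNReal (max 1 C)) g := by
    refine AntilipschitzWith.of_le_mul_dist fun a b => ?_
    have h1 := norm_snd_le_of_mem_topologicalClosure hS (a - b).2
    rw [Subtype.dist_eq, dist_eq_norm, dist_eq_norm, Real.coe_toNNReal _ (by positivity),
      Prod.norm_def]
    refine max_le ?_ ?_
    · exact le_mul_of_one_le_left (norm_nonneg _) (le_max_left _ _)
    · exact h1.trans (mul_le_mul_of_nonneg_right (le_max_right _ _) (norm_nonneg _))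
  have hcl : IsClosed (Set.range g) :=
    hanti.isClosed_range (uniformContinuous_fst.comp uniformContinuous_subtype_val)
  have hsub : Prod.fst '' (S : Set (V × W)) ⊆ Set.range g := by
    rintro _ ⟨z, hz, rfl⟩
    exact ⟨⟨z, S.le_topologicalClosure hz⟩, rfl⟩
  obtain ⟨z, rfl⟩ := closure_minimal hsub hcl hx
  exact ⟨z.1.2, z.2⟩

theorem Submodule.exists_clm_mem_topologicalClosure {S : Submodule ℝ (V × W)} (hC : 0 ≤ C)
    (hS : ∀ z ∈ S, ‖z.2‖ ≤ C * ‖z.1‖) (hd : ∀ x, x ∈ closure (Prod.fst '' (S : Set (V × W)))) :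
    ∃ T : V →L[ℝ] W, ‖T‖ ≤ C ∧ ∀ x, (x, T x) ∈ S.topologicalClosure := by
  choose T hT hTn using fun x => exists_mem_topologicalClosure_of_mem_closure hS (hd x)
  have huniq : ∀ {x y y'}, (x, y) ∈ S.topologicalClosure → (x, y') ∈ S.topologicalClosure →
      y = y' := by
    intro x y y' h h'
    have h1 := norm_snd_le_of_mem_topologicalClosure hS (S.topologicalClosure.sub_mem h h')
    simp only [Prod.mk_sub_mk, sub_self, norm_zero, mul_zero, norm_le_zero_iff] at h1
    exact sub_eq_zero.1 h1
  let T' : V →ₗ[ℝ] W :=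
    { toFun := T
      map_add' := fun x y => huniq (hT _) (S.topologicalClosure.add_mem (hT x) (hT y))
      map_smul' := fun a x => huniq (hT _) (S.topologicalClosure.smul_mem a (hT x)) }
  exact ⟨T'.mkContinuous C hTn, LinearMap.mkContinuous_norm_le _ hC _, hT⟩

end ClosedGraph

namespace Wiener

open OrnsteinUhlenbeck

/-! ### Closability, regularisation and interpolation for the gradient. -/

section Domain

variable {d : ℕ} {Ξ : Type} [NormedAddCommGroup Ξ] [InnerProductSpace ℝ Ξ] [CompleteSpace Ξ]
  {μ : Measure (WienerSpace d)} [hμ : Fact (IsWienerMeasure μ)]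
  {p : ℝ≥0∞} [Fact (1 ≤ p)] [hp : Fact (p ≠ ⊤)]

/-- Closability follows from smoothing: a gradient `D` of the zero function satisfies `sin θ T_θ D =
0`, and `T_θ D → D` as `θ → 0`. -/
theorem eq_of_mem_gradGraph (q : ℝ≥0∞) [hpq : p.HolderConjugate q] [hq : Fact (q ≠ ⊤)]
    {F : Lp Ξ p μ} {G G' : Lp (HTensor d Ξ) p μ}
    (h : (F, G) ∈ gradGraph Ξ μ p) (h' : (F, G') ∈ gradGraph Ξ μ p) : G = G' := by
  have h0 : ((0 : Lp Ξ p μ), G - G') ∈ gradGraph Ξ μ p := by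
    have := (gradGraph Ξ μ p).sub_mem h h'
    rwa [Prod.mk_sub_mk, sub_self] at this
  set D := G - G' with hD
  have h1 : Tendsto (fun θ => mehlerLp μ θ D) (𝓝[>] 0) (𝓝 D) := by
    have := ((continuous_mehlerLp D).tendsto 0).mono_left (nhdsWithin_le_nhds (s := Set.Ioi 0))
    rwa [mehlerLp_of_cos_eq_one Real.cos_zero] at this
  have h2 : Tendsto (fun θ => mehlerLp μ θ D) (𝓝[>] 0) (𝓝 0) := by
    refine tendsto_const_nhds.congr' ?_
    filter_upwards [Ioo_mem_nhdsGT Real.pi_pos] with θ hθ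
    have h3 := norm_sin_smul_mehlerLp_le (q := q) θ h0
    rw [norm_zero, mul_zero, norm_le_zero_iff, smul_eq_zero] at h3
    exact (h3.resolve_left (Real.sin_pos_of_mem_Ioo hθ).ne').symm
  exact sub_eq_zero.1 (tendsto_nhds_unique h1 h2)

/-- Here `A'` is what `A` induces on gradients. If `A'` of the gradient is controlled by the
function alone, it extends by density to all of `L^p`, and closedness of the graph shows that the
extension is the gradient of `A F`. -/
theorem exists_clm_gradGraph {A : Lp Ξ p μ →L[ℝ] Lp Ξ p μ}
    {A' : Lp (HTensor d Ξ) p μ →L[ℝ] Lp (HTensor d Ξ) p μ} {C : ℝ} (hC : 0 ≤ C)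
    (hA : ∀ z ∈ gradGraph Ξ μ p, (A z.1, A' z.2) ∈ gradGraph Ξ μ p)
    (hA' : ∀ z ∈ gradGraph Ξ μ p, ‖A' z.2‖ ≤ C * ‖z.1‖) :
    ∃ T : Lp Ξ p μ →L[ℝ] Lp (HTensor d Ξ) p μ, ‖T‖ ≤ C ∧
      ∀ F, (A F, T F) ∈ gradGraph Ξ μ p := by
  let J : (Lp Ξ p μ × Lp (HTensor d Ξ) p μ) →L[ℝ] (Lp Ξ p μ × Lp (HTensor d Ξ) p μ) :=
    (ContinuousLinearMap.id ℝ (Lp Ξ p μ)).prodMap A'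
  let S : Submodule ℝ (Lp Ξ p μ × Lp (HTensor d Ξ) p μ) := (gradGraph Ξ μ p).map J.toLinearMap
  have hS : ∀ z ∈ S, ‖z.2‖ ≤ C * ‖z.1‖ := by
    rintro _ ⟨z, hz, rfl⟩
    exact hA' z hz
  have hd : ∀ x, x ∈ closure (Prod.fst '' (S : Set (Lp Ξ p μ × Lp (HTensor d Ξ) p μ))) := by
    intro x
    refine closure_mono ?_ (mem_closure_fst_smoothGraph x)
    rintro _ ⟨z, hz, rfl⟩
    exact ⟨J z, ⟨z, Submodule.le_topologicalClosure _ hz, rfl⟩, rfl⟩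
  obtain ⟨T, hT, hTm⟩ := Submodule.exists_clm_mem_topologicalClosure hC hS hd
  refine ⟨T, hT, fun F => ?_⟩
  have hc : Continuous fun z : Lp Ξ p μ × Lp (HTensor d Ξ) p μ => (A z.1, z.2) :=
    (A.continuous.comp continuous_fst).prodMk continuous_snd
  have hcl := isClosed_gradGraph.preimage hc
  have hsub : (S : Set (Lp Ξ p μ × Lp (HTensor d Ξ) p μ)) ⊆
      (fun z : Lp Ξ p μ × Lp (HTensor d Ξ) p μ => (A z.1, z.2)) ⁻¹' (gradGraph Ξ μ p) := by
    rintro _ ⟨z, hz, rfl⟩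
    exact hA z hz
  exact closure_minimal hsub hcl (hTm F)

theorem norm_ouLp_grad_le (q : ℝ≥0∞) [hpq : p.HolderConjugate q] [hq : Fact (q ≠ ⊤)]
    (c : ℕ) {s : ℝ} (hs : 0 < s) {F : Lp Ξ p μ} {G : Lp (HTensor d Ξ) p μ}
    (h : (F, G) ∈ gradGraph Ξ μ p) :
    ‖ouLp μ c s G‖ ≤ (momentConst q).toReal / Real.sin (ouAngle s) * ‖F‖ := by
  have hsin := sin_ouAngle_pos hs
  have h1 := norm_sin_smul_mehlerLp_le (q := q) (ouAngle s) h
  rw [norm_smul, Real.norm_of_nonneg hsin.le] at h1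
  have h2 : ‖ouLp μ c s G‖ ≤ ‖mehlerLp μ (ouAngle s) G‖ := by
    rw [ouLp_apply, norm_smul]
    exact mul_le_of_le_one_left (norm_nonneg _) (abs_cos_ouAngle_pow_le s _)
  refine h2.trans ?_
  rw [div_mul_eq_mul_div, le_div_iff₀ hsin, mul_comm]
  exact h1

theorem exists_ouLp_mem_gradGraph (q : ℝ≥0∞) [hpq : p.HolderConjugate q] [hq : Fact (q ≠ ⊤)]
    (c : ℕ) {s : ℝ} (hs : 0 < s) (F : Lp Ξ p μ) :
    ∃ G : Lp (HTensor d Ξ) p μ, (ouLp μ c s F, G) ∈ gradGraph Ξ μ p := by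
  have hC : 0 ≤ (momentConst q).toReal / Real.sin (ouAngle s) :=
    div_nonneg ENNReal.toReal_nonneg (sin_ouAngle_pos hs).le
  have h1 : ∀ z ∈ gradGraph Ξ μ p, (ouLp μ c s z.1, ouLp μ (c + 1) s z.2) ∈ gradGraph Ξ μ p := by
    rintro ⟨F, G⟩ hz
    exact ouLp_mem_gradGraph c s hz
  have h2 : ∀ z ∈ gradGraph Ξ μ p, ‖ouLp μ (c + 1) s z.2‖ ≤
      (momentConst q).toReal / Real.sin (ouAngle s) * ‖z.1‖ := by
    rintro ⟨F, G⟩ hz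
    exact norm_ouLp_grad_le q (c + 1) hs hz
  obtain ⟨T, -, hT⟩ := exists_clm_gradGraph hC h1 h2
  exact ⟨T F, hT F⟩

/-- For `s > 0` the smoothed `F` has some gradient `D`. After applying the potential, `D` and the
smoothed `G` are gradients of the same function, so injectivity of the potential identifies them;
then `s → 0`. -/
theorem mem_gradGraph_of_pot (q : ℝ≥0∞) [hpq : p.HolderConjugate q] [hq : Fact (q ≠ ⊤)]
    (c : ℕ) {F : Lp Ξ p μ} {G : Lp (HTensor d Ξ) p μ}
    (h : (pot μ c 0 F, pot μ (c + 1) 0 G) ∈ gradGraph Ξ μ p) : (F, G) ∈ gradGraph Ξ μ p := by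
  have key : ∀ s : ℝ, 0 < s → (ouLp μ c s F, ouLp μ (c + 1) s G) ∈ gradGraph Ξ μ p := by
    intro s hs
    obtain ⟨D, hD⟩ := exists_ouLp_mem_gradGraph q c hs F
    have h1 := pot_mem_gradGraph c 0 hD
    have h2 := ouLp_mem_gradGraph c s h
    rw [pot_ouLp c 0 hs.le] at h1
    have h3 := eq_of_mem_gradGraph q h1 h2
    rw [← pot_ouLp (c + 1) 0 hs.le] at h3
    rwa [pot_zero_injective (c + 1) h3] at hD
  have hlim : Tendsto (fun s => (ouLp μ c s F, ouLp μ (c + 1) s G)) (𝓝[>] 0) (𝓝 (F, G)) := by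
    have h1 := (continuous_ouLp (μ := μ) c F).tendsto 0
    have h2 := (continuous_ouLp (μ := μ) (c + 1) G).tendsto 0
    rw [ouLp_zero] at h1 h2
    exact (h1.prodMk_nhds h2).mono_left nhdsWithin_le_nhds
  exact isClosed_gradGraph.mem_of_tendsto hlim
    (by filter_upwards [self_mem_nhdsWithin] with s hs using key s hs)

/-- `G = (G - T_θ G) + T_θ G`: the first part is small with `θ` through the second derivative, the
second is controlled by `F` through smoothing. -/
theorem norm_grad_le (q : ℝ≥0∞) [hpq : p.HolderConjugate q] [Fact (1 ≤ q)] [hq : Fact (q ≠ ⊤)]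
    {F : Lp Ξ p μ} {G : Lp (HTensor d Ξ) p μ} {K : Lp (HTensor d (HTensor d Ξ)) p μ}
    (h : (F, G) ∈ gradGraph Ξ μ p) (h' : (G, K) ∈ gradGraph (HTensor d Ξ) μ p) {θ : ℝ}
    (hθ : θ ∈ Set.Ioo 0 Real.pi) :
    ‖G‖ ≤ (momentConst p).toReal * θ * ‖K‖ + (momentConst q).toReal / Real.sin θ * ‖F‖ := by
  have hsin := Real.sin_pos_of_mem_Ioo hθ
  have h1 := norm_sin_smul_mehlerLp_le (q := q) θ h
  rw [norm_smul, Real.norm_of_nonneg hsin.le] at h1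
  have h2 := norm_sub_mehlerLp_le q θ h'
  rw [abs_of_pos hθ.1] at h2
  have h3 : ‖mehlerLp μ θ G‖ ≤ (momentConst q).toReal / Real.sin θ * ‖F‖ := by
    rw [div_mul_eq_mul_div, le_div_iff₀ hsin, mul_comm]
    exact h1
  calc ‖G‖ = ‖(G - mehlerLp μ θ G) + mehlerLp μ θ G‖ := by rw [sub_add_cancel]
    _ ≤ _ := (norm_add_le _ _).trans (add_le_add h2 h3)

end Domain

/-! ### The Riesz transform and its converse inequality. -/

section Bounds

variable (p q : ℝ≥0∞) [hpq : p.HolderConjugate q] [Fact (1 ≤ p)] [hp : Fact (p ≠ ⊤)]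

theorem exists_clm_grad_pot [hq : Fact (q ≠ ⊤)] (c : ℕ) : ∃ C : ℝ, 0 ≤ C ∧
    ∀ (d : ℕ) (Ξ : Type) [NormedAddCommGroup Ξ] [InnerProductSpace ℝ Ξ] [CompleteSpace Ξ]
      (μ : Measure (WienerSpace d)) [Fact (IsWienerMeasure μ)],
      ∃ T : Lp Ξ p μ →L[ℝ] Lp (HTensor d Ξ) p μ, ‖T‖ ≤ C ∧
        ∀ F, (pot μ c 0 F, T F) ∈ gradGraph Ξ μ p := by
  obtain ⟨C, hC, h⟩ := exists_norm_pot_grad_le p q c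
  exact ⟨C, hC, fun d Ξ _ _ _ μ _ => exists_clm_gradGraph hC
    (fun z hz => pot_mem_gradGraph c 0 hz) fun z hz => h d Ξ μ z.1 z.2 hz⟩

/-- The half potential of `N` is tested against smooth `u`. In the weak identity half a power is
moved from the gradient term onto `v = ∇u`, where it forms the Riesz transform on `L^q`. The right
side then involves only full resolvents of `N` and `N'`, which stay bounded when `N` approximates
`((c+1)I + 𝓛)F`. -/
theorem exists_norm_pot_zero_le [Fact (1 ≤ q)] [hq : Fact (q ≠ ⊤)] (c : ℕ) : ∃ C : ℝ, 0 ≤ C ∧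
    ∀ (d : ℕ) (Ξ : Type) [NormedAddCommGroup Ξ] [InnerProductSpace ℝ Ξ] [CompleteSpace Ξ]
      (μ : Measure (WienerSpace d)) [Fact (IsWienerMeasure μ)]
      (N : Lp Ξ p μ) (N' : Lp (HTensor d Ξ) p μ), (N, N') ∈ gradGraph Ξ μ p →
      ‖pot μ c 0 N‖ ≤ (c + 1) * ‖pot μ c 1 N‖ + C * ‖pot μ (c + 1) 1 N'‖ := by
  have hqp : q.HolderConjugate p := hpq.symm
  obtain ⟨C, hC, h⟩ := exists_norm_pot_grad_le q p c
  refine ⟨C, hC, fun d Ξ _ _ _ μ _ N N' hN => ?_⟩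
  refine norm_le_of_forall_smoothGraph (q := q) (by positivity) ?_
  rintro ⟨u, v⟩ hu
  have hu' : (u, v) ∈ gradGraph Ξ μ q := Submodule.le_topologicalClosure _ hu
  have h1 := pairLp_eq_of_mem_gradGraph c (pot_mem_gradGraph c 0 hN) hu'
  have e1 : pot μ c 1 (pot μ c 0 N) = pot μ c 0 (pot μ c 1 N) := by
    rw [pot_pot, pot_pot]
  have e2 : pot μ (c + 1) 1 (pot μ (c + 1) 0 N') = pot μ (c + 1) 0 (pot μ (c + 1) 1 N') := by
    rw [pot_pot, pot_pot]
  rw [e1, e2, pairLp_pot (c + 1) 0] at h1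
  simp only at h1 ⊢
  rw [h1]
  have h2 : pairLp q (pot μ c 0 (pot μ c 1 N)) u ≤ ‖pot μ c 1 N‖ * ‖u‖ :=
    (le_abs_self _).trans ((abs_pairLp_le _ _).trans
      (mul_le_mul_of_nonneg_right (norm_pot_apply_le c 0 _) (norm_nonneg _)))
  have h3 : pairLp q (pot μ (c + 1) 1 N') (pot μ (c + 1) 0 v) ≤
      ‖pot μ (c + 1) 1 N'‖ * (C * ‖u‖) :=
    (le_abs_self _).trans ((abs_pairLp_le _ _).trans
      (mul_le_mul_of_nonneg_left (h d Ξ μ u v hu') (norm_nonneg _)))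
  have hc : (0 : ℝ) ≤ c + 1 := by positivity
  nlinarith [mul_le_mul_of_nonneg_left h2 hc]

/-- The difference quotients `N = (F - exp(-s) ouLp c s F)/s` approximate `((c+1)I + 𝓛)F`: their
resolvents tend to `F`, those of their gradients to `G`. By `exists_norm_pot_zero_le` the half
potentials of `N` are controlled by these resolvents, so a limit `Ψ` exists in the closed graph; the
relation that the half potential of the third entry is the first entry persists. -/
theorem exists_eq_pot_of_mem_gradGraph [Fact (1 ≤ q)] [hq : Fact (q ≠ ⊤)] (c : ℕ) :
    ∃ C : ℝ, 0 ≤ C ∧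
    ∀ (d : ℕ) (Ξ : Type) [NormedAddCommGroup Ξ] [InnerProductSpace ℝ Ξ] [CompleteSpace Ξ]
      (μ : Measure (WienerSpace d)) [Fact (IsWienerMeasure μ)]
      (F : Lp Ξ p μ) (G : Lp (HTensor d Ξ) p μ), (F, G) ∈ gradGraph Ξ μ p →
      ∃ Ψ : Lp Ξ p μ, pot μ c 0 Ψ = F ∧ ‖Ψ‖ ≤ C * (‖F‖ + ‖G‖) := by
  obtain ⟨C, hC, h⟩ := exists_norm_pot_zero_le p q c
  refine ⟨c + 1 + C, by positivity, fun d Ξ _ _ _ μ _ F G hFG => ?_⟩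
  let J : (Lp Ξ p μ × Lp (HTensor d Ξ) p μ) →L[ℝ]
      ((Lp Ξ p μ × Lp (HTensor d Ξ) p μ) × Lp Ξ p μ) :=
    ((pot μ c 1).prodMap (pot μ (c + 1) 1)).prod
      ((pot μ c 0).comp (ContinuousLinearMap.fst ℝ (Lp Ξ p μ) (Lp (HTensor d Ξ) p μ)))
  let S : Submodule ℝ ((Lp Ξ p μ × Lp (HTensor d Ξ) p μ) × Lp Ξ p μ) :=
    (gradGraph Ξ μ p).map J.toLinearMap
  have hS : ∀ z ∈ S, ‖z.2‖ ≤ (c + 1 + C) * ‖z.1‖ := by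
    rintro _ ⟨z, hz, rfl⟩
    refine (h d Ξ μ z.1 z.2 hz).trans ?_
    have h1 : ‖pot μ c 1 z.1‖ ≤ ‖(pot μ c 1 z.1, pot μ (c + 1) 1 z.2)‖ :=
      le_max_left _ _
    have h2 : ‖pot μ (c + 1) 1 z.2‖ ≤ ‖(pot μ c 1 z.1, pot μ (c + 1) 1 z.2)‖ :=
      le_max_right _ _
    change _ ≤ (c + 1 + C) * ‖(pot μ c 1 z.1, pot μ (c + 1) 1 z.2)‖
    rw [add_mul (c + 1 : ℝ)]
    gcongr
  have hx : (F, G) ∈ closure (Prod.fst ''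
      (S : Set ((Lp Ξ p μ × Lp (HTensor d Ξ) p μ) × Lp Ξ p μ))) := by
    refine mem_closure_of_tendsto
      ((tendsto_average_ouLp (μ := μ) c F).prodMk_nhds (tendsto_average_ouLp (μ := μ) (c + 1) G)) ?_
    filter_upwards [self_mem_nhdsWithin] with s (hs : 0 < s)
    have hN := (gradGraph Ξ μ p).smul_mem s⁻¹ ((gradGraph Ξ μ p).sub_mem hFG
      ((gradGraph Ξ μ p).smul_mem (Real.exp (-s)) (ouLp_mem_gradGraph c s hFG)))
    refine ⟨J _, ⟨_, hN, rfl⟩, ?_⟩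
    change (pot μ c 1 (s⁻¹ • (F - Real.exp (-s) • ouLp μ c s F)),
      pot μ (c + 1) 1 (s⁻¹ • (G - Real.exp (-s) • ouLp μ (c + 1) s G))) = _
    rw [map_smul, map_smul, pot_one_sub c hs.le, pot_one_sub (c + 1) hs.le]
  obtain ⟨Ψ, hΨ, hn⟩ := Submodule.exists_mem_topologicalClosure_of_mem_closure hS hx
  refine ⟨Ψ, ?_, hn.trans ?_⟩
  · have g1 : Continuous fun z : (Lp Ξ p μ × Lp (HTensor d Ξ) p μ) × Lp Ξ p μ => pot μ c 0 z.2 :=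
      (pot μ c 0).continuous.comp continuous_snd
    have g2 : Continuous fun z : (Lp Ξ p μ × Lp (HTensor d Ξ) p μ) × Lp Ξ p μ => z.1.1 :=
      continuous_fst.comp continuous_fst
    have hsub : (S : Set ((Lp Ξ p μ × Lp (HTensor d Ξ) p μ) × Lp Ξ p μ)) ⊆
        {z | pot μ c 0 z.2 = z.1.1} := by
      rintro _ ⟨z, hz, rfl⟩
      exact pot_pot c 0 0 z.1
    exact closure_minimal hsub (isClosed_eq g1 g2) hΨ
  · refine mul_le_mul_of_nonneg_left ?_ (by positivity)
    exact max_le (le_add_of_nonneg_right (norm_nonneg _)) (le_add_of_nonneg_left (norm_nonneg _))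

end Bounds

end Wiener

/-- An interpolation inequality for sequences, from consecutive three-term inequalities. -/
theorem exists_le_mul_add_of_three_term (K : ℝ → ℝ) (hK : ∀ ε, 0 < ε → 0 ≤ K ε) (k : ℕ) :
    ∀ ε : ℝ, 0 < ε → ∃ C : ℝ, 0 ≤ C ∧ ∀ a : ℕ → ℝ, (∀ i, 0 ≤ a i) →
      (∀ i, i + 2 ≤ k → ∀ ε, 0 < ε → a (i + 1) ≤ ε * a (i + 2) + K ε * a i) →
      ∀ i < k, a i ≤ ε * a k + C * a 0 := by
  induction k with
  | zero => exact fun ε _ => ⟨0, le_rfl, fun a _ _ i hi => absurd hi (Nat.not_lt_zero _)⟩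
  | succ k ih =>
    intro ε hε
    rcases Nat.eq_zero_or_pos k with rfl | hk
    · refine ⟨1, zero_le_one, fun a ha _ i hi => ?_⟩
      obtain rfl : i = 0 := by omega
      nlinarith [mul_nonneg hε.le (ha (0 + 1))]
    have hK0 := hK (ε / 2) (by linarith)
    -- Chosen so that `K(ε/2) η ≤ 1/2`: the top inequality bounds `a k` partly by itself, and half
    -- of it can be absorbed on the left.
    set η : ℝ := (2 * K (ε / 2) + 2)⁻¹ with hη
    have hη0 : 0 < η := by positivity
    have hηK : K (ε / 2) * η ≤ 1 / 2 := by
      rw [hη, ← div_eq_mul_inv, div_le_iff₀ (by positivity)]; linarith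
    obtain ⟨C₁, hC₁, h₁⟩ := ih η hη0
    obtain ⟨C₂, hC₂, h₂⟩ := ih 1 one_pos
    refine ⟨2 * (K (ε / 2) * C₁) + C₂, by positivity, fun a ha h i hi => ?_⟩
    have h' : ∀ i, i + 2 ≤ k → ∀ ε, 0 < ε → a (i + 1) ≤ ε * a (i + 2) + K ε * a i :=
      fun i hi => h i (by omega)
    have hk1 : a k ≤ ε / 2 * a (k + 1) + K (ε / 2) * a (k - 1) := by
      have := h (k - 1) (by omega) (ε / 2) (by linarith)
      rwa [show k - 1 + 1 = k by omega, show k - 1 + 2 = k + 1 by omega] at this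
    have hk2 := mul_le_mul_of_nonneg_left (h₁ a ha h' (k - 1) (by omega)) hK0
    have hk3 := mul_le_mul_of_nonneg_right hηK (ha k)
    have hak : a k ≤ ε * a (k + 1) + 2 * (K (ε / 2) * C₁) * a 0 := by nlinarith
    rcases Nat.lt_succ_iff_lt_or_eq.1 hi with hi | rfl
    · have := h₂ a ha h' i hi
      nlinarith
    · nlinarith [mul_nonneg hC₂ (ha 0)]

namespace Wiener

open OrnsteinUhlenbeck

instance instCompleteSpaceHPow (d : ℕ) : ∀ k, CompleteSpace (HPow d k)
  | 0 => inferInstanceAs (CompleteSpace ℝ)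
  | k + 1 =>
    letI := instCompleteSpaceHPow d k
    inferInstanceAs (CompleteSpace (HTensor d (HPow d k)))

/-! ### Iterated gradients and powers of the half potential. -/

section Iterated

variable {d : ℕ} {μ : Measure (WienerSpace d)} [hμ : Fact (IsWienerMeasure μ)]
  {p : ℝ≥0∞} [Fact (1 ≤ p)] [hp : Fact (p ≠ ⊤)]

theorem HasGrad.pot_pot {k : ℕ} {F : Lp (HPow d k) p μ} {G : Lp (HPow d (k + 1)) p μ}
    (h : HasGrad (Ξ := HPow d k) F G) :
    HasGrad (Ξ := HPow d k) (pot μ k 0 F) (pot (Ξ := HPow d (k + 1)) μ (k + 1) 0 G) :=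
  hasGrad_iff.2 (pot_mem_gradGraph k 0 (hasGrad_iff.1 h))

theorem HasGrad.unique (q : ℝ≥0∞) [hpq : p.HolderConjugate q] [hq : Fact (q ≠ ⊤)] {k : ℕ}
    {F : Lp (HPow d k) p μ} {G G' : Lp (HPow d (k + 1)) p μ}
    (h : HasGrad (Ξ := HPow d k) F G) (h' : HasGrad (Ξ := HPow d k) F G') : G = G' :=
  eq_of_mem_gradGraph (Ξ := HPow d k) q (hasGrad_iff.1 h) (hasGrad_iff.1 h')

theorem HasGrad.of_pot (q : ℝ≥0∞) [hpq : p.HolderConjugate q] [hq : Fact (q ≠ ⊤)] {k : ℕ}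
    {F : Lp (HPow d k) p μ} {G : Lp (HPow d (k + 1)) p μ}
    (h : HasGrad (Ξ := HPow d k) (pot μ k 0 F) (pot (Ξ := HPow d (k + 1)) μ (k + 1) 0 G)) :
    HasGrad (Ξ := HPow d k) F G :=
  hasGrad_iff.2 (mem_gradGraph_of_pot (Ξ := HPow d k) q k (hasGrad_iff.1 h))

theorem HasIterGrad.unique (q : ℝ≥0∞) [hpq : p.HolderConjugate q] [hq : Fact (q ≠ ⊤)]
    {φ : Lp ℝ p μ} : ∀ {k : ℕ} {G G' : Lp (HPow d k) p μ}, HasIterGrad φ k G →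
      HasIterGrad φ k G' → G = G'
  | 0, _, _, h, h' => Eq.trans h (Eq.symm h')
  | _ + 1, _, _, ⟨_, hA, hB⟩, ⟨_, hA', hB'⟩ => by
    obtain rfl := HasIterGrad.unique q hA hA'
    exact HasGrad.unique q hB hB'

theorem HasIterGrad.pot_pot {φ : Lp ℝ p μ} : ∀ {k : ℕ} {G : Lp (HPow d k) p μ},
    HasIterGrad φ k G → HasIterGrad (pot μ 0 0 φ) k (pot μ k 0 G)
  | 0, _, h => congrArg (pot (Ξ := ℝ) μ 0 0) h
  | _ + 1, _, ⟨_, hA, hB⟩ => ⟨_, hA.pot_pot, hB.pot_pot⟩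

theorem HasIterGrad.exists_of_le {φ : Lp ℝ p μ} {i : ℕ} : ∀ {k : ℕ} {G : Lp (HPow d k) p μ},
    HasIterGrad φ k G → i ≤ k → ∃ G', HasIterGrad φ i G'
  | 0, G, h, hi => by
    obtain rfl : i = 0 := by omega
    exact ⟨G, h⟩
  | k + 1, G, h, hi => by
    rcases Nat.lt_succ_iff_lt_or_eq.1 (Nat.lt_succ_of_le hi) with h1 | rfl
    · obtain ⟨G', hA, -⟩ := h
      exact hA.exists_of_le (Nat.lt_succ_iff.1 h1)
    · exact ⟨G, h⟩

theorem iterate_pot_injective (k : ℕ) : Function.Injective (pot (Ξ := ℝ) (p := p) μ 0 0)^[k] :=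
  (pot_zero_injective 0).iterate k

theorem norm_iterate_pot_le (k : ℕ) (ψ : Lp ℝ p μ) : ‖(pot μ 0 0)^[k] ψ‖ ≤ ‖ψ‖ := by
  induction k with
  | zero => exact le_rfl
  | succ k ih => rw [Function.iterate_succ_apply']; exact (norm_pot_apply_le 0 0 _).trans ih

theorem iterate_pot_succ (k : ℕ) (ψ : Lp ℝ p μ) : (pot μ 0 0)^[k + 1] ψ = pot μ 0 k ψ := by
  induction k with
  | zero => rfl
  | succ k ih => rw [Function.iterate_succ_apply', ih, OrnsteinUhlenbeck.pot_pot, zero_add]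

/-- Both are the same gamma integral, since `sin (ouAngle t) = √(1 - exp(-2t))` for `t > 0`. -/
theorem coeFn_pot_eq_ouNegPow (k : ℕ) (ψ : Lp ℝ p μ) :
    pot μ 0 k ψ =ᵐ[μ] ouNegPow μ (((k : ℝ) + 1) / 2) ψ := by
  refine (coeFn_pot 0 k (Lp.stronglyMeasurable ψ) (ae_eq_refl _)).trans
    (Eventually.of_forall fun x => ?_)
  have hα : ((k : ℝ) + 1) / 2 ≠ 0 := by positivity
  simp only [pow_zero, one_smul]
  rw [ouNegPow, if_neg hα, gammaHalf, integral_gammaMeasure (by positivity), ← integral_const_mul]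
  refine setIntegral_congr_fun measurableSet_Ioi fun t (ht : 0 < t) => ?_
  have hm : mehler μ (ouAngle t) ψ x = ouSemigroup μ t ψ x := by
    rw [mehler, ouSemigroup]
    simp only [mix_apply, cos_ouAngle ht.le]
    rw [ouAngle, Real.sin_arccos, ← Real.exp_nat_mul]
    push_cast
    ring_nf
  simp only [hm, smul_eq_mul]
  ring

/-- Expressing the power `k/2` as `k` half potentials, with the identity for `k = 0`, permits
induction by one derivative at a time. -/
theorem hasOUPow_iff (k : ℕ) (φ ψ : Lp ℝ p μ) :
    HasOUPow ((k : ℝ) / 2) φ ψ ↔ φ = (pot μ 0 0)^[k] ψ := by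
  rw [HasOUPow]
  cases k with
  | zero =>
    have : ouNegPow μ (((0 : ℕ) : ℝ) / 2) ψ = ψ := by ext x; simp [ouNegPow]
    rw [this, Function.iterate_zero, id]
    exact ⟨Lp.ext, fun h => by rw [h]⟩
  | succ k =>
    rw [iterate_pot_succ]
    have h := coeFn_pot_eq_ouNegPow (μ := μ) k ψ
    push_cast
    exact ⟨fun h' => Lp.ext (h'.trans h.symm), fun h' => by rw [h']; exact h⟩

end Iterated

/-! ### Meyer's inequalities of order `k`. -/

section Meyer

variable (p q : ℝ≥0∞) [hpq : p.HolderConjugate q] [Fact (1 ≤ p)] [hp : Fact (p ≠ ⊤)]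

/-- One more half potential turns the `k`-th gradient `G` into `pot μ k 0 G`, which lies in the
domain of the derivative by the Riesz bound with `c = k`; the constants multiply. -/
theorem exists_hasIterGrad_iterate_pot [hq : Fact (q ≠ ⊤)] (k : ℕ) : ∃ C : ℝ, 0 ≤ C ∧
    ∀ (d : ℕ) (μ : Measure (WienerSpace d)) [Fact (IsWienerMeasure μ)] (ψ : Lp ℝ p μ),
      ∃ G : Lp (HPow d k) p μ, HasIterGrad ((pot μ 0 0)^[k] ψ) k G ∧ ‖G‖ ≤ C * ‖ψ‖ := by
  induction k with
  | zero =>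
    refine ⟨1, zero_le_one, fun d μ _ ψ => ⟨ψ, rfl, ?_⟩⟩
    rw [one_mul]
    exact le_rfl
  | succ k ih =>
    obtain ⟨C, hC, h⟩ := ih
    obtain ⟨R, hR, hT⟩ := exists_clm_grad_pot p q k
    refine ⟨R * C, by positivity, fun d μ _ ψ => ?_⟩
    obtain ⟨G, hG, hGn⟩ := h d μ ψ
    obtain ⟨T, hTn, hTg⟩ := hT d (HPow d k) μ
    refine ⟨T G, ⟨pot μ k 0 G, ?_, hasGrad_iff.2 (hTg G)⟩, ?_⟩
    · rw [Function.iterate_succ_apply']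
      exact hG.pot_pot
    · rw [mul_assoc]
      exact T.le_of_opNorm_le_of_le hTn hGn

/-- One half potential is peeled off at all levels at once: each `D i` with `i ≤ k` is the half
potential, at level `i`, of some `Ψ i`. By `HasGrad.of_pot` the `Ψ i` are again the iterated
gradients of `Ψ 0`, now up to order `k`, so the induction hypothesis applies to them. -/
theorem exists_iterate_pot_eq [Fact (1 ≤ q)] [hq : Fact (q ≠ ⊤)] (k : ℕ) : ∃ C : ℝ, 0 ≤ C ∧
    ∀ (d : ℕ) (μ : Measure (WienerSpace d)) [Fact (IsWienerMeasure μ)] (φ : Lp ℝ p μ)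
      (D : (i : ℕ) → Lp (HPow d i) p μ), (∀ i ≤ k, HasIterGrad φ i (D i)) →
      ∃ ψ : Lp ℝ p μ, (pot μ 0 0)^[k] ψ = φ ∧ ‖ψ‖ ≤ C * ∑ i ∈ Finset.range (k + 1), ‖D i‖ := by
  induction k with
  | zero =>
    refine ⟨1, zero_le_one, fun d μ _ φ D hD => ⟨φ, rfl, ?_⟩⟩
    have : D 0 = φ := hD 0 le_rfl
    rw [one_mul, zero_add, Finset.sum_range_one, this]
    exact le_rfl
  | succ k ih =>
    obtain ⟨C, hC, h⟩ := ih
    choose R hR hRe using fun i => exists_eq_pot_of_mem_gradGraph p q i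
    refine ⟨C * ∑ i ∈ Finset.range (k + 1), 2 * R i,
      mul_nonneg hC (Finset.sum_nonneg fun i _ => by have := hR i; positivity),
      fun d μ _ φ D hD => ?_⟩
    have hstep : ∀ i ≤ k, HasGrad (Ξ := HPow d i) (D i) (D (i + 1)) := by
      intro i hi
      obtain ⟨G', hA, hB⟩ := hD (i + 1) (by omega)
      rwa [hA.unique q (hD i (by omega))] at hB
    have hex : ∀ i, ∃ Ψ : Lp (HPow d i) p μ, i ≤ k → pot μ i 0 Ψ = D i ∧
        ‖Ψ‖ ≤ R i * (‖D i‖ + ‖D (i + 1)‖) := by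
      intro i
      by_cases hi : i ≤ k
      · obtain ⟨Ψ, h1, h2⟩ := hRe i d (HPow d i) μ (D i) (D (i + 1)) (hasGrad_iff.1 (hstep i hi))
        exact ⟨Ψ, fun _ => ⟨h1, h2⟩⟩
      · exact ⟨0, fun h => absurd h hi⟩
    choose Ψ hΨ using hex
    have hΨg : ∀ i ≤ k, HasIterGrad (Ψ 0) i (Ψ i) := by
      intro i
      induction i with
      | zero => exact fun _ => rfl
      | succ i ihi =>
        intro hi
        refine ⟨Ψ i, ihi (by omega), HasGrad.of_pot q ?_⟩
        rw [(hΨ i (by omega)).1, (hΨ (i + 1) hi).1]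
        exact hstep i (by omega)
    obtain ⟨ψ, h1, h2⟩ := h d μ (Ψ 0) Ψ hΨg
    refine ⟨ψ, ?_, h2.trans ?_⟩
    · rw [Function.iterate_succ_apply', h1]
      exact (hΨ 0 (Nat.zero_le _)).1.trans (hD 0 (Nat.zero_le _))
    · rw [mul_assoc, Finset.sum_mul]
      refine mul_le_mul_of_nonneg_left (Finset.sum_le_sum fun i hi => ?_) hC
      have hi' : i < k + 1 := Finset.mem_range.1 hi
      refine (hΨ i (by omega)).2.trans ?_
      have hle : ∀ j < k + 2, ‖D j‖ ≤ ∑ i ∈ Finset.range (k + 1 + 1), ‖D i‖ := fun j hj =>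
        Finset.single_le_sum (f := fun i => ‖D i‖) (fun i _ => norm_nonneg _)
          (Finset.mem_range.2 hj)
      nlinarith [mul_le_mul_of_nonneg_left (add_le_add (hle i (by omega)) (hle (i + 1) (by omega)))
        (hR i)]

/-- Consecutive gradients obey the interpolation inequality with arbitrarily small weight on the
higher one: the angle `min(ε/(γ+1), 1)` makes `γθ ≤ ε` and keeps `sin θ` positive. -/
theorem exists_sum_norm_iterGrad_le [Fact (1 ≤ q)] [hq : Fact (q ≠ ⊤)] (k : ℕ) :
    ∃ C : ℝ, 0 ≤ C ∧
    ∀ (d : ℕ) (μ : Measure (WienerSpace d)) [Fact (IsWienerMeasure μ)] (φ : Lp ℝ p μ)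
      (D : (i : ℕ) → Lp (HPow d i) p μ), (∀ i ≤ k, HasIterGrad φ i (D i)) →
      ∑ i ∈ Finset.range (k + 1), ‖D i‖ ≤ C * (‖φ‖ + ‖D k‖) := by
  set γ := (momentConst p).toReal with hγ
  have hγ0 : 0 ≤ γ := ENNReal.toReal_nonneg
  let ϑ : ℝ → ℝ := fun ε => min (ε / (γ + 1)) 1
  have hϑ : ∀ ε, 0 < ε → ϑ ε ∈ Set.Ioo 0 Real.pi := fun ε hε =>
    ⟨lt_min (by positivity) one_pos, (min_le_right _ _).trans_lt (by linarith [Real.pi_gt_three])⟩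
  obtain ⟨C, hC, h⟩ := exists_le_mul_add_of_three_term
    (fun ε => (momentConst q).toReal / Real.sin (ϑ ε))
    (fun ε hε => div_nonneg ENNReal.toReal_nonneg (Real.sin_pos_of_mem_Ioo (hϑ ε hε)).le)
    k 1 one_pos
  refine ⟨k * (1 + C) + 1, by positivity, fun d μ _ φ D hD => ?_⟩
  have hstep : ∀ i < k, HasGrad (Ξ := HPow d i) (D i) (D (i + 1)) := by
    intro i hi
    obtain ⟨G', hA, hB⟩ := hD (i + 1) (by omega)
    rwa [hA.unique q (hD i (by omega))] at hB
  have h0 : ‖D 0‖ = ‖φ‖ := congrArg (fun F : Lp ℝ p μ => ‖F‖) (hD 0 (Nat.zero_le _))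
  have key := h (fun i => ‖D i‖) (fun i => norm_nonneg _) fun i hi ε hε => by
    have h1 := norm_grad_le (Ξ := HPow d i) q (hasGrad_iff.1 (hstep i (by omega)))
      (hasGrad_iff.1 (hstep (i + 1) (by omega))) (hϑ ε hε)
    refine h1.trans (add_le_add_left (mul_le_mul_of_nonneg_right ?_ (norm_nonneg _)) _)
    calc γ * ϑ ε ≤ γ * (ε / (γ + 1)) := by gcongr; exact min_le_left _ _
      _ = ε * (γ / (γ + 1)) := by ring
      _ ≤ ε := mul_le_of_le_one_right hε.le ((div_le_one (by positivity)).2 (by linarith))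
  rw [Finset.sum_range_succ]
  have hsum : ∑ i ∈ Finset.range k, ‖D i‖ ≤ k * ((1 + C) * (‖φ‖ + ‖D k‖)) := by
    refine (Finset.sum_le_card_nsmul _ _ _ fun i hi => ?_).trans_eq (by
      rw [Finset.card_range, nsmul_eq_mul])
    have := key i (Finset.mem_range.1 hi)
    simp only [h0] at this
    nlinarith [norm_nonneg φ, norm_nonneg (D k), mul_nonneg hC (norm_nonneg (D k))]
  nlinarith [norm_nonneg φ]

end Meyer

end Wiener

theorem mainTheorem1 (p : ℝ≥0∞) [Fact (1 ≤ p)] (hp1 : 1 < p) (hp : p < ⊤) :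
    (∃ c : ℝ, ∀ (d : ℕ) (μ : Measure (Wiener.WienerSpace d)), Wiener.IsWienerMeasure μ →
      ∃ T : Lp ℝ p μ →L[ℝ] Lp (Wiener.HTensor d ℝ) p μ, ‖T‖ ≤ c ∧
        ∀ φ : Lp ℝ p μ, ∃ u : Lp ℝ p μ,
          u =ᵐ[μ] Wiener.ouNegPow μ (1 / 2) φ ∧ Wiener.HasGrad u (T φ)) ∧
    (∀ k : ℕ, ∃ c C : ℝ, ∀ (d : ℕ) (μ : Measure (Wiener.WienerSpace d)),
      Wiener.IsWienerMeasure μ → ∀ φ : Lp ℝ p μ,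
        ((∃ ψ : Lp ℝ p μ, Wiener.HasOUPow ((k : ℝ) / 2) φ ψ) ↔ Wiener.MemSobolev k φ) ∧
        ∀ (ψ : Lp ℝ p μ) (D : (i : ℕ) → Lp (Wiener.HPow d i) p μ),
          Wiener.HasOUPow ((k : ℝ) / 2) φ ψ → (∀ i ≤ k, Wiener.HasIterGrad φ i (D i)) →
            ∑ i ∈ Finset.range (k + 1), ‖D i‖ ≤ c * ‖ψ‖ ∧
            ‖ψ‖ ≤ C * (‖φ‖ + ‖D k‖)) := by
  open Wiener OrnsteinUhlenbeck in
  have hpF : Fact (p ≠ ⊤) := ⟨hp.ne⟩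
  obtain ⟨q, hpq, hq⟩ : ∃ q : ℝ≥0∞, p.HolderConjugate q ∧ q ≠ ⊤ := by
    have h : p.HolderConjugate (ENNReal.conjExponent p) := .conjExponent hp1.le
    refine ⟨_, h, ?_⟩
    exact ((ENNReal.HolderConjugate.lt_top_iff_one_lt _ _).2 hp1).ne
  have hqF : Fact (q ≠ ⊤) := ⟨hq⟩
  have hq1 : Fact (1 ≤ q) := ⟨ENNReal.HolderConjugate.one_le q p⟩
  refine ⟨?_, fun k => ?_⟩
  · obtain ⟨C, -, h⟩ := exists_clm_grad_pot p q 0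
    refine ⟨C, fun d μ hμ => ?_⟩
    have : Fact (IsWienerMeasure μ) := ⟨hμ⟩
    obtain ⟨T, hT, hTg⟩ := h d ℝ μ
    refine ⟨T, hT, fun φ => ⟨pot μ 0 0 φ, ?_, hasGrad_iff.2 (hTg φ)⟩⟩
    simpa using coeFn_pot_eq_ouNegPow (μ := μ) 0 φ
  · choose A hA hAe using fun i => exists_hasIterGrad_iterate_pot p q i
    obtain ⟨B, hB, hBe⟩ := exists_iterate_pot_eq p q k
    obtain ⟨B', hB', hBe'⟩ := exists_sum_norm_iterGrad_le p q k
    -- The first constant adds the bounds for all orders `i ≤ k`; the second combines the bound by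
    -- all gradients with the interpolation inequality that leaves only the extreme ones.
    refine ⟨∑ i ∈ Finset.range (k + 1), A i, B * B', fun d μ hμ φ => ?_⟩
    have : Fact (IsWienerMeasure μ) := ⟨hμ⟩
    refine ⟨⟨?_, ?_⟩, fun ψ D hψ hD => ⟨?_, ?_⟩⟩
    · rintro ⟨ψ, hψ⟩
      obtain rfl := (hasOUPow_iff k φ ψ).1 hψ
      obtain ⟨G, hG, -⟩ := hAe k d μ ψ
      exact ⟨G, hG⟩
    · rintro ⟨G, hG⟩
      have hex : ∀ i, ∃ G' : Lp (HPow d i) p μ, i ≤ k → HasIterGrad φ i G' := by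
        intro i
        by_cases hi : i ≤ k
        · obtain ⟨G', hG'⟩ := hG.exists_of_le hi
          exact ⟨G', fun _ => hG'⟩
        · exact ⟨0, fun h => absurd h hi⟩
      choose D hD using hex
      obtain ⟨ψ, hψ, -⟩ := hBe d μ φ D hD
      exact ⟨ψ, (hasOUPow_iff k φ ψ).2 hψ.symm⟩
    · obtain rfl := (hasOUPow_iff k φ ψ).1 hψ
      rw [Finset.sum_mul]
      refine Finset.sum_le_sum fun i hi => ?_
      have hi' : i ≤ k := Nat.lt_succ_iff.1 (Finset.mem_range.1 hi)
      -- For order `i`, only `i` of the `k` half potentials are spent on derivatives; the remaining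
      -- `k - i` are contractions.
      obtain ⟨G, hG, hGn⟩ := hAe i d μ ((pot μ 0 0)^[k - i] ψ)
      rw [← Function.iterate_add_apply, Nat.add_sub_cancel' hi'] at hG
      rw [(hD i hi').unique q hG]
      exact hGn.trans (mul_le_mul_of_nonneg_left (norm_iterate_pot_le _ _) (hA i))
    · have h1 := (hasOUPow_iff k φ ψ).1 hψ
      obtain ⟨ψ', hψ', hn⟩ := hBe d μ φ D hD
      -- Injectivity of the half potential identifies the constructed preimage with the given one.
      obtain rfl : ψ' = ψ := iterate_pot_injective k (hψ'.trans h1)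
      rw [mul_assoc]
      exact hn.trans (mul_le_mul_of_nonneg_left (hBe' d μ φ D hD) hB)
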